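/- Let $\mathbb K$ be a principal ideal domain. All chain complexes are non-negatively graded complexes of $\mathbb K$-modules. **Definitions.** For a chain complex $C$ and a graded submodule $D_n\subseteq C_n$ (not necessarily a subcomplex), let $\omega(C,D)$ be the subcomplex of $C$ with components $\omega(C,D)_n=D_n\cap\partial^{-1}(D_{n-1})$. A small category $\mathcal C$ is regarded as a quiver whose vertices are the objects, whose arrows are the morphisms and whose degenerate arrows are the identity morphisms. A subquiver $Q$ of $\mathcal C$ consists of a set $Q_0$ of objects and a set $Q_1$ of morphisms, such that the source and the target of each arrow in $Q_1$ lie in $Q_0$ and $1_c\in Q_1$ for each $c\in Q_0$; put $Q_1^{\mathsf D}=\{1_c\mid c\in Q_0\}$. An embedded quiver is a pair $E=(\mathcal C,Q)$ of a small category and a subquiver of it. Let $\mathsf{nerve}(Q)_n\subseteq \mathsf{nerve}(\mathcal C)_n$ be the set of all composable sequences of $n$ morphisms from $Q_1$ (and $\mathsf{nerve}(Q)_0=Q_0$), let $N\mathcal C$ be the normalized chain complex of the simplicial module $\mathbb K[\mathsf{nerve}(\mathcal C)]$ (chains modulo degenerate chains), and let $NQ\subseteq N\mathcal C$ be the graded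 submodule that is the image of $\mathbb K[\mathsf{nerve}(Q)]$. Set $$\Omega E=\omega(N\mathcal C,NQ),\qquad H_n(E)=H_n(\Omega E).$$ The box product of $E=(\mathcal C,Q)$ and $E'=(\mathcal C',Q')$ is $E\square E'=(\mathcal C\times\mathcal C',Q\square Q')$, where $(Q\square Q')_0=Q_0\times Q_0'$ and $(Q\square Q')_1=(Q_1\times Q_1'^{\mathsf D})\cup(Q_1^{\mathsf D}\times Q'_1)$. **Statement.** (1) For any embedded quivers $E,E'$ there is an isomorphism of chain complexes $$\Omega(E\square E')\cong \Omega E\otimes\Omega E',$$ and for every $n\ge 0$ there is a short exact sequence $$0\to\bigoplus_{i+j=n}H_i(E)\otimes H_j(E')\to H_n(E\square E')\to\bigoplus_{i+j=n-1}\mathrm{Tor}_1^{\mathbb K}(H_i(E),H_j(E'))\to 0.$$ (2) A digraph is a pair $G=(V,A)$ with $A\subseteq V\times V$ containing all $(v,v)$. Let $\Omega G$ be $\Omega$ of the embedded quiver whose category has the set of objects $V$ and exactly one morphism between any two objects, and whose subquiver has the vertex set $V$ and the arrow set $A$; put $H_n(G)=H_n(\Omega G)$. Let $G\square G'$ be the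 digraph on $V\times V'$ with an edge from $(v,v')$ to $(w,w')$ if and only if ($(v,w)\in A$ and $v'=w'$) or ($v=w$ and $(v',w')\in A'$). Then for any digraphs $G,G'$ we have $\Omega(G\square G')\cong\Omega G\otimes\Omega G'$ as chain complexes, and for every $n\ge 0$ there is a short exact sequence as in (1) with $G$, $G'$, $G\square G'$ in place of $E$, $E'$, $E\square E'$. (3) For a group $G$ and a subset $X\subseteq G$ with $1\in X$ (a pointed subset of a group), let $\Omega(G,X)$ be $\Omega$ of the embedded quiver formed by $G$, regarded as a category with one object, and its subquiver with the set of arrows $X$; put $H_n(G,X)=H_n(\Omega(G,X))$. For pointed subsets of groups $(G,X)$, $(G',X')$ put $X\vee X'=(X\times 1)\cup(1\times X')\subseteq G\times G'$. Then there is an isomorphism of chain complexes $$\Omega(G\times G',X\vee X')\cong\Omega(G,X)\otimes\Omega(G',X'),$$ and for every $n\ge 0$ there is a short exact sequence $$0\to\bigoplus_{i+j=n}H_i(G,X)\otimes H_j(G',X')\to H_n(G\times G',X\vee X')\to\bigoplus_{i+j=n-1}\mathrm{Tor}_1^{\mathbb K}(H_i(G,X),H_j(G',X'))\to 0,$$ which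 is natural with respect to morphisms of pointed subsets of groups in both arguments (a morphism $(G,X)\to(L,Y)$ is a group homomorphism $f:G\to L$ with $f(X)\subseteq Y$). -/

import Mathlib

open CategoryTheory Limits MonoidalCategory Simplicial

universe v u

namespace GLMY

noncomputable section

/-! ### The complex `ω(C, D)` of a graded submodule of a chain complex -/

section Omega

variable {K : Type u} [CommRing K]

/-- For a graded submodule `D` of a chain complex `C`, the submodule `Dₙ ∩ ∂⁻¹(Dₙ₋₁)` of `Cₙ`.
(For `m ≠ n - 1` the map `C.d n m` is zero and the condition is void.) -/
def omegaSubmodule (C : ChainComplex (ModuleCat.{u} K) ℕ) (D : ∀ n, Submodule K (C.X n)) (n : ℕ) :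
    Submodule K (C.X n) :=
  D n ⊓ ⨅ m : ℕ, (D m).comap (C.d n m).hom

theorem mem_omegaSubmodule {C : ChainComplex (ModuleCat.{u} K) ℕ} {D : ∀ n, Submodule K (C.X n)}
    {n : ℕ} {x : C.X n} : x ∈ omegaSubmodule C D n ↔ x ∈ D n ∧ ∀ m, C.d n m x ∈ D m := by
  simp [omegaSubmodule]

theorem d_mem_omegaSubmodule (C : ChainComplex (ModuleCat.{u} K) ℕ)
    (D : ∀ n, Submodule K (C.X n)) (i j : ℕ) (x : C.X i) (hx : x ∈ omegaSubmodule C D i) :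
    (C.d i j).hom x ∈ omegaSubmodule C D j := by
  rw [mem_omegaSubmodule] at hx ⊢
  refine ⟨hx.2 j, fun m => ?_⟩
  have h : C.d j m (C.d i j x) = 0 := by
    rw [← ConcreteCategory.comp_apply, C.d_comp_d]; rfl
  rw [h]
  exact zero_mem _

/-- The maximal subcomplex `ω(C, D)` of `C` whose components are contained in `D`. -/
def omegaComplex (C : ChainComplex (ModuleCat.{u} K) ℕ) (D : ∀ n, Submodule K (C.X n)) :
    ChainComplex (ModuleCat.{u} K) ℕ where
  X n := ModuleCat.of K (omegaSubmodule C D n)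
  d i j := ModuleCat.ofHom ((C.d i j).hom.restrict (d_mem_omegaSubmodule C D i j))
  shape i j h := by
    ext x
    change (C.d i j).hom x.1 = 0
    rw [C.shape i j h]; rfl
  d_comp_d' i j k _ _ := by
    ext x
    change C.d j k (C.d i j x.1) = 0
    rw [← ConcreteCategory.comp_apply, C.d_comp_d]; rfl

/-- The map `ω(C, D) ⟶ ω(C', D')` induced by a chain map which takes `D` to `D'`. -/
def omegaMap {C C' : ChainComplex (ModuleCat.{u} K) ℕ} {D : ∀ n, Submodule K (C.X n)}
    {D' : ∀ n, Submodule K (C'.X n)} (f : C ⟶ C') (hf : ∀ n, ∀ x ∈ D n, (f.f n).hom x ∈ D' n) :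
    omegaComplex C D ⟶ omegaComplex C' D' where
  f n := ModuleCat.ofHom ((f.f n).hom.restrict (p := omegaSubmodule C D n)
    (q := omegaSubmodule C' D' n) (fun x hx => by
      rw [mem_omegaSubmodule] at hx ⊢
      refine ⟨hf n x hx.1, fun m => ?_⟩
      have h : C'.d n m (f.f n x) = f.f m (C.d n m x) := by
        rw [← ConcreteCategory.comp_apply, ← ConcreteCategory.comp_apply, f.comm]
      change C'.d n m (f.f n x) ∈ D' m
      rw [h]
      exact hf m _ (hx.2 m)))
  comm' i j _ := by
    ext x
    apply Subtype.ext
    change C'.d i j (f.f i x.1) = f.f j (C.d i j x.1)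
    rw [← ConcreteCategory.comp_apply, ← ConcreteCategory.comp_apply, f.comm]

end Omega

/-! ### Path pairs of sets -/

/-- A path pair of sets: a simplicial set `X` together with a path subset `Y`, that is, subsets
`Yₙ ⊆ Xₙ` closed under all degeneracy maps and under the exterior face maps `d₀`, `dₙ`. -/
structure PathPair where
  X : SSet.{u}
  Y : ∀ n : ℕ, Set (X _⦋n⦌)
  σ_mem : ∀ (n : ℕ) (i : Fin (n + 1)) (x : X _⦋n⦌), x ∈ Y n → X.σ i x ∈ Y (n + 1)
  δ_zero_mem : ∀ (n : ℕ) (x : X _⦋n + 1⦌), x ∈ Y (n + 1) → X.δ 0 x ∈ Y n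
  δ_last_mem : ∀ (n : ℕ) (x : X _⦋n + 1⦌), x ∈ Y (n + 1) → X.δ (Fin.last (n + 1)) x ∈ Y n

namespace PathPair

/-- A morphism of path pairs `(X, Y) ⟶ (X', Y')`: a simplicial map which takes `Y` to `Y'`. -/
structure Hom (S S' : PathPair.{u}) where
  map : S.X ⟶ S'.X
  map_mem : ∀ (n : ℕ) (x : S.X _⦋n⦌), x ∈ S.Y n → map.app _ x ∈ S'.Y n

variable (K : Type u) [CommRing K]

/-- The class in `N(K[X])ₙ = C(K[X])ₙ / D(K[X])ₙ` of an `n`-simplex `x` of `X`. -/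
def chainClass (X : SSet.{u}) {n : ℕ} (x : X _⦋n⦌) :
    (X.normalizedChainComplex (ModuleCat.of K K)).X n :=
  X.ιNormalizedChainComplex (R := ModuleCat.of K K) x (1 : K)

/-- The image of `K[Yₙ]` in `N(K[X])ₙ`. -/
def chainSubmodule (S : PathPair.{u}) (n : ℕ) :
    Submodule K ((S.X.normalizedChainComplex (ModuleCat.of K K)).X n) :=
  Submodule.span K {z | ∃ y ∈ S.Y n, z = chainClass K S.X y}

/-- The complex `Ω(X, Y)` of a path pair of sets. -/
def Omega (S : PathPair.{u}) : ChainComplex (ModuleCat.{u} K) ℕ :=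
  omegaComplex (S.X.normalizedChainComplex (ModuleCat.of K K)) (S.chainSubmodule K)

/-- The chain map induced on `Ω` by a morphism of path pairs. -/
def Hom.omegaMap {S S' : PathPair.{u}} (f : Hom S S') : S.Omega K ⟶ S'.Omega K :=
  GLMY.omegaMap (SSet.normalizedChainComplexMap f.map (ModuleCat.of K K)) (fun n x hx => by
    refine Submodule.span_induction (p := fun x _ =>
      ((SSet.normalizedChainComplexMap f.map (ModuleCat.of K K)).f n).hom x ∈
        S'.chainSubmodule K n) ?_ ?_ ?_ ?_ hx
    · rintro _ ⟨y, hy, rfl⟩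
      refine Submodule.subset_span ⟨f.map.app _ y, f.map_mem n y hy, ?_⟩
      change ((SSet.normalizedChainComplexMap f.map (ModuleCat.of K K)).f n)
        (S.X.ιNormalizedChainComplex (R := ModuleCat.of K K) y (1 : K)) = _
      rw [← ConcreteCategory.comp_apply, SSet.ι_normalizedChainComplexMap_f]
      rfl
    · rw [map_zero]; exact zero_mem _
    · intro a b _ _ ha hb
      rw [map_add]; exact add_mem ha hb
    · intro c a _ ha
      rw [map_smul]; exact Submodule.smul_mem _ c ha)

end PathPair

/-! ### Embedded quivers -/

/-- A subquiver of a category `C`, where `C` is regarded as a quiver with degenerate arrows: the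
vertices are the objects of `C`, the arrows are the morphisms of `C`, and the degenerate arrow at a
vertex is its identity morphism. -/
structure SubquiverOf (C : Type u) [Category.{v} C] where
  vert : Set C
  arr : Set (Arrow C)
  left_mem : ∀ a ∈ arr, a.left ∈ vert
  right_mem : ∀ a ∈ arr, a.right ∈ vert
  id_mem : ∀ c ∈ vert, Arrow.mk (𝟙 c) ∈ arr

namespace SubquiverOf

variable {C : Type u} [Category.{v} C]

/-- The degenerate arrows of a subquiver: the identities of its vertices. -/
def degArr (Q : SubquiverOf C) : Set (Arrow C) :=
  {a | ∃ c ∈ Q.vert, a = Arrow.mk (𝟙 c)}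

/-- A chain of `n` composable morphisms of `C` is an `n`-path in the subquiver `Q` if its vertices
are vertices of `Q` and its `n` consecutive morphisms are arrows of `Q`. -/
def IsPath (Q : SubquiverOf C) {n : ℕ} (F : ComposableArrows C n) : Prop :=
  (∀ i, F.obj i ∈ Q.vert) ∧ ∀ i : Fin n, Arrow.mk (F.map (homOfLE i.castSucc_le_succ)) ∈ Q.arr

/-- The `n`-paths in a subquiver, as a subset of the `n`-simplices of the nerve. -/
def paths (Q : SubquiverOf C) (n : ℕ) : Set ((nerve C) _⦋n⦌) :=
  {F | Q.IsPath (show ComposableArrows C n from F)}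

theorem map_mem_paths (Q : SubquiverOf C) {m n : ℕ} (f : ⦋m⦌ ⟶ ⦋n⦌)
    (hf : ∀ i : Fin m, ((f i.succ : Fin (n + 1)) : ℕ) ≤ (f i.castSucc : Fin (n + 1)) + 1)
    (F : (nerve C) _⦋n⦌) (hF : F ∈ Q.paths n) : (nerve C).map f.op F ∈ Q.paths m := by
  have key : ∀ (F : ComposableArrows C n) (_ : Q.IsPath F) (a b : Fin (n + 1)) (h : a ≤ b),
      (b : ℕ) ≤ a + 1 → Arrow.mk (F.map (homOfLE h)) ∈ Q.arr := by
    intro F hF a b h hb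
    rcases h.eq_or_lt with rfl | h'
    · have h1 : homOfLE h = 𝟙 a := rfl
      rw [h1, CategoryTheory.Functor.map_id]
      exact Q.id_mem _ (hF.1 a)
    · have h1 : (a : ℕ) < b := h'
      have ha : (a : ℕ) < n := by have := b.2; omega
      have h2 : b = (⟨a, ha⟩ : Fin n).succ := Fin.ext (by simp; omega)
      subst h2
      exact hF.2 ⟨a, ha⟩
  exact ⟨fun i => hF.1 (f i), fun i => key F hF _ _ _ (hf i)⟩

end SubquiverOf

/-- An embedded quiver `(C, Q)`: a category together with a subquiver. -/
structure EmbeddedQuiver where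
  C : Type u
  [cat : Category.{v} C]
  Q : SubquiverOf C

attribute [instance] EmbeddedQuiver.cat

namespace EmbeddedQuiver

/-- A morphism of embedded quivers: a functor which takes the one subquiver to the other. -/
structure Hom (E E' : EmbeddedQuiver.{v, u}) where
  functor : E.C ⥤ E'.C
  obj_mem : ∀ c ∈ E.Q.vert, functor.obj c ∈ E'.Q.vert
  arr_mem : ∀ a ∈ E.Q.arr, functor.mapArrow.obj a ∈ E'.Q.arr

/-- The path pair of sets `(nerve C, nerve Q)` of an embedded quiver `(C, Q)`. -/
def pathPair (E : EmbeddedQuiver.{v, u}) : PathPair.{max u v} where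
  X := nerve E.C
  Y := E.Q.paths
  σ_mem n i x hx := E.Q.map_mem_paths (SimplexCategory.σ i) (fun j => by
    change (i.predAbove j.succ : ℕ) ≤ (i.predAbove j.castSucc : ℕ) + 1
    have h : (j.succ : ℕ) = j + 1 := rfl
    have h' : (j.castSucc : ℕ) = j := rfl
    rw [Fin.predAbove, Fin.predAbove]
    split_ifs <;> simp <;> grind) x hx
  δ_zero_mem n x hx := E.Q.map_mem_paths (SimplexCategory.δ 0) (fun j => by
    change ((0 : Fin (n + 2)).succAbove j.succ : ℕ) ≤ ((0 : Fin (n + 2)).succAbove j.castSucc) + 1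
    simp) x hx
  δ_last_mem n x hx := E.Q.map_mem_paths (SimplexCategory.δ (Fin.last (n + 1))) (fun j => by
    change ((Fin.last (n + 1)).succAbove j.succ : ℕ) ≤
      ((Fin.last (n + 1)).succAbove j.castSucc) + 1
    simp) x hx

/-- The morphism of path pairs induced by a morphism of embedded quivers. -/
def Hom.pathPairHom {E E' : EmbeddedQuiver.{v, u}} (f : Hom E E') :
    E.pathPair.Hom E'.pathPair where
  map := nerveMap f.functor
  map_mem _ _ hx := ⟨fun i => f.obj_mem _ (hx.1 i), fun i => f.arr_mem _ (hx.2 i)⟩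

/-- The chain complex `Ω(C, Q)` of an embedded quiver; its homology is the GLMY-homology. -/
def Omega (K : Type (max u v)) [CommRing K] (E : EmbeddedQuiver.{v, u}) :
    ChainComplex (ModuleCat.{max u v} K) ℕ :=
  E.pathPair.Omega K

/-- The chain map induced on `Ω` by a morphism of embedded quivers. -/
def Hom.omegaMap (K : Type (max u v)) [CommRing K] {E E' : EmbeddedQuiver.{v, u}} (f : Hom E E') :
    E.Omega K ⟶ E'.Omega K :=
  f.pathPairHom.omegaMap K

/-- The box product `(C × C', Q □ Q')`, where `Q □ Q'` has the vertices `Q₀ × Q'₀` and the arrows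
`(Q₁ × (degenerate arrows of Q')) ∪ ((degenerate arrows of Q) × Q'₁)`. -/
def box (E E' : EmbeddedQuiver.{v, u}) : EmbeddedQuiver.{v, u} where
  C := E.C × E'.C
  Q :=
    { vert := {p | p.1 ∈ E.Q.vert ∧ p.2 ∈ E'.Q.vert}
      arr := {a |
        ((CategoryTheory.Prod.fst E.C E'.C).mapArrow.obj a ∈ E.Q.arr ∧
          (CategoryTheory.Prod.snd E.C E'.C).mapArrow.obj a ∈ E'.Q.degArr) ∨
        ((CategoryTheory.Prod.fst E.C E'.C).mapArrow.obj a ∈ E.Q.degArr ∧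
          (CategoryTheory.Prod.snd E.C E'.C).mapArrow.obj a ∈ E'.Q.arr)}
      left_mem := by
        rintro a (⟨h, c, hc, h'⟩ | ⟨⟨c, hc, h'⟩, h⟩)
        · refine ⟨E.Q.left_mem _ h, ?_⟩
          have h1 : a.left.2 = c := congrArg (fun b : Arrow E'.C => b.left) h'
          rw [h1]; exact hc
        · refine ⟨?_, E'.Q.left_mem _ h⟩
          have h1 : a.left.1 = c := congrArg (fun b : Arrow E.C => b.left) h'
          rw [h1]; exact hc
      right_mem := by
        rintro a (⟨h, c, hc, h'⟩ | ⟨⟨c, hc, h'⟩, h⟩)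
        · refine ⟨E.Q.right_mem _ h, ?_⟩
          have h1 : a.right.2 = c := congrArg (fun b : Arrow E'.C => b.right) h'
          rw [h1]; exact hc
        · refine ⟨?_, E'.Q.right_mem _ h⟩
          have h1 : a.right.1 = c := congrArg (fun b : Arrow E.C => b.right) h'
          rw [h1]; exact hc
      id_mem := fun p hp => Or.inl ⟨E.Q.id_mem _ hp.1, p.2, hp.2, rfl⟩ }

end EmbeddedQuiver

/-! ### Digraphs and pointed subsets of groups -/

/-- A digraph `(V, E)` with `E ⊆ V × V` containing the diagonal. -/
structure DiagDigraph where
  V : Type u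
  E : Set (V × V)
  diag_mem : ∀ v, (v, v) ∈ E

namespace DiagDigraph

/-- The embedded quiver of a digraph `G`: the subquiver of all edges of `G` in the category with
the set of objects `V` and exactly one morphism `v ⟶ w` for all `v`, `w`. -/
def embeddedQuiver (G : DiagDigraph.{u}) : EmbeddedQuiver.{0, u} where
  C := Codiscrete G.V
  Q :=
    { vert := Set.univ
      arr := {a | (a.left.as, a.right.as) ∈ G.E}
      left_mem := fun _ _ => Set.mem_univ _
      right_mem := fun _ _ => Set.mem_univ _
      id_mem := fun c _ => G.diag_mem c.as }

/-- The chain complex `Ω(G)` of a digraph. -/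
def Omega (K : Type u) [CommRing K] (G : DiagDigraph.{u}) : ChainComplex (ModuleCat.{u} K) ℕ :=
  G.embeddedQuiver.Omega K

/-- The box product (Cartesian product) of digraphs. -/
def box (G G' : DiagDigraph.{u}) : DiagDigraph.{u} where
  V := G.V × G'.V
  E := {e | ((e.1.1, e.2.1) ∈ G.E ∧ e.1.2 = e.2.2) ∨ (e.1.1 = e.2.1 ∧ (e.1.2, e.2.2) ∈ G'.E)}
  diag_mem v := Or.inl ⟨G.diag_mem v.1, rfl⟩

end DiagDigraph

/-- A pointed subset `(G, X)` of a group: a subset `X ⊆ G` with `1 ∈ X`. -/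
structure PointedSubset where
  G : Type u
  [group : Group G]
  X : Set G
  one_mem : (1 : G) ∈ X

attribute [instance] PointedSubset.group

namespace PointedSubset

/-- A morphism of pointed subsets of groups: a homomorphism `G →* G'` which takes `X` to `X'`. -/
structure Hom (P P' : PointedSubset.{u}) where
  hom : P.G →* P'.G
  hom_mem : ∀ x ∈ P.X, hom x ∈ P'.X

/-- `(G, X)` as an embedded quiver: the group `G` is regarded as a category with one object, and
`X` as its subquiver with the arrows `x ∈ X`. -/
def embeddedQuiver (P : PointedSubset.{u}) : EmbeddedQuiver.{u, 0} where
  C := SingleObj P.G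
  Q :=
    { vert := Set.univ
      arr := {a | (show P.G from a.hom) ∈ P.X}
      left_mem := fun _ _ => Set.mem_univ _
      right_mem := fun _ _ => Set.mem_univ _
      id_mem := fun _ _ => P.one_mem }

/-- The morphism of embedded quivers induced by a morphism of pointed subsets of groups. -/
def Hom.embeddedQuiverHom {P P' : PointedSubset.{u}} (f : Hom P P') :
    P.embeddedQuiver.Hom P'.embeddedQuiver where
  functor := f.hom.toFunctor
  obj_mem _ _ := Set.mem_univ _
  arr_mem _ ha := f.hom_mem _ ha

/-- The chain complex `Ω(G, X)`. -/
def Omega (K : Type u) [CommRing K] (P : PointedSubset.{u}) : ChainComplex (ModuleCat.{u} K) ℕ :=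
  P.embeddedQuiver.Omega K

/-- The chain map `Ω(G, X) ⟶ Ω(G', X')` induced by a morphism. -/
def Hom.omegaMap (K : Type u) [CommRing K] {P P' : PointedSubset.{u}} (f : Hom P P') :
    P.Omega K ⟶ P'.Omega K :=
  f.embeddedQuiverHom.omegaMap K

/-- `(G × G', X ∨ X')` with `X ∨ X' = (X × 1) ∪ (1 × X')`. -/
def wedge (P P' : PointedSubset.{u}) : PointedSubset.{u} where
  G := P.G × P'.G
  X := P.X ×ˢ {1} ∪ {1} ×ˢ P'.X
  one_mem := Or.inl ⟨P.one_mem, rfl⟩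

/-- The morphism `f × f'` on `(G × G', X ∨ X')`. -/
def Hom.wedge {P P' L L' : PointedSubset.{u}} (f : Hom P L) (f' : Hom P' L') :
    (P.wedge P').Hom (L.wedge L') where
  hom := f.hom.prodMap f'.hom
  hom_mem := by
    rintro ⟨x, y⟩ (⟨hx, hy⟩ | ⟨hx, hy⟩)
    · exact Or.inl ⟨f.hom_mem _ hx, by
        rw [Set.mem_singleton_iff] at hy ⊢
        change f'.hom y = 1
        rw [show y = 1 from hy, map_one]⟩
    · exact Or.inr ⟨by
        rw [Set.mem_singleton_iff] at hx ⊢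
        change f.hom x = 1
        rw [show x = 1 from hx, map_one], f'.hom_mem _ hy⟩

end PointedSubset

/-! ### The outer terms of the Künneth sequence -/

section Kunneth

variable {K : Type u} [CommRing K]

/-- The pairs `(i, j)` with `i + j = n`. -/
abbrev SumPairs (n : ℕ) : Type := {p : ℕ × ℕ // p.1 + p.2 = n}

/-- The pairs `(i, j)` with `i + j = n - 1` (none for `n = 0`). -/
abbrev PredSumPairs (n : ℕ) : Type := {p : ℕ × ℕ // p.1 + p.2 + 1 = n}

instance (n : ℕ) : Finite (SumPairs n) :=
  Finite.of_injective
    (fun p => ((⟨p.1.1, by omega⟩, ⟨p.1.2, by omega⟩) : Fin (n + 1) × Fin (n + 1)))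
    (fun p q h => by
      simp only [Prod.mk.injEq, Fin.mk.injEq] at h
      exact Subtype.ext (Prod.ext h.1 h.2))

instance (n : ℕ) : Finite (PredSumPairs n) :=
  Finite.of_injective
    (fun p => ((⟨p.1.1, by omega⟩, ⟨p.1.2, by omega⟩) : Fin (n + 1) × Fin (n + 1)))
    (fun p q h => by
      simp only [Prod.mk.injEq, Fin.mk.injEq] at h
      exact Subtype.ext (Prod.ext h.1 h.2))

/-- `⨁_{i + j = n} Hᵢ(A) ⊗ Hⱼ(B)`. -/
def kunnethTensor (A B : ChainComplex (ModuleCat.{u} K) ℕ) (n : ℕ) : ModuleCat.{u} K :=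
  ⨁ fun p : SumPairs n => A.homology p.1.1 ⊗ B.homology p.1.2

/-- The map on `⨁_{i + j = n} Hᵢ(A) ⊗ Hⱼ(B)` induced by two chain maps. -/
def kunnethTensorMap {A A' B B' : ChainComplex (ModuleCat.{u} K) ℕ} (f : A ⟶ A') (g : B ⟶ B')
    (n : ℕ) : kunnethTensor A B n ⟶ kunnethTensor A' B' n :=
  biproduct.map fun p =>
    HomologicalComplex.homologyMap f p.1.1 ⊗ₘ HomologicalComplex.homologyMap g p.1.2

/-- `⨁_{i + j = n - 1} Tor₁(Hᵢ(A), Hⱼ(B))`. -/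
def kunnethTor (A B : ChainComplex (ModuleCat.{u} K) ℕ) (n : ℕ) : ModuleCat.{u} K :=
  ⨁ fun p : PredSumPairs n =>
    ((Tor (ModuleCat.{u} K) 1).obj (A.homology p.1.1)).obj (B.homology p.1.2)

/-- The map on `⨁_{i + j = n - 1} Tor₁(Hᵢ(A), Hⱼ(B))` induced by two chain maps. -/
def kunnethTorMap {A A' B B' : ChainComplex (ModuleCat.{u} K) ℕ} (f : A ⟶ A') (g : B ⟶ B')
    (n : ℕ) : kunnethTor A B n ⟶ kunnethTor A' B' n :=
  biproduct.map fun p =>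
    ((Tor (ModuleCat.{u} K) 1).map (HomologicalComplex.homologyMap f p.1.1)).app _ ≫
      ((Tor (ModuleCat.{u} K) 1).obj _).map (HomologicalComplex.homologyMap g p.1.2)

/-- The two maps `a`, `b` form a short exact sequence
`0 ⟶ M₁ ⟶ M₂ ⟶ M₃ ⟶ 0`. -/
def IsShortExact {M₁ M₂ M₃ : ModuleCat.{u} K} (a : M₁ ⟶ M₂) (b : M₂ ⟶ M₃) : Prop :=
  ∃ w : a ≫ b = 0, (ShortComplex.mk a b w).ShortExact

end Kunneth

end

end GLMY

namespace GLMY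

noncomputable section

open scoped TensorProduct

/-! ### Submodules of free modules over a principal ideal domain -/

/-! In a box product every step of a path is horizontal (its second component is an identity) or
vertical (its first component is an identity), so a path is a lattice path over a pair of simplices.
The Alexander–Whitney map AW sends a simplex to the sum over `i + j = n` of (front `i`-face of the
first component) ⊗ (back `j`-face of the second). The isomorphism is the restriction of AW to `Ω`.
The argument is carried out once, for path pairs related by `IsBox`; embedded quivers, digraphs and
pointed subsets of groups are then instances.

The key fact is `PathPair.face_mem`: for a chain `u` in `Ω`, each single face of `u`, and not only
the boundary, is a chain of paths. A simplex whose edge `k` is not an arrow can be a face of a path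
only by omission of the vertex `k + 1`, so its coefficient in that face cannot be cancelled by other
faces.

AW lands in `Ω ⊗ Ω'`. It is a chain map and takes chains of paths to `D ⊗ D'`, the tensor products
of chains of paths. An element which lies in `D ⊗ D'` together with its boundary comes from `Ω ⊗ Ω'`
(`mem_range_tensorι_of_d`), because `Ω` is cut out of `D` by a kernel and the modules involved are
flat. Flatness holds since submodules of free modules over a principal ideal domain are free.

AW is injective on `Ω`. If a path has a vertical step followed by a horizontal one, the face
omitting the vertex between them has a diagonal edge, hence is not a path, and the only two paths
with this face are the given one and the one with the two steps interchanged. By `face_mem` their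
coefficients in `u` are opposite (`coeff_add_coeff_swap`). Such interchanges sort a path into
horizontal steps followed by vertical ones, and the coefficient of a sorted path is read off from
`AW u` (`coeff_eq_zero_of_sorted`).

AW maps `Ω` onto `Ω ⊗ Ω'`. The shuffle product of two chains in `Ω` is again in `Ω`: in an inner
face, shuffles with two steps of different type cancel in pairs, and the others give faces of a
factor, covered by `face_mem`. AW maps the shuffle product of `a` and `b` to `a ⊗ b` up to sign.
That the shuffle product commutes with boundaries is never needed, because AW is the chain map.

The Künneth sequence of complexes `A`, `B` with `B` free comes from the degreewise split sequence of
cycles, chains and boundaries of `B`, tensored with `A`. The outer complexes have flat terms and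
zero differential on the right factor, so their homology is `H(A)` tensored with cycles or
boundaries. The connecting map is, up to sign, the inclusion of boundaries in cycles tensored with
`H(A)`. Its cokernel gives the tensor terms, and its kernel gives `Tor₁`, as boundaries and cycles
form a free resolution of `H(B)`. Every step is natural, in particular AW, which yields the
naturality in (3). -/

theorem free_submodule_finsupp {R ι : Type*} [CommRing R] [IsDomain R] [IsPrincipalIdealRing R]
    (N : Submodule R (ι →₀ R)) : Module.Free R N := by
  classical
  -- For a well-order of the index set, a nonzero vector has a leading index, the maximum of its
  -- support. `I i` is the ideal of coefficients at `i` of vectors in `N` supported up to `i`. The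
  -- lifts `m i` of its generator, for those `i` with nonzero generator, form the basis.
  obtain ⟨_, _⟩ := exists_wellFoundedLT ι
  let F (i : ι) : Submodule R (ι →₀ R) := N ⊓ Finsupp.supported R R (Set.Iic i)
  let I (i : ι) : Ideal R := (F i).map (Finsupp.lapply i)
  let a (i : ι) : R := Submodule.IsPrincipal.generator (I i)
  have ha : ∀ i, ∃ m ∈ F i, m i = a i := fun i =>
    Submodule.mem_map.1 (Submodule.IsPrincipal.generator_mem (I i))
  choose m hm hma using ha
  have hle : ∀ i j, i < j → m i j = 0 := fun i j hij => by
    by_contra h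
    exact absurd ((Finsupp.mem_supported R _).1 (hm i).2 (Finsupp.mem_support_iff.2 h))
      (not_le.2 hij)
  let b : {i // a i ≠ 0} → N := fun i => ⟨m i, (hm i).1⟩
  have hli : LinearIndependent R b := by
    refine LinearIndependent.of_comp N.subtype ?_
    change LinearIndependent R (fun i : {i // a i ≠ 0} => m i)
    refine linearIndependent_iff.2 fun l hl => ?_
    by_contra hne
    have hs : l.support.Nonempty := Finsupp.support_nonempty_iff.2 hne
    -- At the largest index of the combination only `m j` has a nonzero coefficient, so the
    -- coefficient there is `l j * a j`.
    let j := l.support.max' hs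
    have h1 : (Finsupp.linearCombination R (fun i : {i // a i ≠ 0} => m i) l) j.1 = 0 := by
      rw [hl]; rfl
    rw [Finsupp.linearCombination_apply, Finsupp.sum, Finsupp.finsetSum_apply,
      Finset.sum_eq_single j] at h1
    · rw [Finsupp.smul_apply, hma, smul_eq_mul] at h1
      rcases mul_eq_zero.1 h1 with h | h
      · exact Finsupp.mem_support_iff.1 (l.support.max'_mem hs) h
      · exact j.2 h
    · intro k hk hkj
      have : k < j := lt_of_le_of_ne (l.support.le_max' k hk) hkj
      rw [Finsupp.smul_apply, hle k j this, smul_zero]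
    · intro h; exact absurd (l.support.max'_mem hs) h
  -- Transfinite induction on a bound for the support: subtracting a multiple of `m i` kills the
  -- coefficient at `i`, and the leading index of the difference is then smaller.
  have hsp : ∀ i, ∀ x (hx : x ∈ F i), (⟨x, hx.1⟩ : N) ∈ Submodule.span R (Set.range b) := by
    intro i
    induction i using WellFoundedLT.induction with
    | ind i ih =>
      have key : ∀ x (hx : x ∈ F i), x i = 0 →
          (⟨x, hx.1⟩ : N) ∈ Submodule.span R (Set.range b) := by
        intro x hx hxi
        by_cases h0 : x = 0
        · subst h0; exact zero_mem _
        have hs : x.support.Nonempty := Finsupp.support_nonempty_iff.2 h0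
        have hj := x.support.max'_mem hs
        have hji : x.support.max' hs < i := by
          refine lt_of_le_of_ne ((Finsupp.mem_supported R _).1 hx.2 hj) fun h => ?_
          rw [h] at hj
          exact Finsupp.mem_support_iff.1 hj hxi
        exact ih _ hji x ⟨hx.1, (Finsupp.mem_supported R _).2 fun k hk =>
          x.support.le_max' k hk⟩
      intro x hx
      obtain ⟨c, hc⟩ := (Submodule.IsPrincipal.mem_iff_eq_smul_generator (I i)).1
        (Submodule.mem_map_of_mem (f := Finsupp.lapply i) hx)
      change x i = c • a i at hc
      by_cases hai : a i = 0
      · exact key x hx (by rw [hc, hai, smul_zero])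
      · have h1 := key (x - c • m i) (sub_mem hx (Submodule.smul_mem _ c (hm i)))
          (by rw [Finsupp.sub_apply, Finsupp.smul_apply, hma, hc, sub_self])
        have h2 : c • b ⟨i, hai⟩ ∈ Submodule.span R (Set.range b) :=
          Submodule.smul_mem _ c (Submodule.subset_span ⟨_, rfl⟩)
        have h3 := add_mem h1 h2
        convert h3 using 1
        exact Subtype.ext (by simp [b])
  refine Module.Free.of_basis (Module.Basis.mk hli ?_)
  rintro ⟨x, hx⟩ -
  by_cases h0 : x = 0
  · subst h0; exact zero_mem _
  have hs : x.support.Nonempty := Finsupp.support_nonempty_iff.2 h0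
  exact hsp (x.support.max' hs) x ⟨hx, (Finsupp.mem_supported R _).2 fun k hk =>
    x.support.le_max' k hk⟩

theorem free_submodule_of_free {R M : Type*} [CommRing R] [IsDomain R] [IsPrincipalIdealRing R]
    [AddCommGroup M] [Module R M] [Module.Free R M] (N : Submodule R M) : Module.Free R N := by
  let e := (Module.Free.chooseBasis R M).repr
  have := free_submodule_finsupp (N.map e.toLinearMap)
  exact Module.Free.of_equiv (e.submoduleMap N).symm

/-! ### Homology classes of cycles -/

section HomologyClass

variable {K : Type u} [CommRing K] (C D E : ChainComplex (ModuleCat.{u} K) ℕ)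

/-- Truncated subtraction is correct in degree `0` as well: there `next` is `0` itself and the
differential `C.d 0 0` vanishes. So `C.d n (n - 1)` serves in every degree without case
distinctions. -/
theorem next_down_nat (n : ℕ) : (ComplexShape.down ℕ).next n = n - 1 := by
  cases n
  · exact ChainComplex.next_nat_zero
  · exact ChainComplex.next_nat_succ _

theorem d_d_apply (i j k : ℕ) (x : C.X i) : (C.d j k).hom ((C.d i j).hom x) = 0 := by
  change (C.d i j ≫ C.d j k).hom x = 0
  rw [C.d_comp_d]; rfl

variable {C D} in
theorem hom_comm_apply (f : C ⟶ D) (i j : ℕ) (x : C.X i) :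
    (D.d i j).hom ((f.f i).hom x) = (f.f j).hom ((C.d i j).hom x) := by
  change (f.f i ≫ D.d i j).hom x = (C.d i j ≫ f.f j).hom x
  rw [f.comm]

/-- The submodule of `n`-cycles. -/
def cyc (n : ℕ) : Submodule K (C.X n) := LinearMap.ker (C.d n (n - 1)).hom

theorem mem_cyc {n : ℕ} {x : C.X n} : x ∈ cyc C n ↔ (C.d n (n - 1)).hom x = 0 := Iff.rfl

theorem d_mem_cyc (n m : ℕ) (x : C.X n) : (C.d n m).hom x ∈ cyc C m := d_d_apply C _ _ _ x

theorem subtype_comp_d (n : ℕ) :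
    ModuleCat.ofHom (cyc C n).subtype ≫ C.d n (n - 1) = 0 := by
  ext x; exact x.2

/-- The homology class of a cycle. -/
def hcls (n : ℕ) : cyc C n →ₗ[K] C.homology n :=
  (C.liftCycles (ModuleCat.ofHom (cyc C n).subtype) (n - 1) (next_down_nat n)
    (subtype_comp_d C n) ≫ C.homologyπ n).hom

theorem hcls_surjective (n : ℕ) : Function.Surjective (hcls C n) := by
  intro z
  obtain ⟨w, rfl⟩ := (ModuleCat.epi_iff_surjective (C.homologyπ n)).1 inferInstance z
  have hw : (C.d n (n - 1)).hom ((C.iCycles n).hom w) = 0 := by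
    change (C.iCycles n ≫ C.d n (n - 1)).hom w = 0
    rw [C.iCycles_d]; rfl
  refine ⟨⟨_, hw⟩, congrArg (C.homologyπ n).hom ?_⟩
  apply (ModuleCat.mono_iff_injective (C.iCycles n)).1 inferInstance
  change (C.liftCycles _ _ _ _ ≫ C.iCycles n).hom _ = _
  rw [C.liftCycles_i]; rfl

/-- `C.homologyπ n` is the cokernel of `C.toCycles (n + 1) n`, and `C.iCycles n` is mono, so the
lift found among the cycles can be compared inside `C.X n`. -/
theorem hcls_eq_zero_iff (n : ℕ) (x : cyc C n) :
    hcls C n x = 0 ↔ ∃ y : C.X (n + 1), (C.d (n + 1) n).hom y = x := by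
  have hex : (ShortComplex.mk (C.toCycles (n + 1) n) (C.homologyπ n) (by simp)).Exact :=
    ShortComplex.exact_of_g_is_cokernel _ (C.homologyIsCokernel (n + 1) n (by simp))
  constructor
  · intro h
    obtain ⟨y, hy⟩ := (ShortComplex.moduleCat_exact_iff _).1 hex _ h
    refine ⟨y, ?_⟩
    have h2 := congrArg (C.iCycles n).hom hy
    change (C.toCycles _ _ ≫ C.iCycles n).hom y = (C.liftCycles _ _ _ _ ≫ C.iCycles n).hom _ at h2
    rw [C.liftCycles_i, C.toCycles_i] at h2
    exact h2
  · rintro ⟨y, hy⟩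
    have h1 : C.liftCycles (ModuleCat.ofHom (cyc C n).subtype) (n - 1) (next_down_nat n)
        (subtype_comp_d C n) x = C.toCycles (n + 1) n y := by
      apply (ModuleCat.mono_iff_injective (C.iCycles n)).1 inferInstance
      change (C.liftCycles _ _ _ _ ≫ C.iCycles n).hom _ = (C.toCycles _ _ ≫ C.iCycles n).hom y
      rw [C.liftCycles_i, C.toCycles_i]
      exact hy.symm
    change (C.homologyπ n).hom (C.liftCycles (ModuleCat.ofHom (cyc C n).subtype) (n - 1)
      (next_down_nat n) (subtype_comp_d C n) x) = 0
    erw [h1]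
    change (C.toCycles _ _ ≫ C.homologyπ n).hom y = 0
    rw [C.toCycles_comp_homologyπ]; rfl

variable {C D} in
theorem map_mem_cyc (f : C ⟶ D) {n : ℕ} {x : C.X n} (hx : x ∈ cyc C n) :
    (f.f n).hom x ∈ cyc D n := by
  rw [mem_cyc] at hx ⊢
  rw [hom_comm_apply, hx, map_zero]

variable {C D} in
theorem homologyMap_hcls (f : C ⟶ D) (n : ℕ) (x : cyc C n) :
    (HomologicalComplex.homologyMap f n).hom (hcls C n x) =
      hcls D n ⟨(f.f n).hom x, map_mem_cyc f x.2⟩ := by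
  change (C.liftCycles (ModuleCat.ofHom (cyc C n).subtype) (n - 1) (next_down_nat n)
    (subtype_comp_d C n) ≫ C.homologyπ n ≫ HomologicalComplex.homologyMap f n).hom x =
    (D.homologyπ n).hom _
  rw [HomologicalComplex.homologyπ_naturality]
  change (D.homologyπ n).hom _ = (D.homologyπ n).hom _
  congr 1
  apply (ModuleCat.mono_iff_injective (D.iCycles n)).1 inferInstance
  change (C.liftCycles (ModuleCat.ofHom (cyc C n).subtype) (n - 1) (next_down_nat n)
    (subtype_comp_d C n) ≫ HomologicalComplex.cyclesMap f n ≫ D.iCycles n).hom x =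
    (D.liftCycles _ _ _ _ ≫ D.iCycles n).hom _
  rw [HomologicalComplex.cyclesMap_i, C.liftCycles_i_assoc, D.liftCycles_i]
  rfl

/-- The zigzag description of the connecting map on elements. The general formula is for morphisms
from a test object; an element `x` becomes the morphism from `K` with `1 ↦ x`. -/
theorem δ_hcls {S : ShortComplex (ChainComplex (ModuleCat.{u} K) ℕ)} (hS : S.ShortExact) (m : ℕ)
    (x₃ : cyc S.X₃ (m + 1)) (x₂ : S.X₂.X (m + 1)) (x₁ : cyc S.X₁ m)
    (h₃ : (S.g.f (m + 1)).hom x₂ = x₃) (h₁ : (S.f.f m).hom x₁ = (S.X₂.d (m + 1) m).hom x₂) :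
    (hS.δ (m + 1) m (by simp)).hom (hcls S.X₃ (m + 1) x₃) = hcls S.X₁ m x₁ := by
  have key := hS.δ_eq (m + 1) m (by simp)
    (ModuleCat.ofHom (LinearMap.toSpanSingleton K _ x₃.1))
    (by
      ext
      change (S.X₃.d (m + 1) m).hom ((1 : K) • x₃.1) = 0
      rw [one_smul]; exact x₃.2)
    (ModuleCat.ofHom (LinearMap.toSpanSingleton K _ x₂))
    (by
      ext
      change (S.g.f (m + 1)).hom ((1 : K) • x₂) = (1 : K) • x₃.1
      rw [one_smul, one_smul, h₃])
    (ModuleCat.ofHom (LinearMap.toSpanSingleton K _ x₁.1))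
    (by
      ext
      change (S.f.f m).hom ((1 : K) • x₁.1) = (S.X₂.d (m + 1) m).hom ((1 : K) • x₂)
      rw [one_smul, one_smul, h₁]) (m - 1) (next_down_nat m)
  have key2 := congrArg (fun f => f.hom (1 : K)) key
  have e : ∀ (C : ChainComplex (ModuleCat.{u} K) ℕ) (n k : ℕ) (hk : (ComplexShape.down ℕ).next n = k)
      (x : cyc C n) (hx),
      (C.liftCycles (ModuleCat.ofHom (LinearMap.toSpanSingleton K _ x.1)) k hk hx).hom (1 : K) =
      (C.liftCycles (ModuleCat.ofHom (cyc C n).subtype) (n - 1) (next_down_nat n)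
    (subtype_comp_d C n)).hom x := by
    intro C n k hk x hx
    apply (ModuleCat.mono_iff_injective (C.iCycles n)).1 inferInstance
    change (C.liftCycles (ModuleCat.ofHom (LinearMap.toSpanSingleton K _ x.1)) k hk hx ≫
      C.iCycles n).hom (1 : K) = (C.liftCycles (ModuleCat.ofHom (cyc C n).subtype) (n - 1)
        (next_down_nat n) (subtype_comp_d C n) ≫ C.iCycles n).hom x
    rw [C.liftCycles_i, C.liftCycles_i]
    change (1 : K) • x.1 = x.1
    rw [one_smul]
  have hx : ∀ (C : ChainComplex (ModuleCat.{u} K) ℕ) (n : ℕ) (x : cyc C n),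
      ModuleCat.ofHom (LinearMap.toSpanSingleton K _ x.1) ≫ C.d n (n - 1) = 0 := by
    intro C n x
    ext
    change (C.d n (n - 1)).hom ((1 : K) • x.1) = 0
    rw [one_smul]; exact x.2
  refine (congrArg (fun z => (hS.δ (m + 1) m _).hom ((S.X₃.homologyπ (m + 1)).hom z))
    (e S.X₃ (m + 1) m (next_down_nat _) x₃ (hx _ _ x₃)).symm).trans (Eq.trans ?_
    (congrArg (fun z => (S.X₁.homologyπ m).hom z) (e S.X₁ m (m - 1) (next_down_nat m) x₁
      (hx _ _ x₁))))
  exact key2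

end HomologyClass

/-! ### Elements of the tensor product of two chain complexes -/

section TensorElements

variable {K : Type u} [CommRing K] (A B : ChainComplex (ModuleCat.{u} K) ℕ)

/-- The inclusion of `Aᵢ ⊗ Bⱼ` in `(A ⊗ B)ₙ` if `i + j = n`, and zero otherwise. -/
def tz (i j n : ℕ) : (A.X i ⊗[K] B.X j) →ₗ[K] ((A ⊗ B : ChainComplex (ModuleCat.{u} K) ℕ).X n) :=
  (HomologicalComplex.ιMapBifunctorOrZero A B (curriedTensor (ModuleCat.{u} K))
    (ComplexShape.down ℕ) i j n).hom

theorem tz_of_ne {i j n : ℕ} (h : i + j ≠ n) : tz A B i j n = 0 := by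
  unfold tz
  rw [HomologicalComplex.ιMapBifunctorOrZero_eq_zero _ _ _ _ _ _ _ h]
  rfl

theorem tensor_hom_ext {n : ℕ} {M : Type u} [AddCommGroup M] [Module K M]
    {f g : ((A ⊗ B : ChainComplex (ModuleCat.{u} K) ℕ).X n) →ₗ[K] M}
    (h : ∀ i j (_ : i + j = n) (x : A.X i) (y : B.X j),
      f (tz A B i j n (x ⊗ₜ y)) = g (tz A B i j n (x ⊗ₜ y))) : f = g := by
  have : ModuleCat.ofHom f = ModuleCat.ofHom g := by
    refine HomologicalComplex.mapBifunctor.hom_ext fun i j hij => ?_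
    ext1
    refine TensorProduct.ext' fun x y => ?_
    have := h i j hij x y
    unfold tz at this
    rw [HomologicalComplex.ιMapBifunctorOrZero_eq _ _ _ _ _ _ _ hij] at this
    exact this
  exact congrArg ModuleCat.Hom.hom this

/-- No relation between `i`, `j`, `n` is required: off the diagonal `i + j = n + 1` both sides
vanish, and for `i = 0` or `j = 0` the truncated index is harmless because the differential out of
degree `0` is zero. -/
theorem d_tz (i j n : ℕ) (x : A.X i) (y : B.X j) :
    ((A ⊗ B : ChainComplex (ModuleCat.{u} K) ℕ).d (n + 1) n).hom (tz A B i j (n + 1) (x ⊗ₜ y)) =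
      tz A B (i - 1) j n ((A.d i (i - 1)).hom x ⊗ₜ y) +
        (-1 : K) ^ i • tz A B i (j - 1) n (x ⊗ₜ (B.d j (j - 1)).hom y) := by
  by_cases hij : i + j = n + 1
  · have hd : ∀ z, ((A ⊗ B : ChainComplex (ModuleCat.{u} K) ℕ).d (n + 1) n).hom
        (tz A B i j (n + 1) z) =
        (HomologicalComplex.mapBifunctor.d₁ A B (curriedTensor (ModuleCat.{u} K))
          (ComplexShape.down ℕ) i j n).hom z +
        (HomologicalComplex.mapBifunctor.d₂ A B (curriedTensor (ModuleCat.{u} K))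
          (ComplexShape.down ℕ) i j n).hom z := by
      intro z
      unfold tz
      rw [HomologicalComplex.ιMapBifunctorOrZero_eq _ _ _ _ _ _ _ hij]
      rw [← HomologicalComplex.mapBifunctor.ι_D₁ A B (curriedTensor (ModuleCat.{u} K))
          (ComplexShape.down ℕ) (n + 1) n i j hij,
        ← HomologicalComplex.mapBifunctor.ι_D₂ A B (curriedTensor (ModuleCat.{u} K))
          (ComplexShape.down ℕ) (n + 1) n i j hij]
      change (HomologicalComplex.ιMapBifunctor A B (curriedTensor (ModuleCat.{u} K))
          (ComplexShape.down ℕ) i j (n + 1) hij ≫ (HomologicalComplex.mapBifunctor A B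
            (curriedTensor (ModuleCat.{u} K)) (ComplexShape.down ℕ)).d (n + 1) n).hom z = _
      rw [HomologicalComplex.mapBifunctor.d_eq, Preadditive.comp_add]
      rfl
    rw [hd]
    congr 1
    · rcases i with _ | i
      · rw [HomologicalComplex.mapBifunctor.d₁_eq_zero _ _ _ _ _ _ _ (by simp)]
        rw [A.shape 0 (0 - 1) (by simp)]
        change 0 = tz A B _ _ _ (0 ⊗ₜ y)
        rw [TensorProduct.zero_tmul, map_zero]
      · have h' : i + j = n := by omega
        rw [HomologicalComplex.mapBifunctor.d₁_eq A B _ _ (i₁ := i + 1) (i₁' := i) (by simp) j n h']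
        unfold tz
        erw [HomologicalComplex.ιMapBifunctorOrZero_eq _ _ _ _ _ _ _ h']
        rw [show (ComplexShape.down ℕ).ε₁ (ComplexShape.down ℕ) (ComplexShape.down ℕ) (i + 1, j)
          = 1 from rfl, one_smul]
        rfl
    · rcases j with _ | j
      · rw [HomologicalComplex.mapBifunctor.d₂_eq_zero _ _ _ _ _ _ _ (by simp)]
        rw [B.shape 0 (0 - 1) (by simp)]
        change 0 = _ • tz A B _ _ _ (x ⊗ₜ 0)
        rw [TensorProduct.tmul_zero, map_zero, smul_zero]
      · have h' : i + j = n := by omega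
        rw [HomologicalComplex.mapBifunctor.d₂_eq A B _ _ i (i₂ := j + 1) (i₂' := j) (by simp) n h']
        unfold tz
        erw [HomologicalComplex.ιMapBifunctorOrZero_eq _ _ _ _ _ _ _ h']
        rw [show (ComplexShape.down ℕ).ε₂ (ComplexShape.down ℕ) (ComplexShape.down ℕ) (i, j + 1)
          = (-1) ^ i from rfl]
        rcases Nat.even_or_odd i with he | ho
        · rw [he.neg_one_pow, he.neg_one_pow, one_smul, one_smul]
          rfl
        · rw [ho.neg_one_pow, ho.neg_one_pow, neg_smul, Units.neg_smul, one_smul, one_smul]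
          rfl
  · rw [tz_of_ne A B hij]
    have h2 : tz A B (i - 1) j n ((A.d i (i - 1)).hom x ⊗ₜ y) = 0 := by
      rcases i with _ | i
      · rw [A.shape 0 (0 - 1) (by simp)]
        change tz A B _ _ _ (0 ⊗ₜ y) = 0
        rw [TensorProduct.zero_tmul, map_zero]
      · rw [tz_of_ne A B (by simp; omega)]; rfl
    have h3 : tz A B i (j - 1) n (x ⊗ₜ (B.d j (j - 1)).hom y) = 0 := by
      rcases j with _ | j
      · rw [B.shape 0 (0 - 1) (by simp)]
        change tz A B _ _ _ (x ⊗ₜ 0) = 0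
        rw [TensorProduct.tmul_zero, map_zero]
      · rw [tz_of_ne A B (by simp; omega)]; rfl
    rw [h2, h3, smul_zero, add_zero, LinearMap.zero_apply, map_zero]

/-- The projection of `(A ⊗ B)ₙ` to `Aᵢ ⊗ Bⱼ`, as a morphism. -/
def compHom (i j n : ℕ) : (A ⊗ B : ChainComplex (ModuleCat.{u} K) ℕ).X n ⟶
    ModuleCat.of K (A.X i ⊗[K] B.X j) :=
  HomologicalComplex.mapBifunctorDesc (K₁ := A) (K₂ := B) (F := curriedTensor (ModuleCat.{u} K))
    (c := ComplexShape.down ℕ) (A := ModuleCat.of K (A.X i ⊗[K] B.X j))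
    (fun i' j' _ => if h : i' = i ∧ j' = j then
      ModuleCat.ofHom (by rw [h.1, h.2]; exact LinearMap.id) else 0)

theorem ι_compHom (i j i' j' n : ℕ) (h' : i' + j' = n) :
    HomologicalComplex.ιMapBifunctor A B (curriedTensor (ModuleCat.{u} K))
      (ComplexShape.down ℕ) i' j' n h' ≫ compHom A B i j n =
      if h : i' = i ∧ j' = j then
        ModuleCat.ofHom (by rw [h.1, h.2]; exact LinearMap.id) else 0 :=
  HomologicalComplex.ι_mapBifunctorDesc _ _ _ _

/-- The component in `Aᵢ ⊗ Bⱼ` of an element of `(A ⊗ B)ₙ`. -/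
def comp (i j n : ℕ) : ((A ⊗ B : ChainComplex (ModuleCat.{u} K) ℕ).X n) →ₗ[K]
    (A.X i ⊗[K] B.X j) :=
  (compHom A B i j n).hom

theorem comp_tz_self {i j n : ℕ} (h : i + j = n) (z : A.X i ⊗[K] B.X j) :
    comp A B i j n (tz A B i j n z) = z := by
  unfold comp tz
  rw [HomologicalComplex.ιMapBifunctorOrZero_eq _ _ _ _ _ _ _ h]
  refine (congrArg (fun f => f.hom z) (ι_compHom A B i j i j n h)).trans ?_
  rw [dif_pos ⟨rfl, rfl⟩]
  rfl

theorem comp_tz_of_ne {i j i' j' n : ℕ} (h : ¬ (i' = i ∧ j' = j)) (z : A.X i' ⊗[K] B.X j') :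
    comp A B i j n (tz A B i' j' n z) = 0 := by
  by_cases h' : i' + j' = n
  · unfold comp tz
    rw [HomologicalComplex.ιMapBifunctorOrZero_eq _ _ _ _ _ _ _ h']
    refine (congrArg (fun f => f.hom z) (ι_compHom A B i j i' j' n h')).trans ?_
    rw [dif_neg h]
    rfl
  · rw [tz_of_ne A B h', LinearMap.zero_apply, map_zero]

theorem sum_tz_comp (n : ℕ) (u : (A ⊗ B : ChainComplex (ModuleCat.{u} K) ℕ).X n) :
    ∑ p ∈ Finset.HasAntidiagonal.antidiagonal n, tz A B p.1 p.2 n (comp A B p.1 p.2 n u) = u := by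
  have : ∑ p ∈ Finset.HasAntidiagonal.antidiagonal n, tz A B p.1 p.2 n ∘ₗ comp A B p.1 p.2 n =
      LinearMap.id := by
    refine tensor_hom_ext A B fun i j h x y => ?_
    rw [LinearMap.sum_apply, Finset.sum_eq_single (i, j)]
    · rw [LinearMap.comp_apply, comp_tz_self A B h, LinearMap.id_apply]
    · intro p _ hp
      rw [LinearMap.comp_apply, comp_tz_of_ne A B, map_zero]
      rintro ⟨rfl, rfl⟩; exact hp rfl
    · intro h'; exact absurd (Finset.HasAntidiagonal.mem_antidiagonal.2 h) h'
  have h2 := LinearMap.congr_fun this u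
  rw [LinearMap.sum_apply] at h2
  exact h2

variable {A B} in
theorem tensorHom_tz {A' B' : ChainComplex (ModuleCat.{u} K) ℕ} (f : A ⟶ A') (g : B ⟶ B')
    (i j n : ℕ) (z : A.X i ⊗[K] B.X j) :
    ((f ⊗ₘ g : (A ⊗ B : ChainComplex (ModuleCat.{u} K) ℕ) ⟶ A' ⊗ B').f n).hom (tz A B i j n z) =
      tz A' B' i j n (TensorProduct.map (f.f i).hom (g.f j).hom z) := by
  by_cases h : i + j = n
  · unfold tz
    rw [HomologicalComplex.ιMapBifunctorOrZero_eq _ _ _ _ _ _ _ h,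
      HomologicalComplex.ιMapBifunctorOrZero_eq _ _ _ _ _ _ _ h]
    change (HomologicalComplex.ιMapBifunctor A B (curriedTensor (ModuleCat.{u} K))
      (ComplexShape.down ℕ) i j n h ≫ (HomologicalComplex.mapBifunctorMap f g
        (curriedTensor (ModuleCat.{u} K)) (ComplexShape.down ℕ)).f n).hom z = _
    rw [HomologicalComplex.ι_mapBifunctorMap]
    induction z using TensorProduct.induction_on with
    | zero => rw [map_zero, map_zero, map_zero]
    | tmul x y => rfl
    | add a b ha hb => rw [map_add, map_add, map_add, ha, hb]
  · rw [tz_of_ne A B h, tz_of_ne A' B' h, LinearMap.zero_apply, map_zero, LinearMap.zero_apply]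

end TensorElements

/-! ### The cross product in homology -/

section Cross

variable {K : Type u} [CommRing K] (A B : ChainComplex (ModuleCat.{u} K) ℕ)

instance (n : ℕ) : Fintype (SumPairs n) := Fintype.ofFinite _

theorem sum_sumPairs_tz_comp (n : ℕ) (u : (A ⊗ B : ChainComplex (ModuleCat.{u} K) ℕ).X n) :
    ∑ p : SumPairs n, tz A B p.1.1 p.1.2 n (comp A B p.1.1 p.1.2 n u) = u := by
  refine Eq.trans ?_ (sum_tz_comp A B n u)
  exact (Finset.sum_subtype _ (fun _ => Finset.HasAntidiagonal.mem_antidiagonal)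
    (fun p => tz A B p.1 p.2 n (comp A B p.1 p.2 n u))).symm

theorem comp_d {i j n : ℕ} (h : i + j = n) (u : (A ⊗ B : ChainComplex (ModuleCat.{u} K) ℕ).X (n + 1)) :
    comp A B i j n (((A ⊗ B : ChainComplex (ModuleCat.{u} K) ℕ).d (n + 1) n).hom u) =
      (A.d (i + 1) i).hom.rTensor _ (comp A B (i + 1) j (n + 1) u) +
        (-1 : K) ^ i • (B.d (j + 1) j).hom.lTensor _ (comp A B i (j + 1) (n + 1) u) := by
  have key : comp A B i j n ∘ₗ ((A ⊗ B : ChainComplex (ModuleCat.{u} K) ℕ).d (n + 1) n).hom =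
      (A.d (i + 1) i).hom.rTensor _ ∘ₗ comp A B (i + 1) j (n + 1) +
        (-1 : K) ^ i • (B.d (j + 1) j).hom.lTensor _ ∘ₗ comp A B i (j + 1) (n + 1) := by
    refine tensor_hom_ext A B fun i' j' h' x y => ?_
    simp only [LinearMap.comp_apply, LinearMap.add_apply, LinearMap.smul_apply]
    rw [d_tz, map_add, map_smul]
    by_cases h1 : i' = i + 1
    · subst h1
      obtain rfl : j' = j := by omega
      have e1 := comp_tz_self A B h ((A.d (i + 1) i).hom x ⊗ₜ[K] y)
      have e2 : comp A B i j' n (tz A B (i + 1) (j' - 1) n (x ⊗ₜ (B.d j' (j' - 1)).hom y)) = 0 :=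
        comp_tz_of_ne A B (by omega) _
      rw [comp_tz_self A B h', comp_tz_of_ne A B (i := i) (j := j' + 1) (by omega), e2, map_zero,
        LinearMap.rTensor_tmul, smul_zero, smul_zero]
      exact congrArg (· + 0) e1
    · by_cases h2 : j' = j + 1
      · subst h2
        obtain rfl : i' = i := by omega
        have e1 := comp_tz_self A B h (x ⊗ₜ[K] (B.d (j + 1) j).hom y)
        have e2 : comp A B i' j n (tz A B (i' - 1) (j + 1) n
            ((A.d i' (i' - 1)).hom x ⊗ₜ y)) = 0 := comp_tz_of_ne A B (by omega) _
        rw [comp_tz_self A B h', comp_tz_of_ne A B (i := i' + 1) (j := j) (by omega), e2, map_zero,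
          LinearMap.lTensor_tmul]
        exact congrArg (fun z => 0 + (-1 : K) ^ i' • z) e1
      · rw [comp_tz_of_ne A B (by omega), comp_tz_of_ne A B (by omega),
          comp_tz_of_ne A B (by omega), comp_tz_of_ne A B (by omega), map_zero, map_zero,
          smul_zero, smul_zero]
  exact LinearMap.congr_fun key u

theorem tz_mem_cyc {i j : ℕ} (n : ℕ) {x : A.X i} {y : B.X j} (hx : x ∈ cyc A i) (hy : y ∈ cyc B j) :
    tz A B i j n (x ⊗ₜ y) ∈ cyc (A ⊗ B) n := by
  rw [mem_cyc] at hx hy ⊢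
  rcases n with _ | n
  · rw [HomologicalComplex.shape _ 0 (0 - 1) (by simp)]; rfl
  · refine (d_tz A B i j n x y).trans ?_
    rw [hx, hy, TensorProduct.zero_tmul, TensorProduct.tmul_zero, map_zero, map_zero, smul_zero,
      add_zero]

/-- The map induced by `f` on the target of a surjective map whose kernel is killed by `f`. -/
def descSurj {M N P : Type u} [AddCommGroup M] [AddCommGroup N] [AddCommGroup P] [Module K M]
    [Module K N] [Module K P] (π : M →ₗ[K] N) (hπ : Function.Surjective π) (f : M →ₗ[K] P)
    (h : ∀ x, π x = 0 → f x = 0) : N →ₗ[K] P :=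
  (LinearMap.ker π).liftQ f h ∘ₗ (π.quotKerEquivOfSurjective hπ).symm.toLinearMap

theorem descSurj_apply {M N P : Type u} [AddCommGroup M] [AddCommGroup N] [AddCommGroup P]
    [Module K M] [Module K N] [Module K P] (π : M →ₗ[K] N) (hπ : Function.Surjective π)
    (f : M →ₗ[K] P) (h : ∀ x, π x = 0 → f x = 0) (x : M) : descSurj π hπ f h (π x) = f x := by
  have : (π.quotKerEquivOfSurjective hπ).symm (π x) = (LinearMap.ker π).mkQ x := by
    rw [LinearEquiv.symm_apply_eq]; rfl
  change (LinearMap.ker π).liftQ f h ((π.quotKerEquivOfSurjective hπ).symm (π x)) = f x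
  rw [this]; rfl

/-- The class of `x ⊗ y` for cycles `x`, `y`. -/
def crossCyc (i j n : ℕ) : cyc A i →ₗ[K] cyc B j →ₗ[K]
    (A ⊗ B : ChainComplex (ModuleCat.{u} K) ℕ).homology n :=
  LinearMap.mk₂ K (fun x y => hcls (A ⊗ B) n ⟨tz A B i j n (x.1 ⊗ₜ y.1), tz_mem_cyc A B n x.2 y.2⟩)
    (fun x x' y => by
      rw [← map_add]; congr 1; apply Subtype.ext
      change tz A B i j n ((x.1 + x'.1) ⊗ₜ y.1) = _
      rw [TensorProduct.add_tmul, map_add]; rfl)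
    (fun c x y => by
      rw [← map_smul]; congr 1; apply Subtype.ext
      change tz A B i j n ((c • x.1) ⊗ₜ y.1) = _
      rw [← TensorProduct.smul_tmul', map_smul]; rfl)
    (fun x y y' => by
      rw [← map_add]; congr 1; apply Subtype.ext
      change tz A B i j n (x.1 ⊗ₜ (y.1 + y'.1)) = _
      rw [TensorProduct.tmul_add, map_add]; rfl)
    (fun c x y => by
      rw [← map_smul]; congr 1; apply Subtype.ext
      change tz A B i j n (x.1 ⊗ₜ (c • y.1)) = _
      rw [TensorProduct.tmul_smul, map_smul]; rfl)

theorem crossCyc_eq_zero_left (i j n : ℕ) (x : cyc A i) (y : cyc B j) (hx : hcls A i x = 0) :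
    crossCyc A B i j n x y = 0 := by
  obtain ⟨z, hz⟩ := (hcls_eq_zero_iff A i x).1 hx
  refine (hcls_eq_zero_iff (A ⊗ B) n _).2 ⟨tz A B (i + 1) j (n + 1) (z ⊗ₜ y.1), ?_⟩
  rw [d_tz, (mem_cyc B).1 y.2, TensorProduct.tmul_zero, map_zero, smul_zero, add_zero]
  change tz A B i j n ((A.d (i + 1) i).hom z ⊗ₜ y.1) = _
  rw [hz]

theorem crossCyc_eq_zero_right (i j n : ℕ) (x : cyc A i) (y : cyc B j) (hy : hcls B j y = 0) :
    crossCyc A B i j n x y = 0 := by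
  obtain ⟨z, hz⟩ := (hcls_eq_zero_iff B j y).1 hy
  -- For a cycle `x` the boundary of `x ⊗ z` is `(-1) ^ i` times `x ⊗ dz`; the sign in the witness
  -- cancels this one.
  refine (hcls_eq_zero_iff (A ⊗ B) n _).2
    ⟨(-1 : K) ^ i • tz A B i (j + 1) (n + 1) (x.1 ⊗ₜ z), ?_⟩
  rw [map_smul, d_tz, (mem_cyc A).1 x.2, TensorProduct.zero_tmul, map_zero, zero_add, smul_smul,
    ← mul_pow, neg_one_mul, neg_neg, one_pow, one_smul]
  change tz A B i j n (x.1 ⊗ₜ (B.d (j + 1) j).hom z) = _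
  rw [hz]

/-- The map `crossCyc` as a map on `Hⱼ(B)`. -/
def crossRight (i j n : ℕ) : B.homology j →ₗ[K] cyc A i →ₗ[K]
    (A ⊗ B : ChainComplex (ModuleCat.{u} K) ℕ).homology n :=
  descSurj (hcls B j) (hcls_surjective B j) (crossCyc A B i j n).flip
    (fun y hy => LinearMap.ext fun x => crossCyc_eq_zero_right A B i j n x y hy)

theorem crossRight_hcls (i j n : ℕ) (x : cyc A i) (y : cyc B j) :
    crossRight A B i j n (hcls B j y) x = crossCyc A B i j n x y := by
  rw [crossRight, descSurj_apply, LinearMap.flip_apply]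

/-- The cross product `Hᵢ(A) ⊗ Hⱼ(B) → Hₙ(A ⊗ B)`. -/
def cross (i j n : ℕ) : A.homology i ⊗[K] B.homology j →ₗ[K]
    (A ⊗ B : ChainComplex (ModuleCat.{u} K) ℕ).homology n :=
  TensorProduct.lift (descSurj (hcls A i) (hcls_surjective A i) (crossRight A B i j n).flip
    (fun x hx => LinearMap.ext fun y => by
      obtain ⟨y, rfl⟩ := hcls_surjective B j y
      rw [LinearMap.flip_apply, crossRight_hcls, crossCyc_eq_zero_left A B i j n x y hx]
      rfl))

theorem cross_hcls (i j n : ℕ) (x : cyc A i) (y : cyc B j) :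
    cross A B i j n (hcls A i x ⊗ₜ hcls B j y) =
      hcls (A ⊗ B) n ⟨tz A B i j n (x.1 ⊗ₜ y.1), tz_mem_cyc A B n x.2 y.2⟩ := by
  rw [cross, TensorProduct.lift.tmul, descSurj_apply, LinearMap.flip_apply, crossRight_hcls]
  rfl

variable {A B} in
theorem homologyMap_cross {A' B' : ChainComplex (ModuleCat.{u} K) ℕ} (f : A ⟶ A') (g : B ⟶ B')
    (i j n : ℕ) (t : A.homology i ⊗[K] B.homology j) :
    (HomologicalComplex.homologyMap
      (f ⊗ₘ g : (A ⊗ B : ChainComplex (ModuleCat.{u} K) ℕ) ⟶ A' ⊗ B') n).hom (cross A B i j n t) =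
      cross A' B' i j n (TensorProduct.map (HomologicalComplex.homologyMap f i).hom
        (HomologicalComplex.homologyMap g j).hom t) := by
  induction t using TensorProduct.induction_on with
  | zero => simp only [map_zero]
  | add a b ha hb => simp only [map_add, ha, hb]
  | tmul a b =>
    obtain ⟨x, rfl⟩ := hcls_surjective A i a
    obtain ⟨y, rfl⟩ := hcls_surjective B j b
    rw [cross_hcls, homologyMap_hcls, TensorProduct.map_tmul, homologyMap_hcls, homologyMap_hcls,
      cross_hcls]
    congr 2
    rw [tensorHom_tz]; rfl

end Cross

/-! ### Tensor products with complexes with zero differential -/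

section ZeroDifferential

variable {K : Type u} [CommRing K] (A : ChainComplex (ModuleCat.{u} K) ℕ)

/-- All differentials of the complex vanish. -/
class HasZeroDiff (X : ChainComplex (ModuleCat.{u} K) ℕ) : Prop where
  d_eq_zero : ∀ i j, X.d i j = 0

variable (X : ChainComplex (ModuleCat.{u} K) ℕ) [HasZeroDiff X]

theorem mem_cyc_zeroDiff {j : ℕ} (x : X.X j) : x ∈ cyc X j := by
  rw [mem_cyc, HasZeroDiff.d_eq_zero]; rfl

/-- Each element of a complex with zero differential, as a cycle. -/
def zeroDiffCyc (j : ℕ) : X.X j →ₗ[K] cyc X j :=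
  LinearMap.codRestrict _ LinearMap.id (mem_cyc_zeroDiff X)

/-- The map `Hᵢ(A) ⊗ Xⱼ → Hₙ(A ⊗ X)` for a complex `X` with zero differential. -/
def zcross (i j n : ℕ) : A.homology i ⊗[K] X.X j →ₗ[K]
    (A ⊗ X : ChainComplex (ModuleCat.{u} K) ℕ).homology n :=
  cross A X i j n ∘ₗ
    (hcls X j ∘ₗ zeroDiffCyc X j).lTensor _

theorem zcross_hcls (i j n : ℕ) (x : cyc A i) (y : X.X j) :
    zcross A X i j n (hcls A i x ⊗ₜ y) = hcls (A ⊗ X) n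
      ⟨tz A X i j n (x.1 ⊗ₜ y), tz_mem_cyc A _ n x.2 (mem_cyc_zeroDiff X y)⟩ :=
  cross_hcls A X i j n x (zeroDiffCyc X j y)

theorem tz_rTensor_mem_cyc (i j n : ℕ) (v : cyc A i ⊗[K] X.X j) :
    tz A X i j n ((cyc A i).subtype.rTensor (X.X j) v) ∈ cyc (A ⊗ X) n := by
  induction v using TensorProduct.induction_on with
  | zero => rw [map_zero, map_zero]; exact zero_mem _
  | add a b ha hb => rw [map_add, map_add]; exact add_mem ha hb
  | tmul x y => exact tz_mem_cyc A X n x.2 (mem_cyc_zeroDiff X y)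

theorem zcross_rTensor (i j n : ℕ) (v : cyc A i ⊗[K] X.X j) :
    zcross A X i j n ((hcls A i).rTensor (X.X j) v) =
      hcls (A ⊗ X) n ⟨_, tz_rTensor_mem_cyc A X i j n v⟩ := by
  induction v using TensorProduct.induction_on with
  | zero =>
    rw [map_zero, map_zero]
    refine (map_zero (hcls (A ⊗ X) n)).symm.trans (congrArg _ (Subtype.ext ?_))
    simp only [map_zero]; rfl
  | add a b ha hb =>
    rw [map_add, map_add, ha, hb, ← map_add]
    refine congrArg _ (Subtype.ext ?_)
    simp only [map_add]; rfl
  | tmul x y =>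
    rw [LinearMap.rTensor_tmul, zcross_hcls]; rfl

/-- The sum of the maps `zcross` with `i + j = n`. -/
def zcrossSum (n : ℕ) : ((p : SumPairs n) → A.homology p.1.1 ⊗[K] X.X p.1.2) →ₗ[K]
    (A ⊗ X : ChainComplex (ModuleCat.{u} K) ℕ).homology n :=
  ∑ p : SumPairs n, zcross A X p.1.1 p.1.2 n ∘ₗ LinearMap.proj p

theorem zcrossSum_apply (n : ℕ) (t : (p : SumPairs n) → A.homology p.1.1 ⊗[K] X.X p.1.2) :
    zcrossSum A X n t = ∑ p : SumPairs n, zcross A X p.1.1 p.1.2 n (t p) := by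
  rw [zcrossSum, LinearMap.sum_apply]; rfl

variable [∀ j, Module.Flat K (X.X j)]

/-- As `X` has zero differential, the boundary in `A ⊗ X` is `d ⊗ 1` in each bidegree. So the
components of a cycle lie in the kernel of `d ⊗ 1`, and by flatness this kernel is the image of
(cycles of `A`) ⊗ `X`. -/
theorem zcrossSum_surjective (n : ℕ) : Function.Surjective (zcrossSum A X n) := by
  intro z
  obtain ⟨u, rfl⟩ := hcls_surjective _ n z
  have h1 : ∀ p : SumPairs n, ∃ v : cyc A p.1.1 ⊗[K] X.X p.1.2,
      (cyc A p.1.1).subtype.rTensor (X.X p.1.2) v = comp A X p.1.1 p.1.2 n u.1 := by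
    rintro ⟨⟨i, j⟩, hij⟩
    have hex := Module.Flat.rTensor_exact (X.X j)
      (LinearMap.exact_subtype_ker_map (A.d i (i - 1)).hom)
    refine (hex _).1 ?_
    rcases i with _ | i
    · rw [A.shape 0 (0 - 1) (by simp)]
      exact LinearMap.congr_fun (LinearMap.rTensor_zero (X.X j)) _
    · change i + 1 + j = n at hij
      obtain rfl : n = (i + j) + 1 := by omega
      have h := comp_d A X (i := i) (j := j) rfl u.1
      rw [show ((A ⊗ X : ChainComplex (ModuleCat.{u} K) ℕ).d (i + j + 1) (i + j)).hom u.1 = 0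
        from u.2, map_zero] at h
      have h2 : (X.d (j + 1) j).hom.lTensor (A.X i)
          (comp A X i (j + 1) (i + j + 1) u.1) = 0 :=
        by
        rw [HasZeroDiff.d_eq_zero]; exact LinearMap.congr_fun (LinearMap.lTensor_zero (A.X i)) _
      rw [h2, smul_zero, add_zero] at h
      exact h.symm
  choose v hv using h1
  refine ⟨fun p => (hcls A p.1.1).rTensor _ (v p), ?_⟩
  rw [zcrossSum_apply]
  simp only [zcross_rTensor]
  rw [← map_sum]
  refine congrArg _ (Subtype.ext ?_)
  rw [AddSubmonoidClass.coe_finsetSum]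
  simp only [hv]
  exact sum_sumPairs_tz_comp A X n u.1

/-- After lifting each component to (cycles of `A`) ⊗ `X`, the sum is a boundary. In bidegree `(i,
j)` the lift then agrees with an element of (boundaries) ⊗ `X`, at first only inside `Aᵢ ⊗ Xⱼ`.
Flatness of `X` moves this equality into (cycles) ⊗ `X`, where boundaries have class zero. -/
theorem zcrossSum_injective (n : ℕ) : Function.Injective (zcrossSum A X n) := by
  rw [injective_iff_map_eq_zero]
  intro t ht
  have h1 : ∀ p : SumPairs n, ∃ v : cyc A p.1.1 ⊗[K] X.X p.1.2,
      (hcls A p.1.1).rTensor (X.X p.1.2) v = t p := fun p =>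
    LinearMap.rTensor_surjective _ (hcls_surjective A p.1.1) (t p)
  choose v hv using h1
  rw [zcrossSum_apply] at ht
  simp only [← hv, zcross_rTensor] at ht
  rw [← map_sum, hcls_eq_zero_iff, AddSubmonoidClass.coe_finsetSum] at ht
  obtain ⟨w, hw⟩ := ht
  funext ⟨⟨i, j⟩, hij⟩
  have h := congrArg (comp A X i j n) hw
  have h2 : (X.d (j + 1) j).hom.lTensor (A.X i)
      (comp A X i (j + 1) (n + 1) w) = 0 :=
    by
        rw [HasZeroDiff.d_eq_zero]; exact LinearMap.congr_fun (LinearMap.lTensor_zero (A.X i)) _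
  rw [comp_d A X hij, h2, smul_zero, add_zero, map_sum,
    Finset.sum_eq_single (⟨(i, j), hij⟩ : SumPairs n), comp_tz_self A _ hij] at h
  · let d' : A.X (i + 1) →ₗ[K] cyc A i :=
      LinearMap.codRestrict _ (A.d (i + 1) i).hom (d_mem_cyc A (i + 1) i)
    have h3 : (cyc A i).subtype.rTensor (X.X j)
        (d'.rTensor (X.X j) (comp A X (i + 1) j (n + 1) w)) =
        (cyc A i).subtype.rTensor (X.X j) (v ⟨(i, j), hij⟩) := by
      rw [← h, ← LinearMap.comp_apply, ← LinearMap.rTensor_comp]; rfl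
    have h4 := Module.Flat.rTensor_preserves_injective_linearMap (M := X.X j) (cyc A i).subtype
      Subtype.val_injective h3
    rw [← hv, ← h4, ← LinearMap.comp_apply, ← LinearMap.rTensor_comp]
    have h5 : hcls A i ∘ₗ d' = 0 := by
      ext y
      exact (hcls_eq_zero_iff A i _).2 ⟨y, rfl⟩
    rw [h5, LinearMap.rTensor_zero]; rfl
  · intro p _ hp
    refine comp_tz_of_ne A _ (fun h => hp (Subtype.ext (Prod.ext h.1 h.2))) _
  · intro h; exact absurd (Finset.mem_univ _) h

/-- The isomorphism `⨁_{i + j = n} Hᵢ(A) ⊗ Xⱼ ≃ Hₙ(A ⊗ X)` for a flat graded module `X` with zero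
differential. -/
def zcrossEquiv (n : ℕ) : ((p : SumPairs n) → A.homology p.1.1 ⊗[K] X.X p.1.2) ≃ₗ[K]
    (A ⊗ X : ChainComplex (ModuleCat.{u} K) ℕ).homology n :=
  LinearEquiv.ofBijective (zcrossSum A X n) ⟨zcrossSum_injective A X n, zcrossSum_surjective A X n⟩

end ZeroDifferential

/-! ### The sequence of cycles, chains and boundaries -/

section CyclesBoundaries

variable {K : Type u} [CommRing K] (B : ChainComplex (ModuleCat.{u} K) ℕ)

/-- The complex of cycles of `B`, with zero differential. -/
def kerC : ChainComplex (ModuleCat.{u} K) ℕ where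
  X j := ModuleCat.of K (cyc B j)
  d _ _ := 0

/-- The complex which consists in degree `j` of the boundaries in `Bⱼ₋₁`, with zero
differential. -/
def imC : ChainComplex (ModuleCat.{u} K) ℕ where
  X j := ModuleCat.of K (LinearMap.range (B.d j (j - 1)).hom)
  d _ _ := 0

instance : HasZeroDiff (kerC B) := ⟨fun _ _ => rfl⟩

instance : HasZeroDiff (imC B) := ⟨fun _ _ => rfl⟩

/-- The inclusion of the cycles. -/
def kerι : kerC B ⟶ B where
  f j := ModuleCat.ofHom (cyc B j).subtype
  comm' i j hij := by
    obtain rfl : j + 1 = i := hij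
    ext x
    exact x.2

/-- The differential as a map onto the boundaries. -/
def imπ : B ⟶ imC B where
  f j := ModuleCat.ofHom (B.d j (j - 1)).hom.rangeRestrict
  comm' i j _ := by
    ext x
    exact Subtype.ext (d_d_apply B i j (j - 1) x).symm

/-- The inclusion of the boundaries in the cycles. -/
def bdryι (j : ℕ) : (imC B).X (j + 1) →ₗ[K] (kerC B).X j :=
  LinearMap.codRestrict (cyc B j) (LinearMap.range (B.d (j + 1) j).hom).subtype (by
    rintro ⟨_, b, rfl⟩
    exact d_mem_cyc B (j + 1) j b)

/-- The homology class as a map on `kerC`. -/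
def kerCls (j : ℕ) : (kerC B).X j →ₗ[K] B.homology j := hcls B j

theorem kerι_injective (j : ℕ) : Function.Injective ((kerι B).f j).hom := Subtype.val_injective

theorem imπ_surjective (j : ℕ) : Function.Surjective ((imπ B).f j).hom :=
  (B.d j (j - 1)).hom.surjective_rangeRestrict

theorem imπ_kerι (j : ℕ) (z : (kerC B).X j) : ((imπ B).f j).hom (((kerι B).f j).hom z) = 0 :=
  Subtype.ext z.2

theorem kerι_bdryι_imπ (j : ℕ) (b : B.X (j + 1)) :
    ((kerι B).f j).hom (bdryι B j (((imπ B).f (j + 1)).hom b)) = (B.d (j + 1) j).hom b := rfl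

theorem kerι_mem_cyc (j : ℕ) (z : (kerC B).X j) : ((kerι B).f j).hom z ∈ cyc B j := z.2

theorem kerCls_eq (j : ℕ) (z : (kerC B).X j) :
    kerCls B j z = hcls B j ⟨_, kerι_mem_cyc B j z⟩ := rfl

theorem kerCls_surjective (j : ℕ) : Function.Surjective (kerCls B j) := hcls_surjective B j

theorem bdryι_injective (j : ℕ) : Function.Injective (bdryι B j) := fun _ _ h =>
  Subtype.ext (congrArg (fun z : cyc B j => z.1) h)

theorem bdryι_kerCls_exact (j : ℕ) : Function.Exact (bdryι B j) (kerCls B j) := by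
  intro z
  refine (hcls_eq_zero_iff B j z).trans ⟨?_, ?_⟩
  · rintro ⟨b, hb⟩
    exact ⟨((imπ B).f (j + 1)).hom b, Subtype.ext hb⟩
  · rintro ⟨w, rfl⟩
    obtain ⟨b, rfl⟩ := imπ_surjective B _ w
    exact ⟨b, rfl⟩

/-- Because of this vanishing the pairs `(i, 0)` contribute nothing to the homology of `A ⊗ imC B`,
and the remaining pairs `(i, j + 1)` match the index set of the torsion terms. -/
instance subsingleton_imC_zero : Subsingleton ((imC B).X 0) := by
  refine ⟨fun x y => ?_⟩
  obtain ⟨x, rfl⟩ := imπ_surjective B _ x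
  obtain ⟨y, rfl⟩ := imπ_surjective B _ y
  have h : (B.d 0 (0 - 1)) = 0 := B.shape _ _ (by simp)
  refine Subtype.ext ?_
  change (B.d 0 (0 - 1)).hom x = (B.d 0 (0 - 1)).hom y
  rw [h]; rfl

section Free

variable [IsDomain K] [IsPrincipalIdealRing K] [∀ j, Module.Free K (B.X j)]

instance (j : ℕ) : Module.Free K ((kerC B).X j) := free_submodule_of_free (cyc B j)

instance (j : ℕ) : Module.Free K ((imC B).X j) :=
  free_submodule_of_free (M := B.X (j - 1)) (LinearMap.range (B.d j (j - 1)).hom)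

/-- The boundaries form a submodule of a free module over a principal ideal domain, so they are
free, hence projective. -/
theorem exists_imπ_section (j : ℕ) : ∃ s : (imC B).X j →ₗ[K] B.X j,
    ∀ w, ((imπ B).f j).hom (s w) = w := by
  obtain ⟨s, hs⟩ := Module.projective_lifting_property ((imπ B).f j).hom LinearMap.id
    (imπ_surjective B j)
  exact ⟨s, fun w => LinearMap.congr_fun hs w⟩

end Free

end CyclesBoundaries

/-! ### Tensoring the sequence of cycles, chains and boundaries -/

section TensorSequence

variable {K : Type u} [CommRing K] (A B : ChainComplex (ModuleCat.{u} K) ℕ)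

/-- The short complex `A ⊗ kerC B ⟶ A ⊗ B ⟶ A ⊗ imC B`. -/
abbrev tensorSeq : ShortComplex (ChainComplex (ModuleCat.{u} K) ℕ) where
  X₁ := A ⊗ kerC B
  X₂ := A ⊗ B
  X₃ := A ⊗ imC B
  f := 𝟙 A ⊗ₘ kerι B
  g := 𝟙 A ⊗ₘ imπ B
  zero := by
    ext n : 2
    refine tensor_hom_ext A (kerC B) fun i j h x z => ?_
    change ((𝟙 A ⊗ₘ imπ B : A ⊗ B ⟶ A ⊗ imC B).f n).hom
      (((𝟙 A ⊗ₘ kerι B : A ⊗ kerC B ⟶ A ⊗ B).f n).hom (tz A (kerC B) i j n (x ⊗ₜ z))) = 0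
    rw [tensorHom_tz, tensorHom_tz, TensorProduct.map_tmul, TensorProduct.map_tmul, imπ_kerι,
      TensorProduct.tmul_zero, map_zero]

theorem id_tensorHom_tz {B C : ChainComplex (ModuleCat.{u} K) ℕ} (g : B ⟶ C) (i j n : ℕ)
    (x : A.X i) (y : B.X j) :
    ((𝟙 A ⊗ₘ g : A ⊗ B ⟶ A ⊗ C).f n).hom (tz A B i j n (x ⊗ₜ y)) =
      tz A C i j n (x ⊗ₜ (g.f j).hom y) := by
  rw [tensorHom_tz, TensorProduct.map_tmul]; rfl

/-- The map on `A ⊗ B` induced by a graded map on `B`. -/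
def gradedMap {B C : ChainComplex (ModuleCat.{u} K) ℕ} (φ : ∀ j, B.X j →ₗ[K] C.X j) (n : ℕ) :
    (A ⊗ B : ChainComplex (ModuleCat.{u} K) ℕ).X n →ₗ[K]
      (A ⊗ C : ChainComplex (ModuleCat.{u} K) ℕ).X n :=
  ∑ p : SumPairs n, tz A C p.1.1 p.1.2 n ∘ₗ (φ p.1.2).lTensor _ ∘ₗ comp A B p.1.1 p.1.2 n

theorem gradedMap_tz {B C : ChainComplex (ModuleCat.{u} K) ℕ} (φ : ∀ j, B.X j →ₗ[K] C.X j)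
    {i j n : ℕ} (h : i + j = n) (x : A.X i) (y : B.X j) :
    gradedMap A φ n (tz A B i j n (x ⊗ₜ y)) = tz A C i j n (x ⊗ₜ φ j y) := by
  rw [gradedMap, LinearMap.sum_apply, Finset.sum_eq_single (⟨(i, j), h⟩ : SumPairs n)]
  · simp only [LinearMap.comp_apply]
    rw [comp_tz_self A B h, LinearMap.lTensor_tmul]
  · intro p _ hp
    simp only [LinearMap.comp_apply]
    rw [comp_tz_of_ne A B (fun h => hp (Subtype.ext (Prod.ext h.1.symm h.2.symm))), map_zero,
      map_zero]
  · intro h; exact absurd (Finset.mem_univ _) h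

/-- The map `Hₙ(A ⊗ kerC B) → Hₙ(A ⊗ B)`. -/
def tensorKerι (n : ℕ) : (A ⊗ kerC B : ChainComplex (ModuleCat.{u} K) ℕ).homology n →ₗ[K]
    (A ⊗ B : ChainComplex (ModuleCat.{u} K) ℕ).homology n :=
  (HomologicalComplex.homologyMap (𝟙 A ⊗ₘ kerι B : A ⊗ kerC B ⟶ A ⊗ B) n).hom

/-- The map `Hₙ(A ⊗ B) → Hₙ(A ⊗ imC B)`. -/
def tensorImπ (n : ℕ) : (A ⊗ B : ChainComplex (ModuleCat.{u} K) ℕ).homology n →ₗ[K]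
    (A ⊗ imC B : ChainComplex (ModuleCat.{u} K) ℕ).homology n :=
  (HomologicalComplex.homologyMap (𝟙 A ⊗ₘ imπ B : A ⊗ B ⟶ A ⊗ imC B) n).hom

theorem tensorKerι_zcross (i j n : ℕ) (t : A.homology i ⊗[K] (kerC B).X j) :
    tensorKerι A B n (zcross A (kerC B) i j n t) = cross A B i j n ((kerCls B j).lTensor _ t) := by
  induction t using TensorProduct.induction_on with
  | zero => simp only [map_zero]
  | add a b ha hb => rw [map_add, map_add, ha, hb, map_add, map_add]
  | tmul a z =>
    obtain ⟨x, rfl⟩ := hcls_surjective A i a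
    rw [zcross_hcls, LinearMap.lTensor_tmul, kerCls_eq, cross_hcls, tensorKerι,
      homologyMap_hcls]
    refine congrArg _ (Subtype.ext ?_)
    exact id_tensorHom_tz A (kerι B) i j n x.1 z

variable [IsDomain K] [IsPrincipalIdealRing K] [∀ j, Module.Free K (B.X j)]

/-- Exactness is a degreewise matter, so the section `s` and the retraction `r` need not commute
with differentials. They survive tensoring with `A` as graded maps, and the split identities `h1`,
`h2`, `h3` give exactness with no condition on `A`. -/
theorem tensorSeq_shortExact : (tensorSeq A B).ShortExact := by
  choose s hs using exists_imπ_section B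
  have hr : ∀ j b, ((imπ B).f j).hom (b - s j (((imπ B).f j).hom b)) = 0 := fun j b => by
    rw [map_sub, hs, sub_self]
  have hr' : ∀ j, ∃ r : B.X j →ₗ[K] (kerC B).X j,
      ∀ b, ((kerι B).f j).hom (r b) = b - s j (((imπ B).f j).hom b) := fun j =>
    ⟨LinearMap.codRestrict (cyc B j) (LinearMap.id - s j ∘ₗ ((imπ B).f j).hom)
      (fun b => congrArg Subtype.val (hr j b)), fun b => rfl⟩
  choose r hr'' using hr'
  refine HomologicalComplex.shortExact_of_degreewise_shortExact _ fun n => ?_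
  have h1 : gradedMap A r n ∘ₗ ((tensorSeq A B).f.f n).hom = LinearMap.id := by
    refine tensor_hom_ext A (kerC B) fun i j h x z => ?_
    change gradedMap A r n (((𝟙 A ⊗ₘ kerι B : A ⊗ kerC B ⟶ A ⊗ B).f n).hom _) = _
    rw [id_tensorHom_tz, gradedMap_tz A r h]
    have e : r j (((kerι B).f j).hom z) = z := by
      apply kerι_injective
      rw [hr'', imπ_kerι, map_zero, sub_zero]
    rw [e]; rfl
  have h2 : ((tensorSeq A B).g.f n).hom ∘ₗ gradedMap A s n = LinearMap.id := by
    refine tensor_hom_ext A (imC B) fun i j h x z => ?_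
    change ((𝟙 A ⊗ₘ imπ B : A ⊗ B ⟶ A ⊗ imC B).f n).hom (gradedMap A s n _) = _
    rw [gradedMap_tz A s h, id_tensorHom_tz, hs]; rfl
  have h3 : ((𝟙 A ⊗ₘ kerι B : A ⊗ kerC B ⟶ A ⊗ B).f n).hom ∘ₗ gradedMap A r n +
      gradedMap A s n ∘ₗ ((𝟙 A ⊗ₘ imπ B : A ⊗ B ⟶ A ⊗ imC B).f n).hom = LinearMap.id := by
    refine tensor_hom_ext A B fun i j h x z => ?_
    change ((𝟙 A ⊗ₘ kerι B : A ⊗ kerC B ⟶ A ⊗ B).f n).hom (gradedMap A r n _) +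
      gradedMap A s n (((𝟙 A ⊗ₘ imπ B : A ⊗ B ⟶ A ⊗ imC B).f n).hom _) = _
    rw [gradedMap_tz A r h, id_tensorHom_tz, hr'', id_tensorHom_tz, gradedMap_tz A s h, ← map_add,
      ← TensorProduct.tmul_add, sub_add_cancel]; rfl
  have h4 : ∀ x, ((𝟙 A ⊗ₘ imπ B : A ⊗ B ⟶ A ⊗ imC B).f n).hom x = 0 →
      ((𝟙 A ⊗ₘ kerι B : A ⊗ kerC B ⟶ A ⊗ B).f n).hom (gradedMap A r n x) = x := by
    intro x hx
    have := LinearMap.congr_fun h3 x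
    rwa [LinearMap.add_apply, LinearMap.comp_apply, LinearMap.comp_apply, hx, map_zero,
      add_zero] at this
  refine { exact := ?_, mono_f := ?_, epi_g := ?_ }
  · rw [ShortComplex.moduleCat_exact_iff]
    intro x hx
    refine ⟨gradedMap A r n x, ?_⟩
    exact h4 x hx
  · refine (ModuleCat.mono_iff_injective _).2 (Function.LeftInverse.injective (g := gradedMap A r n)
      fun x => LinearMap.congr_fun h1 x)
  · exact (ModuleCat.epi_iff_surjective _).2 fun x =>
      ⟨gradedMap A s n x, LinearMap.congr_fun h2 x⟩

/-- The connecting map `Hₘ₊₁(A ⊗ imC B) → Hₘ(A ⊗ kerC B)`. -/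
def tensorδ (m : ℕ) : (A ⊗ imC B : ChainComplex (ModuleCat.{u} K) ℕ).homology (m + 1) →ₗ[K]
    (A ⊗ kerC B : ChainComplex (ModuleCat.{u} K) ℕ).homology m :=
  ((tensorSeq_shortExact A B).δ (m + 1) m (by simp)).hom

/-- For a cycle `x` and `w = db`, the element `x ⊗ b` lifts `x ⊗ w`, and its boundary is `(-1) ^ i`
times `x ⊗ db`, which already lies in `A ⊗ kerC B`. -/
theorem δ_zcross (i j m : ℕ) (r : A.homology i ⊗[K] (imC B).X (j + 1)) :
    tensorδ A B m (zcross A (imC B) i (j + 1) (m + 1) r) =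
      (-1 : K) ^ i • zcross A (kerC B) i j m ((bdryι B j).lTensor _ r) := by
  induction r using TensorProduct.induction_on with
  | zero => simp only [map_zero, smul_zero]
  | add a b ha hb =>
    rw [map_add, map_add, ha, hb, map_add, map_add, smul_add]
  | tmul a w =>
    obtain ⟨x, rfl⟩ := hcls_surjective A i a
    obtain ⟨b, rfl⟩ := imπ_surjective B _ w
    rw [zcross_hcls, LinearMap.lTensor_tmul, zcross_hcls, ← map_smul]
    refine δ_hcls (tensorSeq_shortExact A B) m _ (tz A B i (j + 1) (m + 1) (x.1 ⊗ₜ b)) _ ?_ ?_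
    · exact id_tensorHom_tz A (imπ B) i (j + 1) (m + 1) x.1 b
    · change ((𝟙 A ⊗ₘ kerι B : A ⊗ kerC B ⟶ A ⊗ B).f m).hom ((-1 : K) ^ i • tz A (kerC B) i j m _) =
        ((A ⊗ B : ChainComplex (ModuleCat.{u} K) ℕ).d (m + 1) m).hom _
      rw [map_smul, id_tensorHom_tz, kerι_bdryι_imπ, d_tz, (mem_cyc A).1 x.2,
        TensorProduct.zero_tmul, map_zero, zero_add]
      rfl

theorem tensorδ_tensorKerι_exact (m : ℕ) :
    Function.Exact (tensorδ A B m) (tensorKerι A B m) :=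
  (ShortComplex.ShortExact.moduleCat_exact_iff_function_exact _).1
    ((tensorSeq_shortExact A B).homology_exact₁ (m + 1) m (by simp))

theorem tensorKerι_tensorImπ_exact (n : ℕ) :
    Function.Exact (tensorKerι A B n) (tensorImπ A B n) :=
  (ShortComplex.ShortExact.moduleCat_exact_iff_function_exact _).1
    ((tensorSeq_shortExact A B).homology_exact₂ n)

theorem tensorImπ_tensorδ_exact (m : ℕ) :
    Function.Exact (tensorImπ A B (m + 1)) (tensorδ A B m) :=
  (ShortComplex.ShortExact.moduleCat_exact_iff_function_exact _).1
    ((tensorSeq_shortExact A B).homology_exact₃ (m + 1) m (by simp))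

end TensorSequence

/-! ### `Tor₁` from a two-term projective resolution -/

section TorKernel

variable {K : Type u} [CommRing K]

/-- If `D₂ = 0`, the first homology of `D` is a submodule of `D₁`. -/
def homologyOneι (D : ChainComplex (ModuleCat.{u} K) ℕ) [Subsingleton (D.X 2)] :
    D.homology 1 →ₗ[K] D.X 1 :=
  descSurj (hcls D 1) (hcls_surjective D 1) (cyc D 1).subtype (fun x hx => by
    obtain ⟨y, hy⟩ := (hcls_eq_zero_iff D 1 x).1 hx
    rw [Submodule.subtype_apply, ← hy, Subsingleton.elim y 0, map_zero])

theorem homologyOneι_hcls (D : ChainComplex (ModuleCat.{u} K) ℕ) [Subsingleton (D.X 2)]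
    (x : cyc D 1) : homologyOneι D (hcls D 1 x) = x :=
  descSurj_apply _ _ _ _ _

theorem homologyOneι_injective (D : ChainComplex (ModuleCat.{u} K) ℕ) [Subsingleton (D.X 2)] :
    Function.Injective (homologyOneι D) := by
  intro a b h
  obtain ⟨x, rfl⟩ := hcls_surjective D 1 a
  obtain ⟨y, rfl⟩ := hcls_surjective D 1 b
  rw [homologyOneι_hcls, homologyOneι_hcls] at h
  rw [Subtype.ext h]

theorem homologyOneι_naturality {D E : ChainComplex (ModuleCat.{u} K) ℕ} [Subsingleton (D.X 2)]
    [Subsingleton (E.X 2)] (f : D ⟶ E) (a : D.homology 1) :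
    homologyOneι E ((HomologicalComplex.homologyMap f 1).hom a) =
      (f.f 1).hom (homologyOneι D a) := by
  obtain ⟨x, rfl⟩ := hcls_surjective D 1 a
  rw [homologyMap_hcls, homologyOneι_hcls, homologyOneι_hcls]

/-- A projective resolution of length one of a module. -/
structure ShortResolution (M : ModuleCat.{u} K) where
  P₁ : ModuleCat.{u} K
  P₀ : ModuleCat.{u} K
  i : P₁ ⟶ P₀
  p : P₀ ⟶ M
  projective₁ : Projective P₁
  projective₀ : Projective P₀
  injective : Function.Injective i.hom
  exact : Function.Exact i.hom p.hom
  surjective : Function.Surjective p.hom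

namespace ShortResolution

variable {M M' : ModuleCat.{u} K} (R : ShortResolution M) (R' : ShortResolution M')

/-- The modules of the resolution. -/
def X (n : ℕ) : ModuleCat.{u} K :=
  match n with
  | 0 => R.P₀
  | 1 => R.P₁
  | _ + 2 => ModuleCat.of K PUnit.{u + 1}

/-- The differentials of the resolution. -/
def d (n : ℕ) : R.X (n + 1) ⟶ R.X n :=
  match n with
  | 0 => R.i
  | _ + 1 => 0

/-- The resolution as a chain complex. -/
def complex : ChainComplex (ModuleCat.{u} K) ℕ :=
  ChainComplex.of R.X R.d (fun n => by
    change 0 ≫ _ = 0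
    rw [zero_comp])

theorem complex_d_one : (R.complex.d 1 0) = R.i :=
  ChainComplex.of_d R.X R.d 0

instance (n : ℕ) : Subsingleton (R.complex.X (n + 2)) :=
  inferInstanceAs (Subsingleton PUnit.{u + 1})

/-- The augmentation. -/
def π : R.complex ⟶ (ChainComplex.single₀ (ModuleCat.{u} K)).obj M :=
  (ChainComplex.toSingle₀Equiv _ _).symm ⟨R.p, by
    rw [complex_d_one]
    ext x
    exact R.exact.apply_apply_eq_zero x⟩

theorem π_f_zero : R.π.f 0 = R.p := by
  exact ChainComplex.toSingle₀Equiv_symm_apply_f_zero _ _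

/-- Degree `0` is exactness at `P₀` together with surjectivity of `p`, degree `1` is injectivity of
`i`, and in higher degrees both complexes are zero. -/
theorem quasiIso_π : QuasiIso R.π := by
  refine (quasiIso_iff _).2 fun n => ?_
  rw [quasiIsoAt_iff_isIso_homologyMap]
  rw [ConcreteCategory.isIso_iff_bijective]
  have hs : ∀ n, Subsingleton (((ChainComplex.single₀ (ModuleCat.{u} K)).obj M).X (n + 1)) :=
    fun n => ModuleCat.subsingleton_of_isZero
      (HomologicalComplex.isZero_single_obj_X (ComplexShape.down ℕ) 0 M (n + 1) (by omega))
  constructor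
  · refine (injective_iff_map_eq_zero (HomologicalComplex.homologyMap R.π n).hom).2 fun a ha => ?_
    obtain ⟨x, rfl⟩ := hcls_surjective _ n a
    rw [homologyMap_hcls, hcls_eq_zero_iff] at ha
    rw [hcls_eq_zero_iff]
    obtain ⟨y, hy⟩ := ha
    match n with
    | 0 =>
      rw [Subsingleton.elim y 0, map_zero, π_f_zero] at hy
      obtain ⟨w, hw⟩ := (R.exact x.1).1 hy.symm
      exact ⟨w, by rw [complex_d_one]; exact hw⟩
    | 1 =>
      have h0 : R.i.hom x.1 = 0 := by
        have := x.2
        rw [mem_cyc] at this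
        change (R.complex.d 1 0).hom x.1 = 0 at this
        rwa [complex_d_one] at this
      exact ⟨0, by rw [map_zero]; exact (R.injective (h0.trans (map_zero _).symm)).symm⟩
    | n + 2 => exact ⟨0, Subsingleton.elim _ _⟩
  · intro a
    obtain ⟨x, rfl⟩ := hcls_surjective _ n a
    match n with
    | 0 =>
      obtain ⟨w, hw⟩ := R.surjective x.1
      have hw' : (show R.complex.X 0 from w) ∈ cyc R.complex 0 := by
        rw [mem_cyc, HomologicalComplex.shape _ 0 (0 - 1) (by simp)]; rfl
      refine ⟨hcls R.complex 0 ⟨w, hw'⟩, (homologyMap_hcls R.π 0 _).trans ?_⟩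
      refine congrArg _ (Subtype.ext ?_)
      change (R.π.f 0).hom w = _
      rw [π_f_zero]; exact hw
    | n + 1 =>
      refine ⟨0, ?_⟩
      rw [map_zero, show x = 0 from Subtype.ext (Subsingleton.elim _ _), map_zero]

/-- The projective resolution. -/
def projectiveResolution : ProjectiveResolution M where
  complex := R.complex
  projective n := by
    match n with
    | 0 => exact R.projective₀
    | 1 => exact R.projective₁
    | n + 2 => exact (ModuleCat.isZero_of_subsingleton (R.complex.X (n + 2))).projective
  π := R.π
  quasiIso := R.quasiIso_π

variable {R R'} in
/-- The map of resolutions induced by maps of modules. -/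
def map (φ₁ : R.P₁ ⟶ R'.P₁) (φ₀ : R.P₀ ⟶ R'.P₀) (h : R.i ≫ φ₀ = φ₁ ≫ R'.i) :
    R.complex ⟶ R'.complex where
  f n := match n with
    | 0 => φ₀
    | 1 => φ₁
    | _ + 2 => 0
  comm' i j hij := by
    obtain rfl : j + 1 = i := hij
    match j with
    | 0 =>
      rw [complex_d_one, complex_d_one]; exact h.symm
    | j + 1 =>
      ext x
      rw [Subsingleton.elim x 0, map_zero, map_zero]

variable (N : ModuleCat.{u} K)

/-- The resolution tensored with a module. -/
def tensorComplex : ChainComplex (ModuleCat.{u} K) ℕ :=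
  (((tensoringLeft (ModuleCat.{u} K)).obj N).mapHomologicalComplex _).obj R.complex

instance : Subsingleton ((R.tensorComplex N).X 2) :=
  inferInstanceAs (Subsingleton (N ⊗[K] PUnit.{u + 1}))

/-- The embedding of `Tor₁(N, M)` in `N ⊗ P₁`. -/
def torι : ((Tor (ModuleCat.{u} K) 1).obj N).obj M →ₗ[K] N ⊗[K] R.P₁ :=
  homologyOneι (R.tensorComplex N) ∘ₗ
    (R.projectiveResolution.isoLeftDerivedObj ((tensoringLeft (ModuleCat.{u} K)).obj N) 1).hom.hom

theorem torι_injective : Function.Injective (R.torι N) :=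
  (homologyOneι_injective (R.tensorComplex N)).comp
    ((ConcreteCategory.isIso_iff_bijective
      (R.projectiveResolution.isoLeftDerivedObj
        ((tensoringLeft (ModuleCat.{u} K)).obj N) 1).hom).1 inferInstance).1

theorem tensorComplex_d_one : (R.tensorComplex N).d 1 0 = N ◁ R.i :=
  congrArg (fun f => N ◁ f) R.complex_d_one

/-- `Tor₁(N, M)` is the first homology of `N ⊗ R` for the resolution `R` of the second argument.
Since `R` has no term in degree `2`, there is nothing to divide out, and the homology is the kernel
of `N ⊗ P₁ → N ⊗ P₀`. -/
theorem mem_range_torι (t : N ⊗[K] R.P₁) :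
    t ∈ LinearMap.range (R.torι N) ↔ R.i.hom.lTensor N t = 0 := by
  have hd : (R.tensorComplex N).d 1 0 = ModuleCat.ofHom (R.i.hom.lTensor N) :=
    R.tensorComplex_d_one N
  constructor
  · rintro ⟨z, rfl⟩
    obtain ⟨x, hx⟩ := hcls_surjective (R.tensorComplex N) 1
      ((R.projectiveResolution.isoLeftDerivedObj
        ((tensoringLeft (ModuleCat.{u} K)).obj N) 1).hom.hom z)
    have h1 : R.torι N z = x.1 :=
      (congrArg (homologyOneι (R.tensorComplex N)) hx.symm).trans (homologyOneι_hcls _ x)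
    rw [h1]
    have h2 := (mem_cyc _).1 x.2
    change ((R.tensorComplex N).d 1 0).hom x.1 = 0 at h2
    rwa [hd] at h2
  · intro h
    have ht : (show (R.tensorComplex N).X 1 from t) ∈ cyc (R.tensorComplex N) 1 := by
      rw [mem_cyc]
      change ((R.tensorComplex N).d 1 0).hom _ = 0
      rw [hd]; exact h
    obtain ⟨z, hz⟩ := ((ConcreteCategory.isIso_iff_bijective
      (R.projectiveResolution.isoLeftDerivedObj
        ((tensoringLeft (ModuleCat.{u} K)).obj N) 1).hom).1 inferInstance).2
          (hcls (R.tensorComplex N) 1 ⟨t, ht⟩)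
    refine ⟨z, (congrArg (homologyOneι (R.tensorComplex N)) hz).trans ?_⟩
    rw [homologyOneι_hcls]

/-- Both functorialities of `Tor₁` are induced by a single chain map `N ⊗ R ⟶ N' ⊗ R'`. As `torι` is
injective, identities between maps into `Tor₁` can then be checked in `N' ⊗ P₁'`. -/
theorem torι_map {N' : ModuleCat.{u} K} (f : N ⟶ N') (g : M ⟶ M') (φ₁ : R.P₁ ⟶ R'.P₁)
    (φ₀ : R.P₀ ⟶ R'.P₀) (h : R.i ≫ φ₀ = φ₁ ≫ R'.i) (hp : φ₀ ≫ R'.p = R.p ≫ g)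
    (z : ((Tor (ModuleCat.{u} K) 1).obj N).obj M) :
    R'.torι N' ((((Tor (ModuleCat.{u} K) 1).map f).app M ≫
      ((Tor (ModuleCat.{u} K) 1).obj N').map g).hom z) =
      TensorProduct.map f.hom φ₁.hom (R.torι N z) := by
  have h1 := R.projectiveResolution.leftDerived_app_eq
    ((tensoringLeft (ModuleCat.{u} K)).map f) 1
  have h2 := ProjectiveResolution.isoLeftDerivedObj_hom_naturality g R.projectiveResolution
    R'.projectiveResolution (map φ₁ φ₀ h) (by
      change φ₀ ≫ R'.π.f 0 = R.π.f 0 ≫ g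
      rw [π_f_zero, π_f_zero]; exact hp) ((tensoringLeft (ModuleCat.{u} K)).obj N') 1
  let F : R.tensorComplex N ⟶ R'.tensorComplex N' :=
    (NatTrans.mapHomologicalComplex ((tensoringLeft (ModuleCat.{u} K)).map f) _).app R.complex ≫
      (((tensoringLeft (ModuleCat.{u} K)).obj N').mapHomologicalComplex _).map (map φ₁ φ₀ h)
  have key : ((NatTrans.leftDerived ((tensoringLeft (ModuleCat.{u} K)).map f) 1).app M ≫
      (((tensoringLeft (ModuleCat.{u} K)).obj N').leftDerived 1).map g) ≫
      (R'.projectiveResolution.isoLeftDerivedObj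
        ((tensoringLeft (ModuleCat.{u} K)).obj N') 1).hom =
      (R.projectiveResolution.isoLeftDerivedObj
        ((tensoringLeft (ModuleCat.{u} K)).obj N) 1).hom ≫
      HomologicalComplex.homologyMap F 1 := by
    rw [Category.assoc, h2, h1, Category.assoc, Category.assoc, Iso.inv_hom_id_assoc]
    exact congrArg (_ ≫ ·) (HomologicalComplex.homologyMap_comp _ _ 1).symm
  have key2 := congrArg (fun k => homologyOneι (R'.tensorComplex N') (k.hom z)) key
  refine key2.trans ((homologyOneι_naturality F _).trans ?_)
  change (F.f 1).hom (R.torι N z) = _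
  induction R.torι N z using TensorProduct.induction_on with
  | zero => rw [map_zero]; exact (map_zero _)
  | add a b ha hb => rw [map_add, ← ha, ← hb]; exact map_add (F.f 1).hom a b
  | tmul a b => rfl

end ShortResolution

end TorKernel

/-! ### The algebraic Künneth theorem -/

section AlgebraicKunneth

variable {K : Type u} [CommRing K]

/-- `(i, j) ↦ (i, j + 1)`. -/
abbrev PredSumPairs.succRight {n : ℕ} (p : PredSumPairs n) : SumPairs n :=
  ⟨(p.1.1, p.1.2 + 1), by have := p.2; omega⟩

/-- `(i, j) ↦ (i, j)`. -/
abbrev SumPairs.toPred {m : ℕ} (p : SumPairs m) : PredSumPairs (m + 1) :=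
  ⟨p.1, by have := p.2; omega⟩

theorem SumPairs.succRight_injective (m : ℕ) :
    Function.Injective fun q : SumPairs m => q.toPred.succRight := by
  intro p q h
  have h1 : (p.1.1, p.1.2 + 1) = (q.1.1, q.1.2 + 1) := congrArg Subtype.val h
  simp only [Prod.mk.injEq, add_left_inj] at h1
  exact Subtype.ext (Prod.ext h1.1 h1.2)

section Functoriality

variable {A A' : ChainComplex (ModuleCat.{u} K) ℕ} (f : A ⟶ A')
variable {B B' : ChainComplex (ModuleCat.{u} K) ℕ} (g : B ⟶ B')

/-- The map induced on cycles. -/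
def kerCMap : kerC B ⟶ kerC B' where
  f j := ModuleCat.ofHom ((g.f j).hom.restrict fun _ hx => map_mem_cyc g hx)
  comm' i j _ := by
    exact Limits.comp_zero.trans Limits.zero_comp.symm

/-- The map induced on boundaries. -/
def imCMap : imC B ⟶ imC B' where
  f j := ModuleCat.ofHom ((g.f (j - 1)).hom.restrict (by
    rintro _ ⟨b, rfl⟩
    exact ⟨(g.f j).hom b, hom_comm_apply g j (j - 1) b⟩))
  comm' i j _ := by
    exact Limits.comp_zero.trans Limits.zero_comp.symm

theorem imπ_naturality : g ≫ imπ B' = imπ B ≫ imCMap g := by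
  ext n x
  exact Subtype.ext (hom_comm_apply g n (n - 1) x)

theorem bdryι_naturality (j : ℕ) (w : (imC B).X (j + 1)) :
    ((kerCMap g).f j).hom (bdryι B j w) = bdryι B' j (((imCMap g).f (j + 1)).hom w) := rfl

theorem kerCls_naturality (j : ℕ) (z : (kerC B).X j) :
    kerCls B' j (((kerCMap g).f j).hom z) =
      (HomologicalComplex.homologyMap g j).hom (kerCls B j z) :=
  (homologyMap_hcls g j z).symm

theorem homologyMap_zcross {X X' : ChainComplex (ModuleCat.{u} K) ℕ} [HasZeroDiff X]
    [HasZeroDiff X'] (h : X ⟶ X') (i j n : ℕ) (t : A.homology i ⊗[K] X.X j) :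
    (HomologicalComplex.homologyMap
      (f ⊗ₘ h : (A ⊗ X : ChainComplex (ModuleCat.{u} K) ℕ) ⟶ A' ⊗ X') n).hom
        (zcross A X i j n t) =
      zcross A' X' i j n (TensorProduct.map (HomologicalComplex.homologyMap f i).hom
        (h.f j).hom t) := by
  induction t using TensorProduct.induction_on with
  | zero => simp only [map_zero]
  | add a b ha hb => simp only [map_add, ha, hb]
  | tmul a b =>
    obtain ⟨x, rfl⟩ := hcls_surjective A i a
    rw [zcross_hcls, homologyMap_hcls, TensorProduct.map_tmul, homologyMap_hcls,
      zcross_hcls]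
    congr 2
    rw [tensorHom_tz]; rfl

end Functoriality

variable (A B : ChainComplex (ModuleCat.{u} K) ℕ)

/-- The sum of all cross products with values in degree `n`. -/
def crossSum (n : ℕ) : ((p : SumPairs n) → A.homology p.1.1 ⊗[K] B.homology p.1.2) →ₗ[K]
    (A ⊗ B : ChainComplex (ModuleCat.{u} K) ℕ).homology n :=
  ∑ p : SumPairs n, cross A B p.1.1 p.1.2 n ∘ₗ LinearMap.proj p

theorem crossSum_apply (n : ℕ) (t : (p : SumPairs n) → A.homology p.1.1 ⊗[K] B.homology p.1.2) :
    crossSum A B n t = ∑ p : SumPairs n, cross A B p.1.1 p.1.2 n (t p) := by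
  rw [crossSum, LinearMap.sum_apply]; rfl

theorem tensorKerι_zcrossSum (n : ℕ)
    (s : (p : SumPairs n) → A.homology p.1.1 ⊗[K] (kerC B).X p.1.2) :
    tensorKerι A B n (zcrossSum A (kerC B) n s) =
      crossSum A B n fun p => (kerCls B p.1.2).lTensor _ (s p) := by
  rw [zcrossSum_apply, crossSum_apply, map_sum]
  exact Finset.sum_congr rfl fun p _ => tensorKerι_zcross A B _ _ _ _

variable [IsDomain K] [IsPrincipalIdealRing K] [∀ j, Module.Free K (B.X j)]

/-- The summands at `(i, 0)` vanish since there are no boundaries in that degree of `imC B`; the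
others are reindexed by `(i, j) ↦ (i, j + 1)`, to which `δ_zcross` applies. -/
theorem tensorδ_zcrossSum (m : ℕ)
    (r : (p : SumPairs (m + 1)) → A.homology p.1.1 ⊗[K] (imC B).X p.1.2) :
    tensorδ A B m (zcrossSum A (imC B) (m + 1) r) = zcrossSum A (kerC B) m fun q =>
      (-1 : K) ^ q.1.1 • (bdryι B q.1.2).lTensor _ (r q.toPred.succRight) := by
  rw [zcrossSum_apply, zcrossSum_apply, map_sum]
  refine (Fintype.sum_of_injective _ (SumPairs.succRight_injective m) _ _ ?_ ?_).symm
  · rintro ⟨⟨i, j⟩, hij⟩ hp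
    rcases j with _ | j
    · have h : r ⟨(i, 0), hij⟩ = 0 := by
        have : Subsingleton (A.homology i ⊗[K] (imC B).X 0) := inferInstance
        exact Subsingleton.elim _ _
      rw [h, map_zero, map_zero]
    · exact absurd ⟨⟨(i, j), by simp only at hij; omega⟩, rfl⟩ hp
  · intro q
    rw [map_smul]
    exact (δ_zcross A B q.1.1 q.1.2 m _).symm

/-- The resolution of the homology by boundaries and cycles. -/
def homologyResolution (j : ℕ) : ShortResolution (B.homology j) where
  P₁ := (imC B).X (j + 1)
  P₀ := (kerC B).X j
  i := ModuleCat.ofHom (bdryι B j)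
  p := ModuleCat.ofHom (kerCls B j)
  projective₁ := ModuleCat.projective_of_free (Module.Free.chooseBasis K ((imC B).X (j + 1)))
  projective₀ := ModuleCat.projective_of_free (Module.Free.chooseBasis K ((kerC B).X j))
  injective := bdryι_injective B j
  exact := bdryι_kerCls_exact B j
  surjective := kerCls_surjective B j

/-- The component in `Hᵢ(A) ⊗ (imC B)ⱼ₊₁` of a homology class of `A ⊗ B`. -/
def bdryComp (n : ℕ) (p : PredSumPairs n) :
    (A ⊗ B : ChainComplex (ModuleCat.{u} K) ℕ).homology n →ₗ[K]
      A.homology p.1.1 ⊗[K] (imC B).X (p.1.2 + 1) :=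
  LinearMap.proj (R := K) (φ := fun p : SumPairs n => A.homology p.1.1 ⊗[K] (imC B).X p.1.2)
    p.succRight ∘ₗ (zcrossEquiv A (imC B) n).symm.toLinearMap ∘ₗ tensorImπ A B n

/-- The signs are units and `zcrossSum` is injective on `A ⊗ kerC B`, so the connecting map vanishes
exactly when it does so in each bidegree; this is the condition that describes the range of `torι`.
-/
theorem tensorδ_eq_zero_iff (m : ℕ)
    (r : (p : SumPairs (m + 1)) → A.homology p.1.1 ⊗[K] (imC B).X p.1.2) :
    tensorδ A B m (zcrossSum A (imC B) (m + 1) r) = 0 ↔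
      ∀ p : PredSumPairs (m + 1), (bdryι B p.1.2).lTensor (A.homology p.1.1) (r p.succRight) = 0 := by
  rw [tensorδ_zcrossSum, map_eq_zero_iff _ (zcrossSum_injective A (kerC B) m), funext_iff]
  have hu : ∀ i : ℕ, IsUnit ((-1 : K) ^ i) := fun i => (isUnit_one.neg).pow i
  constructor
  · intro h p
    have := h ⟨p.1, by have := p.2; omega⟩
    exact ((hu _).smul_eq_zero).1 this
  · intro h q
    exact ((hu _).smul_eq_zero).2 (h q.toPred)

theorem lTensor_bdryComp (n : ℕ) (p : PredSumPairs n)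
    (z : (A ⊗ B : ChainComplex (ModuleCat.{u} K) ℕ).homology n) :
    (bdryι B p.1.2).lTensor _ (bdryComp A B n p z) = 0 := by
  rcases n with _ | m
  · exact absurd p.2 (by omega)
  refine (tensorδ_eq_zero_iff A B m
    ((zcrossEquiv A (imC B) (m + 1)).symm (tensorImπ A B (m + 1) z))).1 ?_ p
  have h : zcrossSum A (imC B) (m + 1) ((zcrossEquiv A (imC B) (m + 1)).symm
      (tensorImπ A B (m + 1) z)) = tensorImπ A B (m + 1) z :=
    (zcrossEquiv A (imC B) (m + 1)).apply_symm_apply _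
  rw [h]
  exact (tensorImπ_tensorδ_exact A B m).apply_apply_eq_zero z

/-- The component `Hₙ(A ⊗ B) → Tor₁(Hᵢ(A), Hⱼ(B))` of the second map of the Künneth sequence. -/
def torComp (n : ℕ) (p : PredSumPairs n) :
    (A ⊗ B : ChainComplex (ModuleCat.{u} K) ℕ).homology n →ₗ[K]
      ((Tor (ModuleCat.{u} K) 1).obj (A.homology p.1.1)).obj (B.homology p.1.2) :=
  (LinearEquiv.ofInjective ((homologyResolution B p.1.2).torι (A.homology p.1.1))
    ((homologyResolution B p.1.2).torι_injective _)).symm.toLinearMap ∘ₗ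
    LinearMap.codRestrict _ (bdryComp A B n p) (fun z =>
      ((homologyResolution B p.1.2).mem_range_torι _ _).2 (lTensor_bdryComp A B n p z))

theorem torι_torComp (n : ℕ) (p : PredSumPairs n)
    (z : (A ⊗ B : ChainComplex (ModuleCat.{u} K) ℕ).homology n) :
    (homologyResolution B p.1.2).torι _ (torComp A B n p z) = bdryComp A B n p z :=
  congrArg Subtype.val ((LinearEquiv.ofInjective
    ((homologyResolution B p.1.2).torι (A.homology p.1.1))
    ((homologyResolution B p.1.2).torι_injective _)).apply_symm_apply ⟨bdryComp A B n p z, _⟩)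

/-- The second map of the Künneth sequence. -/
def torPi (n : ℕ) : (A ⊗ B : ChainComplex (ModuleCat.{u} K) ℕ).homology n →ₗ[K]
    ((p : PredSumPairs n) →
      ((Tor (ModuleCat.{u} K) 1).obj (A.homology p.1.1)).obj (B.homology p.1.2)) :=
  LinearMap.pi (torComp A B n)

/-- Lift the tensors from homology of `B` to cycles. If the result dies in the homology of `A ⊗ B`,
it comes from the connecting map, hence from boundaries in the second factor, and these vanish in
homology. -/
theorem crossSum_injective (n : ℕ) : Function.Injective (crossSum A B n) := by
  rw [injective_iff_map_eq_zero]
  intro t ht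
  have h1 : ∀ p : SumPairs n, ∃ s : A.homology p.1.1 ⊗[K] (kerC B).X p.1.2,
      (kerCls B p.1.2).lTensor _ s = t p := fun p =>
    LinearMap.lTensor_surjective _ (kerCls_surjective B p.1.2) (t p)
  choose s hs using h1
  have h2 : tensorKerι A B n (zcrossSum A (kerC B) n s) = 0 := by
    rw [tensorKerι_zcrossSum, funext hs, ht]
  obtain ⟨w, hw⟩ := (tensorδ_tensorKerι_exact A B n _).1 h2
  obtain ⟨r, rfl⟩ := zcrossSum_surjective A (imC B) (n + 1) w
  rw [tensorδ_zcrossSum] at hw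
  have h3 := zcrossSum_injective A (kerC B) n hw
  funext p
  rw [← hs p, ← congrFun h3 p, map_smul, ← LinearMap.comp_apply, ← LinearMap.lTensor_comp,
    (bdryι_kerCls_exact B p.1.2).linearMap_comp_eq_zero, LinearMap.lTensor_zero,
    LinearMap.zero_apply, smul_zero]
  rfl

/-- The maps `torι` are injective and the components of `tensorImπ` at `(i, 0)` lie in zero modules,
so passing to `Tor₁` loses no information. -/
theorem torPi_eq_zero_iff (n : ℕ) (z : (A ⊗ B : ChainComplex (ModuleCat.{u} K) ℕ).homology n) :
    torPi A B n z = 0 ↔ tensorImπ A B n z = 0 := by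
  have h1 : torPi A B n z = 0 ↔ ∀ p, bdryComp A B n p z = 0 := by
    rw [funext_iff]
    refine forall_congr' fun p => ?_
    rw [← torι_torComp]
    exact (map_eq_zero_iff _ ((homologyResolution B p.1.2).torι_injective _)).symm
  rw [h1]
  constructor
  · intro h
    have h2 : (zcrossEquiv A (imC B) n).symm (tensorImπ A B n z) = 0 := by
      funext ⟨⟨i, j⟩, hij⟩
      rcases j with _ | j
      · have : Subsingleton (A.homology i ⊗[K] (imC B).X 0) := inferInstance
        exact Subsingleton.elim _ _
      · exact h ⟨(i, j), hij⟩
    exact (LinearEquiv.map_eq_zero_iff _).1 h2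
  · intro h p
    change ((zcrossEquiv A (imC B) n).symm (tensorImπ A B n z)) p.succRight = 0
    rw [h, map_zero]; rfl

theorem crossSum_torPi_exact (n : ℕ) : Function.Exact (crossSum A B n) (torPi A B n) := by
  intro z
  rw [torPi_eq_zero_iff]
  refine (tensorKerι_tensorImπ_exact A B n z).trans ?_
  constructor
  · rintro ⟨w, rfl⟩
    obtain ⟨s, rfl⟩ := zcrossSum_surjective A (kerC B) n w
    exact ⟨_, (tensorKerι_zcrossSum A B n s).symm⟩
  · rintro ⟨t, rfl⟩
    have h1 : ∀ p : SumPairs n, ∃ s : A.homology p.1.1 ⊗[K] (kerC B).X p.1.2,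
        (kerCls B p.1.2).lTensor _ s = t p := fun p =>
      LinearMap.lTensor_surjective _ (kerCls_surjective B p.1.2) (t p)
    choose s hs using h1
    exact ⟨zcrossSum A (kerC B) n s, by rw [tensorKerι_zcrossSum, funext hs]⟩

theorem torPi_surjective (n : ℕ) : Function.Surjective (torPi A B n) := by
  intro t
  rcases n with _ | m
  · exact ⟨0, funext fun p => absurd p.2 (by omega)⟩
  -- The family `r` must be indexed by all pairs with sum `m + 1`: it is the embedded torsion
  -- element at `(i, j + 1)` and zero at `(i, 0)`. The transport along `h` is needed because the
  -- type of the value depends on the pair.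
  have h0 : ∀ p : SumPairs (m + 1), ∃ r : A.homology p.1.1 ⊗[K] (imC B).X p.1.2,
      ∀ (q : PredSumPairs (m + 1)) (h : q.succRight = p),
        h ▸ (homologyResolution B q.1.2).torι _ (t q) = r := by
    rintro ⟨⟨i, j⟩, hij⟩
    rcases j with _ | j
    · exact ⟨0, fun q h => absurd (congrArg (fun p : SumPairs (m + 1) => p.1.2) h)
        (Nat.succ_ne_zero _)⟩
    · refine ⟨(homologyResolution B j).torι (A.homology i) (t ⟨(i, j), hij⟩), ?_⟩
      rintro ⟨⟨i', j'⟩, hq⟩ h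
      have h' : (i', j' + 1) = (i, j + 1) := congrArg Subtype.val h
      simp only [Prod.mk.injEq, add_left_inj] at h'
      obtain ⟨rfl, rfl⟩ := h'
      rfl
  choose r hr using h0
  have h1 : tensorδ A B m (zcrossSum A (imC B) (m + 1) r) = 0 := by
    rw [tensorδ_eq_zero_iff]
    intro p
    rw [← hr _ p rfl]
    exact ((homologyResolution B p.1.2).mem_range_torι _ _).1 ⟨_, rfl⟩
  obtain ⟨z, hz⟩ := (tensorImπ_tensorδ_exact A B m _).1 h1
  refine ⟨z, funext fun p => (homologyResolution B p.1.2).torι_injective _ ?_⟩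
  refine (torι_torComp A B (m + 1) p z).trans ?_
  change ((zcrossEquiv A (imC B) (m + 1)).symm (tensorImπ A B (m + 1) z)) p.succRight = _
  rw [hz]
  have h2 : (zcrossEquiv A (imC B) (m + 1)).symm (zcrossSum A (imC B) (m + 1) r) = r :=
    (zcrossEquiv A (imC B) (m + 1)).symm_apply_apply r
  rw [h2]
  exact (hr _ p rfl).symm

end AlgebraicKunneth

/-! ### The Künneth sequence and its naturality -/

section KunnethSequence

variable {K : Type u} [CommRing K]

section Biproduct

variable {J : Type} [Finite J]

/-- The components of an element of a biproduct of modules. -/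
def biproductPi (F : J → ModuleCat.{u} K) : (⨁ F : ModuleCat.{u} K) ≃ₗ[K] ((j : J) → F j) :=
  (ModuleCat.biproductIsoPi F).toLinearEquiv

theorem biproductPi_apply (F : J → ModuleCat.{u} K) (x : (⨁ F : ModuleCat.{u} K)) (j : J) :
    biproductPi F x j = (biproduct.π F j).hom x := by
  have h := ModuleCat.biproductIsoPi_inv_comp_π F j
  rw [Iso.inv_comp_eq] at h
  rw [h]; rfl

theorem biproductPi_map {F G : J → ModuleCat.{u} K} (φ : ∀ j, F j ⟶ G j)
    (x : (⨁ F : ModuleCat.{u} K)) (j : J) :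
    biproductPi G ((biproduct.map φ).hom x) j = (φ j).hom (biproductPi F x j) := by
  rw [biproductPi_apply, biproductPi_apply]
  exact congrArg (fun f => f.hom x) (biproduct.map_π φ j)

end Biproduct

variable (A B : ChainComplex (ModuleCat.{u} K) ℕ)

/-- The first map of the Künneth sequence. -/
def kunnethCross (n : ℕ) : kunnethTensor A B n ⟶
    (A ⊗ B : ChainComplex (ModuleCat.{u} K) ℕ).homology n :=
  ModuleCat.ofHom (crossSum A B n ∘ₗ
    (biproductPi fun p : SumPairs n => A.homology p.1.1 ⊗ B.homology p.1.2).toLinearMap)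

theorem kunnethCross_apply (n : ℕ) (x : kunnethTensor A B n) :
    (kunnethCross A B n).hom x = ∑ p : SumPairs n, cross A B p.1.1 p.1.2 n
      (biproductPi (fun p : SumPairs n => A.homology p.1.1 ⊗ B.homology p.1.2) x p) :=
  crossSum_apply A B n _

variable {A B} in
theorem kunnethCross_naturality {A' B' : ChainComplex (ModuleCat.{u} K) ℕ} (f : A ⟶ A')
    (g : B ⟶ B') (n : ℕ) : kunnethTensorMap f g n ≫ kunnethCross A' B' n =
      kunnethCross A B n ≫ HomologicalComplex.homologyMap
        (f ⊗ₘ g : (A ⊗ B : ChainComplex (ModuleCat.{u} K) ℕ) ⟶ A' ⊗ B') n := by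
  refine ModuleCat.hom_ext (LinearMap.ext fun x => ?_)
  refine (kunnethCross_apply A' B' n ((kunnethTensorMap f g n).hom x)).trans ?_
  refine Eq.trans ?_ (congrArg (HomologicalComplex.homologyMap
    (f ⊗ₘ g : (A ⊗ B : ChainComplex (ModuleCat.{u} K) ℕ) ⟶ A' ⊗ B') n).hom
      (kunnethCross_apply A B n x)).symm
  rw [map_sum]
  refine Finset.sum_congr rfl fun p _ => ?_
  refine Eq.trans ?_ (homologyMap_cross f g p.1.1 p.1.2 n _).symm
  exact congrArg _ (biproductPi_map (fun p : SumPairs n => HomologicalComplex.homologyMap f p.1.1 ⊗ₘ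
    HomologicalComplex.homologyMap g p.1.2) x p)

section

variable [IsDomain K] [IsPrincipalIdealRing K] [∀ j, Module.Free K (B.X j)]

/-- The second map of the Künneth sequence. -/
def kunnethTorMapOut (n : ℕ) : (A ⊗ B : ChainComplex (ModuleCat.{u} K) ℕ).homology n ⟶
    kunnethTor A B n :=
  ModuleCat.ofHom ((biproductPi fun p : PredSumPairs n =>
    ((Tor (ModuleCat.{u} K) 1).obj (A.homology p.1.1)).obj
      (B.homology p.1.2)).symm.toLinearMap ∘ₗ torPi A B n)

/-- **The algebraic Künneth theorem.** -/
theorem kunneth_isShortExact (n : ℕ) :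
    IsShortExact (kunnethCross A B n) (kunnethTorMapOut A B n) := by
  let F := fun p : SumPairs n => A.homology p.1.1 ⊗ B.homology p.1.2
  let G := fun p : PredSumPairs n =>
    ((Tor (ModuleCat.{u} K) 1).obj (A.homology p.1.1)).obj (B.homology p.1.2)
  have hex : Function.Exact (kunnethCross A B n).hom (kunnethTorMapOut A B n).hom := by
    intro z
    refine Iff.trans ?_ ((crossSum_torPi_exact A B n z).trans ?_)
    · exact (biproductPi G).symm.map_eq_zero_iff
    · constructor
      · rintro ⟨t, rfl⟩
        exact ⟨(biproductPi F).symm t, congrArg (crossSum A B n)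
          ((biproductPi F).apply_symm_apply t)⟩
      · rintro ⟨t, rfl⟩
        exact ⟨biproductPi F t, rfl⟩
  have w : kunnethCross A B n ≫ kunnethTorMapOut A B n = 0 :=
    ModuleCat.hom_ext (LinearMap.ext fun x => hex.apply_apply_eq_zero x)
  refine ⟨w, { exact := ?_, mono_f := ?_, epi_g := ?_ }⟩
  · exact (ShortComplex.ShortExact.moduleCat_exact_iff_function_exact _).2 hex
  · exact (ModuleCat.mono_iff_injective _).2
      ((crossSum_injective A B n).comp (biproductPi F).injective)
  · exact (ModuleCat.epi_iff_surjective _).2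
      ((biproductPi G).symm.surjective.comp (torPi_surjective A B n))

end

section Naturality

variable {A B} {A' B' : ChainComplex (ModuleCat.{u} K) ℕ}

theorem zcrossEquiv_symm_naturality (f : A ⟶ A') {X X' : ChainComplex (ModuleCat.{u} K) ℕ}
    [HasZeroDiff X] [HasZeroDiff X'] [∀ j, Module.Flat K (X.X j)] [∀ j, Module.Flat K (X'.X j)]
    (h : X ⟶ X') (n : ℕ) (z : (A ⊗ X : ChainComplex (ModuleCat.{u} K) ℕ).homology n)
    (p : SumPairs n) :
    (zcrossEquiv A' X' n).symm ((HomologicalComplex.homologyMap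
      (f ⊗ₘ h : (A ⊗ X : ChainComplex (ModuleCat.{u} K) ℕ) ⟶ A' ⊗ X') n).hom z) p =
      TensorProduct.map (HomologicalComplex.homologyMap f p.1.1).hom (h.f p.1.2).hom
        ((zcrossEquiv A X n).symm z p) := by
  obtain ⟨t, rfl⟩ := (zcrossEquiv A X n).surjective z
  rw [LinearEquiv.symm_apply_apply]
  have h1 : (HomologicalComplex.homologyMap
      (f ⊗ₘ h : (A ⊗ X : ChainComplex (ModuleCat.{u} K) ℕ) ⟶ A' ⊗ X') n).hom
        (zcrossEquiv A X n t) = zcrossEquiv A' X' n fun p =>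
        TensorProduct.map (HomologicalComplex.homologyMap f p.1.1).hom (h.f p.1.2).hom (t p) := by
    change (HomologicalComplex.homologyMap
      (f ⊗ₘ h : (A ⊗ X : ChainComplex (ModuleCat.{u} K) ℕ) ⟶ A' ⊗ X') n).hom
        (zcrossSum A X n t) = zcrossSum A' X' n _
    rw [zcrossSum_apply, zcrossSum_apply, map_sum]
    exact Finset.sum_congr rfl fun p _ => homologyMap_zcross f h _ _ _ _
  rw [h1, LinearEquiv.symm_apply_apply]

theorem tensorImπ_naturality (f : A ⟶ A') (g : B ⟶ B') (n : ℕ)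
    (z : (A ⊗ B : ChainComplex (ModuleCat.{u} K) ℕ).homology n) :
    tensorImπ A' B' n ((HomologicalComplex.homologyMap
      (f ⊗ₘ g : (A ⊗ B : ChainComplex (ModuleCat.{u} K) ℕ) ⟶ A' ⊗ B') n).hom z) =
      (HomologicalComplex.homologyMap (f ⊗ₘ imCMap g :
        (A ⊗ imC B : ChainComplex (ModuleCat.{u} K) ℕ) ⟶ A' ⊗ imC B') n).hom
          (tensorImπ A B n z) := by
  have h : (f ⊗ₘ g : (A ⊗ B : ChainComplex (ModuleCat.{u} K) ℕ) ⟶ A' ⊗ B') ≫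
      (𝟙 A' ⊗ₘ imπ B') = (𝟙 A ⊗ₘ imπ B) ≫ (f ⊗ₘ imCMap g) := by
    rw [MonoidalCategory.tensorHom_comp_tensorHom, MonoidalCategory.tensorHom_comp_tensorHom,
      Category.id_comp, Category.comp_id, imπ_naturality]
  have h2 := congrArg (fun k => HomologicalComplex.homologyMap k n) h
  simp only [HomologicalComplex.homologyMap_comp] at h2
  exact congrArg (fun k => k.hom z) h2

variable [IsDomain K] [IsPrincipalIdealRing K]
variable [∀ j, Module.Free K (B.X j)] [∀ j, Module.Free K (B'.X j)]

/-- After the injective map `torι` both sides become components of classes of `A' ⊗ imC B'`, where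
naturality of `zcrossEquiv` and `tensorImπ` applies. The maps of resolutions are those induced by
`g` on boundaries and cycles. -/
theorem torComp_naturality (f : A ⟶ A') (g : B ⟶ B') (n : ℕ) (p : PredSumPairs n)
    (z : (A ⊗ B : ChainComplex (ModuleCat.{u} K) ℕ).homology n) :
    torComp A' B' n p ((HomologicalComplex.homologyMap
      (f ⊗ₘ g : (A ⊗ B : ChainComplex (ModuleCat.{u} K) ℕ) ⟶ A' ⊗ B') n).hom z) =
      (((Tor (ModuleCat.{u} K) 1).map (HomologicalComplex.homologyMap f p.1.1)).app _ ≫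
        ((Tor (ModuleCat.{u} K) 1).obj _).map (HomologicalComplex.homologyMap g p.1.2)).hom
          (torComp A B n p z) := by
  apply (homologyResolution B' p.1.2).torι_injective
  rw [torι_torComp, (homologyResolution B p.1.2).torι_map (homologyResolution B' p.1.2)
    (A.homology p.1.1) (HomologicalComplex.homologyMap f p.1.1) (HomologicalComplex.homologyMap g p.1.2)
    ((imCMap g).f (p.1.2 + 1)) ((kerCMap g).f p.1.2)
    (ModuleCat.hom_ext (LinearMap.ext fun w => bdryι_naturality g p.1.2 w))
    (ModuleCat.hom_ext (LinearMap.ext fun w => kerCls_naturality g p.1.2 w)), torι_torComp]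
  refine Eq.trans (congrArg (fun t => (zcrossEquiv A' (imC B') n).symm t p.succRight)
    (tensorImπ_naturality f g n z)) ?_
  exact zcrossEquiv_symm_naturality f (imCMap g) n (tensorImπ A B n z) p.succRight

theorem kunnethTorMapOut_naturality (f : A ⟶ A') (g : B ⟶ B') (n : ℕ) :
    HomologicalComplex.homologyMap
        (f ⊗ₘ g : (A ⊗ B : ChainComplex (ModuleCat.{u} K) ℕ) ⟶ A' ⊗ B') n ≫
      kunnethTorMapOut A' B' n = kunnethTorMapOut A B n ≫ kunnethTorMap f g n := by
  let G := fun p : PredSumPairs n =>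
    ((Tor (ModuleCat.{u} K) 1).obj (A.homology p.1.1)).obj (B.homology p.1.2)
  let G' := fun p : PredSumPairs n =>
    ((Tor (ModuleCat.{u} K) 1).obj (A'.homology p.1.1)).obj (B'.homology p.1.2)
  refine ModuleCat.hom_ext (LinearMap.ext fun z => (biproductPi G').injective ?_)
  funext p
  refine (congrFun ((biproductPi G').apply_symm_apply _) p).trans ?_
  refine (torComp_naturality f g n p z).trans ?_
  refine Eq.trans ?_ (biproductPi_map (F := G) (G := G') (fun p : PredSumPairs n =>
    ((Tor (ModuleCat.{u} K) 1).map (HomologicalComplex.homologyMap f p.1.1)).app _ ≫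
      ((Tor (ModuleCat.{u} K) 1).obj _).map (HomologicalComplex.homologyMap g p.1.2))
    ((kunnethTorMapOut A B n).hom z) p).symm
  exact congrArg _ (congrFun ((biproductPi G).apply_symm_apply (torPi A B n z)) p).symm

end Naturality

end KunnethSequence

/-! ### Normalized chains -/

section NormalizedChains

variable (K : Type u) [CommRing K] (X : SSet.{u})

/-- The normalized chain complex. -/
abbrev normChains : ChainComplex (ModuleCat.{u} K) ℕ :=
  X.normalizedChainComplex (ModuleCat.of K K)

/-- The class of a simplex in the normalized chain complex. -/
abbrev cl {n : ℕ} (x : X _⦋n⦌) : (normChains K X).X n := PathPair.chainClass K X x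

theorem cl_eq_zero {n : ℕ} {x : X _⦋n⦌} (hx : x ∈ X.degenerate n) : cl K X x = 0 := by
  unfold cl PathPair.chainClass
  rw [SSet.ιNormalizedChainComplex_eq_zero X x hx]; rfl

theorem d_cl {n : ℕ} (x : X _⦋n + 1⦌) :
    ((normChains K X).d (n + 1) n).hom (cl K X x) =
      ∑ i : Fin (n + 2), (-1 : K) ^ (i : ℕ) • cl K X (X.δ i x) := by
  have h := congrArg (fun f => f.hom (1 : K))
    (SSet.ιNormalizedChainComplex_d X (R := ModuleCat.of K K) x)
  refine h.trans ?_
  simp only [ModuleCat.hom_sum, LinearMap.sum_apply]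
  refine Finset.sum_congr rfl fun i _ => ?_
  rw [ModuleCat.hom_zsmul, LinearMap.smul_apply]
  rcases Nat.even_or_odd (i : ℕ) with h | h
  · rw [h.neg_one_pow, h.neg_one_pow, one_smul, one_smul]; rfl
  · rw [h.neg_one_pow, h.neg_one_pow, neg_smul, neg_smul, one_smul, one_smul]; rfl

theorem normMap_cl {X Y : SSet.{u}} (f : X ⟶ Y) {n : ℕ} (x : X _⦋n⦌) :
    ((SSet.normalizedChainComplexMap f (ModuleCat.of K K)).f n).hom (cl K X x) =
      cl K Y (f.app _ x) :=
  congrArg (fun g => g.hom (1 : K)) (SSet.ι_normalizedChainComplexMap_f (R := ModuleCat.of K K) f x)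

/-- This version, with target in the universe of `ModuleCat`, is what the coproduct description of
normalized chains gives. It serves to construct the basis; `normChains_ext` then covers targets in
any universe. -/
theorem normChains_hom_ext {M : Type u} [AddCommGroup M] [Module K M] {n : ℕ}
    {f g : (normChains K X).X n →ₗ[K] M}
    (h : ∀ x ∈ X.nonDegenerate n, f (cl K X x) = g (cl K X x)) : f = g := by
  have h' : ModuleCat.ofHom f = ModuleCat.ofHom g := by
    refine Cofan.IsColimit.hom_ext (X.isColimitCofanNormalizedChainComplex (ModuleCat.of K K) n)
      _ _ fun x => ModuleCat.hom_ext (LinearMap.ext_ring ?_)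
    exact h x.1 x.2
  exact congrArg ModuleCat.Hom.hom h'

/-- The coordinates with respect to the nondegenerate simplices. -/
def chainRepr (n : ℕ) : (normChains K X).X n →ₗ[K] (X.nonDegenerate n →₀ K) :=
  (Cofan.IsColimit.desc (X.isColimitCofanNormalizedChainComplex (ModuleCat.of K K) n)
    (fun x => ModuleCat.ofHom (Finsupp.lsingle (R := K) (M := K) x) :
      X.nonDegenerate n → (ModuleCat.of K K ⟶ ModuleCat.of K (X.nonDegenerate n →₀ K)))).hom

theorem chainRepr_cl {n : ℕ} (x : X _⦋n⦌) (hx : x ∈ X.nonDegenerate n) :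
    chainRepr K X n (cl K X x) = Finsupp.single ⟨x, hx⟩ 1 :=
  congrArg (fun f => f.hom (1 : K)) (Cofan.IsColimit.fac
    (X.isColimitCofanNormalizedChainComplex (ModuleCat.of K K) n)
    (fun x => ModuleCat.ofHom (Finsupp.lsingle (R := K) (M := K) x) :
      X.nonDegenerate n → (ModuleCat.of K K ⟶ ModuleCat.of K (X.nonDegenerate n →₀ K))) ⟨x, hx⟩)

/-- The basis of the normalized chains given by the nondegenerate simplices. -/
def chainBasis (n : ℕ) : Module.Basis (X.nonDegenerate n) K ((normChains K X).X n) :=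
  .ofRepr (LinearEquiv.ofLinearMap (chainRepr K X n)
    (Finsupp.linearCombination K fun x : X.nonDegenerate n => cl K X x.1)
    (Finsupp.lhom_ext' fun x => LinearMap.ext_ring (by
      simp only [LinearMap.comp_apply, Finsupp.lsingle_apply, Finsupp.linearCombination_single,
        one_smul, LinearMap.id_apply]
      exact chainRepr_cl K X x.1 x.2))
    (normChains_hom_ext K X fun x hx => by
      rw [LinearMap.comp_apply, chainRepr_cl K X x hx, Finsupp.linearCombination_single, one_smul]
      rfl))

theorem chainBasis_apply {n : ℕ} (x : X.nonDegenerate n) : chainBasis K X n x = cl K X x.1 := by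
  change Finsupp.linearCombination K _ (Finsupp.single x 1) = _
  rw [Finsupp.linearCombination_single, one_smul]

instance (n : ℕ) : Module.Free K ((normChains K X).X n) := .of_basis (chainBasis K X n)

variable {K X}

theorem normChains_ext {M : Type*} [AddCommGroup M] [Module K M] {n : ℕ}
    {f g : (normChains K X).X n →ₗ[K] M}
    (h : ∀ x ∈ X.nonDegenerate n, f (cl K X x) = g (cl K X x)) : f = g :=
  (chainBasis K X n).ext fun x => by rw [chainBasis_apply]; exact h x.1 x.2

/-- The map on normalized chains with prescribed values on the nondegenerate simplices. -/
def normDesc {M : Type*} [AddCommGroup M] [Module K M] {n : ℕ} (φ : X _⦋n⦌ → M) :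
    (normChains K X).X n →ₗ[K] M :=
  (chainBasis K X n).constr K fun x => φ x.1

theorem normDesc_cl_of_nonDegenerate {M : Type*} [AddCommGroup M] [Module K M] {n : ℕ}
    (φ : X _⦋n⦌ → M) {x : X _⦋n⦌} (hx : x ∈ X.nonDegenerate n) :
    normDesc φ (cl K X x) = φ x := by
  rw [← chainBasis_apply K X ⟨x, hx⟩, normDesc, Module.Basis.constr_basis]

theorem normDesc_cl {M : Type*} [AddCommGroup M] [Module K M] {n : ℕ}
    (φ : X _⦋n⦌ → M) (hφ : ∀ x ∈ X.degenerate n, φ x = 0) (x : X _⦋n⦌) :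
    normDesc φ (cl K X x) = φ x := by
  by_cases hx : x ∈ X.nonDegenerate n
  · exact normDesc_cl_of_nonDegenerate φ hx
  · rw [← SSet.mem_degenerate_iff_notMem_nonDegenerate] at hx
    rw [hφ x hx, cl_eq_zero K X hx, map_zero]

open Classical in
variable (K) in
/-- The coefficient of a simplex in a normalized chain. -/
def coeff {n : ℕ} (w : X _⦋n⦌) : (normChains K X).X n →ₗ[K] K :=
  normDesc fun y => if y = w then 1 else 0

open Classical in
theorem coeff_cl {n : ℕ} {w : X _⦋n⦌} (hw : w ∈ X.nonDegenerate n) (x : X _⦋n⦌) :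
    coeff K w (cl K X x) = if x = w then 1 else 0 :=
  normDesc_cl _ (fun y hy => if_neg (by rintro rfl; exact hw hy)) x

theorem eq_zero_of_coeff {n : ℕ} {u : (normChains K X).X n}
    (h : ∀ w ∈ X.nonDegenerate n, coeff K w u = 0) : u = 0 := by
  classical
  refine (chainBasis K X n).ext_elem fun w => ?_
  rw [map_zero, Finsupp.zero_apply, ← h w.1 w.2]
  have key : Finsupp.lapply w ∘ₗ (chainBasis K X n).repr.toLinearMap = coeff K w.1 := by
    refine (chainBasis K X n).ext fun x => ?_
    simp only [LinearMap.comp_apply, LinearEquiv.coe_coe, Module.Basis.repr_self,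
      Finsupp.lapply_apply]
    rw [chainBasis_apply, coeff_cl w.2, Finsupp.single_apply]
    simp only [Subtype.ext_iff]
  exact LinearMap.congr_fun key u

variable (K X) in
/-- The linear map which extends a face operator on nondegenerate simplices. -/
def face {n : ℕ} (i : Fin (n + 2)) : (normChains K X).X (n + 1) →ₗ[K] (normChains K X).X n :=
  normDesc fun x => cl K X (X.δ i x)

/-- Nondegeneracy matters here: a single face operator does not descend to normalized chains, since
a degenerate simplex may have a nondegenerate face. -/
theorem face_cl {n : ℕ} (i : Fin (n + 2)) {x : X _⦋n + 1⦌} (hx : x ∈ X.nonDegenerate (n + 1)) :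
    face K X i (cl K X x) = cl K X (X.δ i x) :=
  normDesc_cl_of_nonDegenerate _ hx

/-- Both sides are linear, so it is enough that they agree on nondegenerate simplices, where the
choice made in `face` is the true face. -/
theorem d_eq_sum_face {n : ℕ} (u : (normChains K X).X (n + 1)) :
    ((normChains K X).d (n + 1) n).hom u =
      ∑ i : Fin (n + 2), (-1 : K) ^ (i : ℕ) • face K X i u := by
  have h : ((normChains K X).d (n + 1) n).hom =
      ∑ i : Fin (n + 2), (-1 : K) ^ (i : ℕ) • face K X i := by
    refine normChains_ext fun x hx => ?_
    rw [d_cl, LinearMap.sum_apply]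
    exact Finset.sum_congr rfl fun i _ => by rw [LinearMap.smul_apply, face_cl i hx]
  rw [h, LinearMap.sum_apply]; rfl

end NormalizedChains

/-! ### Chains in a path pair -/

namespace PathPair

variable {K : Type u} [CommRing K] (S : PathPair.{u})

theorem cl_mem {n : ℕ} {x : S.X _⦋n⦌} (hx : x ∈ S.Y n) : cl K S.X x ∈ S.chainSubmodule K n :=
  Submodule.subset_span ⟨x, hx, rfl⟩

theorem chainSubmodule_le {n : ℕ} {N : Submodule K ((normChains K S.X).X n)}
    (h : ∀ x ∈ S.Y n, x ∈ S.X.nonDegenerate n → cl K S.X x ∈ N) : S.chainSubmodule K n ≤ N := by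
  refine Submodule.span_le.2 ?_
  rintro _ ⟨y, hy, rfl⟩
  by_cases hd : y ∈ S.X.nonDegenerate n
  · exact h y hy hd
  · rw [← SSet.mem_degenerate_iff_notMem_nonDegenerate] at hd
    have : cl K S.X y = 0 := cl_eq_zero K S.X hd
    exact (congrArg (· ∈ N) this).mpr (zero_mem N)

/-- Linear maps which agree on the simplices of the path pair agree on its chains. -/
theorem eqOn_chainSubmodule {M : Type*} [AddCommGroup M] [Module K M] {n : ℕ}
    {f g : (normChains K S.X).X n →ₗ[K] M}
    (h : ∀ x ∈ S.Y n, x ∈ S.X.nonDegenerate n → f (cl K S.X x) = g (cl K S.X x))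
    {u : (normChains K S.X).X n} (hu : u ∈ S.chainSubmodule K n) : f u = g u :=
  S.chainSubmodule_le (N := LinearMap.eqLocus f g) h hu

open Classical in
variable (K) in
/-- The projection onto the chains which are supported outside of the path pair. -/
def proj (n : ℕ) : (normChains K S.X).X n →ₗ[K] (normChains K S.X).X n :=
  normDesc fun x => if x ∈ S.Y n then 0 else cl K S.X x

open Classical in
theorem proj_cl {n : ℕ} (x : S.X _⦋n⦌) :
    S.proj K n (cl K S.X x) = if x ∈ S.Y n then 0 else cl K S.X x :=
  normDesc_cl _ (fun y hy => by rw [cl_eq_zero K S.X hy, ite_self]) x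

/-- This presents the chains of paths as the kernel of a linear map with free target, the form in
which they can be intersected and tensored by flatness. -/
theorem proj_eq_zero_iff {n : ℕ} (u : (normChains K S.X).X n) :
    S.proj K n u = 0 ↔ u ∈ S.chainSubmodule K n := by
  classical
  constructor
  · intro h
    have h1 : ∀ u, u - S.proj K n u ∈ S.chainSubmodule K n := by
      have h2 : (S.chainSubmodule K n).mkQ ∘ₗ (LinearMap.id - S.proj K n) = 0 := by
        refine normChains_ext fun x _ => ?_
        rw [LinearMap.comp_apply, LinearMap.sub_apply, proj_cl, LinearMap.zero_apply,
          Submodule.mkQ_apply, Submodule.Quotient.mk_eq_zero]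
        split_ifs with hx
        · rw [sub_zero]; exact S.cl_mem hx
        · rw [LinearMap.id_apply, sub_self]; exact zero_mem _
      exact fun u => (Submodule.Quotient.mk_eq_zero _).1 (LinearMap.congr_fun h2 u)
    have := h1 u
    rwa [h, sub_zero] at this
  · intro h
    exact S.eqOn_chainSubmodule (g := 0) (fun x hx _ => by rw [proj_cl, if_pos hx]; rfl) h

theorem mem_of_coeff {n : ℕ} {u : (normChains K S.X).X n}
    (h : ∀ w ∈ S.X.nonDegenerate n, w ∉ S.Y n → coeff K w u = 0) : u ∈ S.chainSubmodule K n := by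
  classical
  rw [← proj_eq_zero_iff]
  refine eq_zero_of_coeff fun w hw => ?_
  by_cases hY : w ∈ S.Y n
  · have key : coeff K w ∘ₗ S.proj K n = 0 := by
      refine normChains_ext fun x _ => ?_
      rw [LinearMap.comp_apply, proj_cl, LinearMap.zero_apply]
      split_ifs with hx
      · exact map_zero _
      · rw [coeff_cl hw, if_neg (by rintro rfl; exact hx hY)]
    exact LinearMap.congr_fun key u
  · have key : coeff K w ∘ₗ S.proj K n = coeff K w := by
      refine normChains_ext fun x _ => ?_
      rw [LinearMap.comp_apply, proj_cl]
      split_ifs with hx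
      · rw [map_zero, coeff_cl hw, if_neg (by rintro rfl; exact hY hx)]
      · rfl
    exact (LinearMap.congr_fun key u).trans (h w hw hY)

theorem coeff_eq_zero {n : ℕ} {u : (normChains K S.X).X n} (hu : u ∈ S.chainSubmodule K n)
    {w : S.X _⦋n⦌} (hw : w ∈ S.X.nonDegenerate n) (hY : w ∉ S.Y n) : coeff K w u = 0 := by
  classical
  exact S.eqOn_chainSubmodule (g := 0)
    (fun x hx _ => by rw [coeff_cl hw, if_neg (by rintro rfl; exact hY hx)]; rfl) hu

end PathPair

/-! ### Segments of simplices -/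

section Segments

variable {X : SSet.{u}}

/-- The action of a monotone map on the simplices of a simplicial set. -/
def act {m n : ℕ} (f : Fin (m + 1) →o Fin (n + 1)) (x : X _⦋n⦌) : X _⦋m⦌ :=
  X.map (SimplexCategory.mkHom f).op x

theorem act_act {l m n : ℕ} (g : Fin (l + 1) →o Fin (m + 1)) (f : Fin (m + 1) →o Fin (n + 1))
    (x : X _⦋n⦌) : act g (act f x) = act (f.comp g) x :=
  (ConcreteCategory.congr_hom (X.map_comp (SimplexCategory.mkHom f).op
    (SimplexCategory.mkHom g).op) x).symm

theorem act_id {n : ℕ} (x : X _⦋n⦌) : act OrderHom.id x = x :=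
  ConcreteCategory.congr_hom (X.map_id _) x

theorem act_congr {m n : ℕ} {f g : Fin (m + 1) →o Fin (n + 1)} (h : ∀ k, f k = g k) (x : X _⦋n⦌) :
    act f x = act g x := by
  rw [OrderHom.ext _ _ (funext h)]

theorem app_act {Y : SSet.{u}} (φ : X ⟶ Y) {m n : ℕ} (f : Fin (m + 1) →o Fin (n + 1))
    (x : X _⦋n⦌) : φ.app _ (act f x) = act f (φ.app _ x) :=
  ConcreteCategory.congr_hom (φ.naturality (SimplexCategory.mkHom f).op) x

/-- The monotone injection which omits `i`. -/
def dHom {n : ℕ} (i : Fin (n + 2)) : Fin (n + 1) →o Fin (n + 2) := i.succAboveOrderEmb.toOrderHom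

/-- The monotone surjection which repeats `i`. -/
def sHom {n : ℕ} (i : Fin (n + 1)) : Fin (n + 2) →o Fin (n + 1) := i.predAboveOrderHom

theorem δ_eq_act {n : ℕ} (i : Fin (n + 2)) (x : X _⦋n + 1⦌) : X.δ i x = act (dHom i) x := rfl

theorem dHom_val {n : ℕ} (i : Fin (n + 2)) (k : Fin (n + 1)) :
    (dHom i k : ℕ) = if (k : ℕ) < i then (k : ℕ) else k + 1 := by
  change (i.succAbove k : ℕ) = _
  rw [Fin.succAbove]
  split_ifs <;> simp_all [Fin.lt_def]

theorem sHom_val {n : ℕ} (i : Fin (n + 1)) (k : Fin (n + 2)) :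
    (sHom i k : ℕ) = if (k : ℕ) ≤ i then (k : ℕ) else k - 1 := by
  change (i.predAbove k : ℕ) = _
  rw [Fin.predAbove]
  split_ifs with h1 h2 h2 <;> simp only [Fin.lt_def, Fin.val_castSucc, not_lt] at h1 <;> simp <;>
    omega

/-- The monotone map `Fin 2 → Fin (n + 1)` with values `a ≤ b`. -/
def pairHom {n : ℕ} (a b : Fin (n + 1)) (h : a ≤ b) : Fin 2 →o Fin (n + 1) where
  toFun k := if k = 0 then a else b
  monotone' := by
    intro k l hkl
    fin_cases k <;> fin_cases l <;> simp_all

/-- The edge between two vertices of a simplex. -/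
def seg {n : ℕ} (x : X _⦋n⦌) (a b : Fin (n + 1)) (h : a ≤ b) : X _⦋1⦌ := act (pairHom a b h) x

/-- A vertex of a simplex. -/
def vtx {n : ℕ} (x : X _⦋n⦌) (a : Fin (n + 1)) : X _⦋0⦌ := act (OrderHom.const _ a) x

/-- The edge between consecutive vertices of a simplex. -/
def edge {n : ℕ} (x : X _⦋n⦌) (i : Fin n) : X _⦋1⦌ := seg x i.castSucc i.succ i.castSucc_le_succ

/-- The degenerate edge at a vertex. -/
def degEdge (v : X _⦋0⦌) : X _⦋1⦌ := act (OrderHom.const _ 0) v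

theorem degEdge_eq_σ (v : X _⦋0⦌) : degEdge v = X.σ 0 v :=
  act_congr (fun _ => Subsingleton.elim (α := Fin 1) _ _) v

theorem mem_degenerate_one_iff (e : X _⦋1⦌) : e ∈ X.degenerate 1 ↔ ∃ v, e = degEdge v := by
  rw [SSet.degenerate_eq_iUnion_range_σ, Set.mem_iUnion]
  constructor
  · rintro ⟨i, v, rfl⟩
    exact ⟨v, by rw [degEdge_eq_σ, show i = 0 from Subsingleton.elim (α := Fin 1) i 0]⟩
  · rintro ⟨v, rfl⟩
    exact ⟨0, v, (degEdge_eq_σ v).symm⟩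

theorem degEdge_mem (v : X _⦋0⦌) : degEdge v ∈ X.degenerate 1 :=
  (mem_degenerate_one_iff _).2 ⟨v, rfl⟩

theorem act_mem_degenerate {m n : ℕ} (h : m < n) (f : Fin (n + 1) →o Fin (m + 1)) (x : X _⦋m⦌) :
    act f x ∈ X.degenerate n := ⟨m, h, SimplexCategory.mkHom f, x, rfl⟩

theorem exists_sHom_of_mem_degenerate {n : ℕ} {x : X _⦋n + 1⦌} (hx : x ∈ X.degenerate (n + 1)) :
    ∃ (i : Fin (n + 1)) (y : X _⦋n⦌), x = act (sHom i) y := by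
  rw [SSet.degenerate_eq_iUnion_range_σ, Set.mem_iUnion] at hx
  obtain ⟨i, y, rfl⟩ := hx
  exact ⟨i, y, rfl⟩

section

variable {m n : ℕ} (x : X _⦋n⦌)

theorem seg_act (f : Fin (m + 1) →o Fin (n + 1)) (a b : Fin (m + 1)) (h : a ≤ b) :
    seg (act f x) a b h = seg x (f a) (f b) (f.monotone h) := by
  unfold seg
  rw [act_act]
  refine act_congr (fun k => ?_) x
  fin_cases k <;> rfl

theorem vtx_act (f : Fin (m + 1) →o Fin (n + 1)) (a : Fin (m + 1)) :
    vtx (act f x) a = vtx x (f a) := act_act _ _ _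

theorem vtx_seg_zero (a b : Fin (n + 1)) (h : a ≤ b) : vtx (seg x a b h) 0 = vtx x a :=
  act_act _ _ _

theorem vtx_seg_one (a b : Fin (n + 1)) (h : a ≤ b) : vtx (seg x a b h) 1 = vtx x b :=
  act_act _ _ _

theorem seg_self (a : Fin (n + 1)) (h : a ≤ a) : seg x a a h = degEdge (vtx x a) := by
  refine Eq.trans (act_congr (fun k => ?_) x) (act_act _ _ _).symm
  exact ite_self a

theorem vtx_degEdge (v : X _⦋0⦌) (a : Fin 2) : vtx (degEdge v) a = v := by
  refine (act_act _ _ _).trans (Eq.trans (act_congr (fun k => ?_) v) (act_id v))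
  exact Subsingleton.elim (α := Fin 1) _ _

theorem seg_eq_of_mem_degenerate {a b : Fin (n + 1)} {h : a ≤ b}
    (hd : seg x a b h ∈ X.degenerate 1) : seg x a b h = degEdge (vtx x a) ∧ vtx x a = vtx x b := by
  obtain ⟨v, hv⟩ := (mem_degenerate_one_iff _).1 hd
  have h0 := vtx_seg_zero x a b h
  have h1 := vtx_seg_one x a b h
  rw [hv, vtx_degEdge] at h0 h1
  exact ⟨by rw [hv, h0], by rw [← h0, h1]⟩

theorem seg_self_mem (a : Fin (n + 1)) (h : a ≤ a) : seg x a a h ∈ X.degenerate 1 := by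
  rw [seg_self]; exact degEdge_mem _

theorem edge_act (f : Fin (m + 1) →o Fin (n + 1)) (i : Fin m) :
    edge (act f x) i = seg x (f i.castSucc) (f i.succ) (f.monotone i.castSucc_le_succ) :=
  seg_act x f _ _ _

theorem seg_congr {a a' b b' : Fin (n + 1)} (ha : a = a') (hb : b = b') (h : a ≤ b) :
    seg x a b h = seg x a' b' (ha ▸ hb ▸ h) := by
  subst ha hb; rfl

theorem seg_eq_edge {a b : Fin (n + 1)} (h : a ≤ b) (i : Fin n) (ha : (a : ℕ) = i)
    (hb : (b : ℕ) = i + 1) : seg x a b h = edge x i :=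
  seg_congr x (Fin.ext ha) (Fin.ext hb) h

theorem seg_mem_of_edge {a b : Fin (n + 1)} (h : a ≤ b) (i : Fin n) (ha : (a : ℕ) = i)
    (hb : (b : ℕ) = i + 1) (hd : edge x i ∈ X.degenerate 1) : seg x a b h ∈ X.degenerate 1 := by
  rw [seg_eq_edge x h i ha hb]; exact hd

theorem seg_mem_of_eq {a b : Fin (n + 1)} (h : a ≤ b) (hab : a = b) :
    seg x a b h ∈ X.degenerate 1 := by
  subst hab; exact seg_self_mem x a h

end

/-- A degeneracy that repeats the vertex `i` makes the edge `i` constant. -/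
theorem exists_edge_of_mem_degenerate {n : ℕ} {x : X _⦋n⦌} (hx : x ∈ X.degenerate n) :
    ∃ i, edge x i ∈ X.degenerate 1 := by
  rcases n with _ | n
  · rw [SSet.degenerate_zero] at hx; exact hx.elim
  · obtain ⟨i, y, rfl⟩ := exists_sHom_of_mem_degenerate hx
    refine ⟨i, ?_⟩
    rw [edge_act]
    refine seg_mem_of_eq y _ (Fin.ext ?_)
    rw [sHom_val, sHom_val]; simp

end Segments

/-- A simplicial set in which simplices are determined by their vertices and their consecutive
edges. -/
class SpineDetermined (X : SSet.{u}) : Prop where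
  ext' : ∀ (n : ℕ) (x y : X _⦋n⦌), (∀ a, vtx x a = vtx y a) → (∀ i, edge x i = edge y i) → x = y

section SpineDetermined

variable {X : SSet.{u}} [SpineDetermined X]

theorem spine_ext {n : ℕ} {x y : X _⦋n⦌} (h : ∀ a, vtx x a = vtx y a)
    (h' : ∀ i, edge x i = edge y i) : x = y := SpineDetermined.ext' n x y h h'

/-- The monotone map `Fin 3 → Fin (n + 1)` with values `a ≤ b ≤ c`. -/
def tripleHom {n : ℕ} (a b c : Fin (n + 1)) (h : a ≤ b) (h' : b ≤ c) : Fin 3 →o Fin (n + 1) where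
  toFun k := if k = 0 then a else if k = 1 then b else c
  monotone' := by
    have := h.trans h'
    intro k l hkl
    fin_cases k <;> fin_cases l <;> simp_all

variable {m n : ℕ} (x : X _⦋n⦌)

/-- The triangles on `a ≤ b ≤ c` and on `b ≤ b ≤ c` have the same spine when the first edge is
degenerate, so they coincide and so do their long edges. In a nerve this is the unit law for
composition. -/
theorem seg_eq_of_left {a b c : Fin (n + 1)} (h : a ≤ b) (h' : b ≤ c)
    (hd : seg x a b h ∈ X.degenerate 1) : seg x a c (h.trans h') = seg x b c h' := by
  obtain ⟨h1, h2⟩ := seg_eq_of_mem_degenerate x hd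
  have key : act (tripleHom a b c h h') x = act (tripleHom b b c le_rfl h') x := by
    refine spine_ext (fun k => ?_) (fun k => ?_)
    · rw [vtx_act, vtx_act]
      fin_cases k
      · exact h2
      · rfl
      · rfl
    · rw [edge_act, edge_act]
      fin_cases k
      · change seg x a b h = seg x b b le_rfl
        rw [h1, seg_self, h2]
      · rfl
  have := congrArg (fun t => seg t 0 2 (by decide)) key
  simp only [seg_act] at this
  exact this

theorem seg_eq_of_right {a b c : Fin (n + 1)} (h : a ≤ b) (h' : b ≤ c)
    (hd : seg x b c h' ∈ X.degenerate 1) : seg x a c (h.trans h') = seg x a b h := by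
  obtain ⟨h1, h2⟩ := seg_eq_of_mem_degenerate x hd
  have key : act (tripleHom a b c h h') x = act (tripleHom a b b h le_rfl) x := by
    refine spine_ext (fun k => ?_) (fun k => ?_)
    · rw [vtx_act, vtx_act]
      fin_cases k
      · rfl
      · rfl
      · exact h2.symm
    · rw [edge_act, edge_act]
      fin_cases k
      · rfl
      · change seg x b c h' = seg x b b le_rfl
        rw [h1, seg_self]
  have := congrArg (fun t => seg t 0 2 (by decide)) key
  simp only [seg_act] at this
  exact this

theorem seg_mem_degenerate_trans {a b c : Fin (n + 1)} (h : a ≤ b) (h' : b ≤ c)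
    (hd : seg x a b h ∈ X.degenerate 1) (hd' : seg x b c h' ∈ X.degenerate 1) :
    seg x a c (h.trans h') ∈ X.degenerate 1 := by
  rw [seg_eq_of_left x h h' hd]; exact hd'

theorem seg_mem_degenerate_of_edges {a b : Fin (n + 1)} (h : a ≤ b)
    (hd : ∀ i : Fin n, (a : ℕ) ≤ i → (i : ℕ) < b → edge x i ∈ X.degenerate 1) :
    seg x a b h ∈ X.degenerate 1 := by
  obtain ⟨b, hb⟩ := b
  induction b with
  | zero =>
    obtain rfl : a = ⟨0, hb⟩ := Fin.ext (Nat.le_zero.1 h)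
    exact seg_self_mem x _ _
  | succ b ih =>
    rcases Nat.lt_or_ge b a with h1 | h1
    · obtain rfl : a = ⟨b + 1, hb⟩ := Fin.ext (le_antisymm h h1)
      exact seg_self_mem x _ _
    · refine seg_mem_degenerate_trans x (b := ⟨b, by omega⟩) h1 (Nat.le_succ b)
        (ih _ h1 fun i h2 h3 => hd i h2 (Nat.lt_succ_of_lt h3)) ?_
      rw [seg_eq_edge x _ ⟨b, by omega⟩ rfl rfl]
      exact hd _ h1 (Nat.lt_succ_self b)

/-- Two monotone maps act equally on a simplex if the edges between their values are
degenerate. -/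
theorem act_eq_of_seg_degenerate (f g : Fin (m + 1) →o Fin (n + 1))
    (h : ∀ k, ∃ hk : f k ≤ g k, seg x (f k) (g k) hk ∈ X.degenerate 1) : act f x = act g x := by
  choose hk hd using h
  refine spine_ext (fun k => ?_) (fun k => ?_)
  · rw [vtx_act, vtx_act]
    exact (seg_eq_of_mem_degenerate x (hd k)).2
  · rw [edge_act, edge_act]
    exact (seg_eq_of_right x (f.monotone k.castSucc_le_succ) (hk k.succ) (hd _)).symm.trans
      (seg_eq_of_left x (hk k.castSucc) (g.monotone k.castSucc_le_succ) (hd _))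

/-- A simplex whose `i`-th edge is degenerate, as the degeneracy of a face. -/
theorem eq_sHom_dHom_succ (x : X _⦋n + 1⦌) (i : Fin (n + 1)) (hd : edge x i ∈ X.degenerate 1) :
    x = act (sHom i) (act (dHom i.succ) x) := by
  rw [act_act]
  refine (act_id x).symm.trans (act_eq_of_seg_degenerate x _ _ fun k => ?_).symm
  by_cases hk : (k : ℕ) = i + 1
  · have h1 : (dHom i.succ (sHom i k) : ℕ) = i := by
      rw [dHom_val, sHom_val]; simp; split_ifs <;> omega
    refine ⟨by rw [Fin.le_def]; change (dHom i.succ (sHom i k) : ℕ) ≤ k; omega, ?_⟩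
    exact seg_mem_of_edge x _ i h1 hk hd
  · have h1 : dHom i.succ (sHom i k) = k := by
      apply Fin.ext
      rw [dHom_val, sHom_val]; simp; split_ifs <;> omega
    refine ⟨h1.le, ?_⟩
    exact seg_mem_of_eq x _ h1

/-- The counterpart of `eq_sHom_dHom_succ` with the other end of the degenerate edge omitted. One
form is used for moving a vertex up and the other for moving it down. -/
theorem eq_sHom_dHom_castSucc (x : X _⦋n + 1⦌) (i : Fin (n + 1))
    (hd : edge x i ∈ X.degenerate 1) : x = act (sHom i) (act (dHom i.castSucc) x) := by
  rw [act_act]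
  refine (act_id x).symm.trans (act_eq_of_seg_degenerate x _ _ fun k => ?_)
  by_cases hk : (k : ℕ) = i
  · have h1 : (dHom i.castSucc (sHom i k) : ℕ) = i + 1 := by
      rw [dHom_val, sHom_val]; simp; split_ifs <;> omega
    refine ⟨by rw [Fin.le_def]; change (k : ℕ) ≤ (dHom i.castSucc (sHom i k) : ℕ); omega, ?_⟩
    exact seg_mem_of_edge x _ i hk h1 hd
  · have h1 : dHom i.castSucc (sHom i k) = k := by
      apply Fin.ext
      rw [dHom_val, sHom_val]; simp; split_ifs <;> omega
    refine ⟨h1.ge, ?_⟩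
    exact seg_mem_of_eq x _ h1.symm

theorem mem_degenerate_of_edge (i : Fin n) (hd : edge x i ∈ X.degenerate 1) :
    x ∈ X.degenerate n := by
  rcases n with _ | n
  · exact i.elim0
  · rw [eq_sHom_dHom_succ x i hd]
    exact act_mem_degenerate (Nat.lt_succ_self n) _ _

/-- Nondegeneracy, like being a path, thereby becomes a condition on single edges, which is how
lattice paths in a box product are handled below. -/
theorem mem_nonDegenerate_iff_edges {n : ℕ} {x : X _⦋n⦌} :
    x ∈ X.nonDegenerate n ↔ ∀ i, edge x i ∉ X.degenerate 1 :=
  ⟨fun h i hi => h (mem_degenerate_of_edge x i hi), fun h hx =>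
    let ⟨i, hi⟩ := exists_edge_of_mem_degenerate hx; h i hi⟩

end SpineDetermined

/-! ### Faces of chains in `Ω` -/

/-- A path pair given by the vertices and arrows of a quiver: the simplices are determined by their
vertices and consecutive edges, and the paths are the simplices whose vertices and consecutive
edges are paths. -/
class QuiverLike (S : PathPair.{u}) : Prop where
  spineDetermined : SpineDetermined S.X
  mem_iff : ∀ {n : ℕ} (x : S.X _⦋n⦌),
    x ∈ S.Y n ↔ (∀ a, vtx x a ∈ S.Y 0) ∧ ∀ i, edge x i ∈ S.Y 1

attribute [instance] QuiverLike.spineDetermined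

namespace PathPair

variable (S : PathPair.{u})

theorem degEdge_mem_Y {v : S.X _⦋0⦌} (hv : v ∈ S.Y 0) : degEdge v ∈ S.Y 1 := by
  rw [degEdge_eq_σ]; exact S.σ_mem 0 0 v hv

variable {K : Type u} [CommRing K]

theorem coeff_face_eq_zero {n : ℕ} {w : S.X _⦋n⦌} (hw : w ∈ S.X.nonDegenerate n)
    (j : Fin (n + 2)) (hj : ∀ y ∈ S.Y (n + 1), act (dHom j) y ≠ w)
    {u : (normChains K S.X).X (n + 1)} (hu : u ∈ S.chainSubmodule K (n + 1)) :
    coeff K w (face K S.X j u) = 0 := by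
  classical
  refine S.eqOn_chainSubmodule (f := coeff K w ∘ₗ face K S.X j) (g := 0) (fun y hy hd => ?_) hu
  rw [LinearMap.comp_apply, face_cl j hd, coeff_cl hw, δ_eq_act, if_neg (hj y hy)]
  rfl

variable [QuiverLike S]

variable {S} in
theorem vtx_mem {n : ℕ} {x : S.X _⦋n⦌} (hx : x ∈ S.Y n) (a : Fin (n + 1)) : vtx x a ∈ S.Y 0 :=
  ((QuiverLike.mem_iff x).1 hx).1 a

variable {S} in
theorem edge_mem {n : ℕ} {x : S.X _⦋n⦌} (hx : x ∈ S.Y n) (i : Fin n) : edge x i ∈ S.Y 1 :=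
  ((QuiverLike.mem_iff x).1 hx).2 i

/-- Omitting the vertex `j` merges the edges `j - 1` and `j` into edge `j - 1` of the face; every
other edge of the face is an edge of `x`. -/
theorem edge_act_dHom_mem {n : ℕ} {x : S.X _⦋n + 1⦌} (hx : x ∈ S.Y (n + 1)) (j : Fin (n + 2))
    (k : Fin n) (hjk : (j : ℕ) ≠ k + 1) : edge (act (dHom j) x) k ∈ S.Y 1 := by
  rw [edge_act]
  rcases Nat.lt_or_ge k j with h | h
  · rw [seg_eq_edge x _ k.castSucc (by rw [dHom_val]; simp [h])
      (by rw [dHom_val]; simp; omega)]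
    exact edge_mem hx _
  · rw [seg_eq_edge x _ k.succ (by rw [dHom_val]; simp; omega)
      (by rw [dHom_val]; simp; omega)]
    exact edge_mem hx _

/-- All faces of a chain in `Ω` are chains in the path pair. -/
theorem face_mem {n : ℕ} {u : (normChains K S.X).X (n + 1)}
    (hu : u ∈ omegaSubmodule (normChains K S.X) (S.chainSubmodule K) (n + 1)) (i : Fin (n + 2)) :
    face K S.X i u ∈ S.chainSubmodule K n := by
  rw [mem_omegaSubmodule] at hu
  refine S.mem_of_coeff fun w hw hY => ?_
  rw [QuiverLike.mem_iff, not_and_or, not_forall, not_forall] at hY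
  -- A vertex outside of the quiver cannot occur in any face of a path. An edge `k` outside of the
  -- quiver can arise only by omission of the vertex `k + 1`.
  rcases hY with ⟨a, ha⟩ | ⟨k, hk⟩
  · refine S.coeff_face_eq_zero hw i (fun y hy h => ha ?_) hu.1
    rw [← h, vtx_act]
    exact vtx_mem hy _
  · have h0 : ∀ j : Fin (n + 2), j ≠ k.succ.castSucc → coeff K w (face K S.X j u) = 0 := by
      intro j hj
      refine S.coeff_face_eq_zero hw j (fun y hy h => hk ?_) hu.1
      rw [← h]
      exact S.edge_act_dHom_mem hy j k fun h => hj (Fin.ext (by simpa using h))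
    by_cases hi : i = k.succ.castSucc
    · have h1 : coeff K w (((normChains K S.X).d (n + 1) n).hom u) = 0 :=
        S.coeff_eq_zero (hu.2 n) hw fun hw' => hk (edge_mem hw' k)
      rw [d_eq_sum_face, map_sum, Finset.sum_eq_single k.succ.castSucc
        (fun j _ hj => by rw [map_smul, h0 j hj, smul_zero])
        (fun h => absurd (Finset.mem_univ _) h), map_smul] at h1
      rw [hi]
      exact ((isUnit_one.neg.pow _).smul_eq_zero).1 h1
    · exact h0 i hi

end PathPair

/-! ### The Alexander–Whitney map -/

/-- The inclusion of an initial interval. -/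
def frontHom {i n : ℕ} (h : i ≤ n) : Fin (i + 1) →o Fin (n + 1) where
  toFun k := ⟨k, by omega⟩
  monotone' _ _ h := h

/-- The inclusion of a final interval. -/
def backHom {i j n : ℕ} (h : i + j = n) : Fin (j + 1) →o Fin (n + 1) where
  toFun k := ⟨i + k, by omega⟩
  monotone' _ _ h := Nat.add_le_add_left h _

theorem frontHom_val {i n : ℕ} (h : i ≤ n) (k : Fin (i + 1)) : (frontHom h k : ℕ) = k := rfl

theorem backHom_val {i j n : ℕ} (h : i + j = n) (k : Fin (j + 1)) :
    (backHom h k : ℕ) = i + k := rfl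

section SSet

variable {X Y : SSet.{u}}

theorem app_edge (φ : X ⟶ Y) {n : ℕ} (x : X _⦋n⦌) (i : Fin n) :
    φ.app _ (edge x i) = edge (φ.app _ x) i := app_act φ _ x

theorem app_mem_degenerate_one (φ : X ⟶ Y) {e : X _⦋1⦌} (he : e ∈ X.degenerate 1) :
    φ.app _ e ∈ Y.degenerate 1 := by
  obtain ⟨v, rfl⟩ := (mem_degenerate_one_iff e).1 he
  rw [degEdge, app_act]
  exact degEdge_mem _

theorem edge_act_frontHom {i n : ℕ} (h : i ≤ n) (x : X _⦋n⦌) (k : Fin i) :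
    edge (act (frontHom h) x) k = edge x ⟨k, by omega⟩ := by
  rw [edge_act]; rfl

theorem edge_act_backHom {i j n : ℕ} (h : i + j = n) (x : X _⦋n⦌) (k : Fin j) :
    edge (act (backHom h) x) k = edge x ⟨i + k, by omega⟩ := by
  rw [edge_act]; rfl

end SSet

section AlexanderWhitney

variable {K : Type u} [CommRing K]

theorem tensor_ext_comp {A B : ChainComplex (ModuleCat.{u} K) ℕ} {n : ℕ}
    {u w : (A ⊗ B : ChainComplex (ModuleCat.{u} K) ℕ).X n}
    (h : ∀ i j, i + j = n → comp A B i j n u = comp A B i j n w) : u = w := by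
  rw [← sum_sumPairs_tz_comp A B n u, ← sum_sumPairs_tz_comp A B n w]
  exact Finset.sum_congr rfl fun p _ => by rw [h _ _ p.2]

/-- The last term of the first sum has sign `(-1) ^ (i + 1)` and the first term of the second has
sign `(-1) ^ i`, so these equal entries cancel. The remaining `(i + 1) + (j + 1)` terms line up with
the `n + 2` terms on the right. -/
theorem alternating_sum_split {M : Type*} [AddCommGroup M] [Module K M] {i j n : ℕ}
    (h : i + j = n) (L : Fin (i + 2) → M) (R : Fin (j + 2) → M) (F : Fin (n + 2) → M)
    (hL : ∀ k : Fin (i + 1), L k.castSucc = F ⟨k, by omega⟩)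
    (hR : ∀ l : Fin (j + 1), R l.succ = F ⟨i + 1 + l, by omega⟩)
    (hLR : L (Fin.last (i + 1)) = R 0) :
    ∑ k : Fin (i + 2), (-1 : K) ^ (k : ℕ) • L k +
      (-1 : K) ^ i • ∑ l : Fin (j + 2), (-1 : K) ^ (l : ℕ) • R l =
        ∑ k : Fin (n + 2), (-1 : K) ^ (k : ℕ) • F k := by
  have e : (i + 1) + (j + 1) = n + 2 := by omega
  have hF : ∑ k : Fin (n + 2), (-1 : K) ^ (k : ℕ) • F k = _ :=
    ((finCongr e).sum_comp _).symm.trans (Fin.sum_univ_add _)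
  rw [hF, Fin.sum_univ_castSucc, Fin.sum_univ_succ (n := j + 1), hLR, smul_add, Finset.smul_sum]
  have h1 : ∀ k : Fin (i + 1), (-1 : K) ^ (k.castSucc : ℕ) • L k.castSucc =
      (-1 : K) ^ (finCongr e (Fin.castAdd (j + 1) k) : ℕ) • F (finCongr e (Fin.castAdd (j + 1) k)) :=
    fun k => by rw [hL]; rfl
  have h2 : ∀ l : Fin (j + 1), (-1 : K) ^ i • (-1 : K) ^ (l.succ : ℕ) • R l.succ =
      (-1 : K) ^ (finCongr e (Fin.natAdd (i + 1) l) : ℕ) • F (finCongr e (Fin.natAdd (i + 1) l)) :=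
    fun l => by
      rw [hR, smul_smul, ← pow_add]
      refine congrArg₂ (fun a b => (-1 : K) ^ a • F b) ?_ rfl
      simp; omega
  rw [Finset.sum_congr rfl fun k _ => h1 k, Finset.sum_congr rfl fun l _ => h2 l]
  simp only [Fin.val_last, Fin.val_zero, pow_zero, one_smul, pow_succ, mul_neg, mul_one, neg_smul]
  abel

variable (K) {X Y Z : SSet.{u}} (φ : Z ⟶ X) (ψ : Z ⟶ Y)

/-- The Alexander–Whitney map on a simplex. -/
def awSimplex {n : ℕ} (z : Z _⦋n⦌) :
    (normChains K X ⊗ normChains K Y : ChainComplex (ModuleCat.{u} K) ℕ).X n :=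
  ∑ p : SumPairs n, tz (normChains K X) (normChains K Y) p.1.1 p.1.2 n
    (cl K X (act (frontHom (by have := p.2; omega)) (φ.app _ z)) ⊗ₜ
      cl K Y (act (backHom p.2) (ψ.app _ z)))

theorem comp_awSimplex {i j n : ℕ} (h : i + j = n) (z : Z _⦋n⦌) :
    comp (normChains K X) (normChains K Y) i j n (awSimplex K φ ψ z) =
      cl K X (act (frontHom (by omega)) (φ.app _ z)) ⊗ₜ cl K Y (act (backHom h) (ψ.app _ z)) := by
  rw [awSimplex, map_sum, Finset.sum_eq_single (⟨(i, j), h⟩ : SumPairs n)]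
  · exact comp_tz_self (normChains K X) (normChains K Y) h _
  · intro p _ hp
    exact comp_tz_of_ne (normChains K X) (normChains K Y) (fun h => hp (Subtype.ext (Prod.ext h.1 h.2))) _
  · intro h; exact absurd (Finset.mem_univ _) h

variable [SpineDetermined X] [SpineDetermined Y]

/-- The degenerate edge of `z` lies in the front part or in the back part of every splitting, so one
tensor factor is degenerate. -/
theorem awSimplex_eq_zero {n : ℕ} {z : Z _⦋n⦌} (hz : z ∈ Z.degenerate n) :
    awSimplex K φ ψ z = 0 := by
  refine tensor_ext_comp fun i j h => ?_
  rw [comp_awSimplex K φ ψ h, map_zero]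
  obtain ⟨k, hk⟩ := exists_edge_of_mem_degenerate hz
  rcases Nat.lt_or_ge k i with hki | hki
  · rw [cl_eq_zero K X (mem_degenerate_of_edge _ ⟨k, hki⟩ _), TensorProduct.zero_tmul]
    rw [edge_act_frontHom, ← app_edge]
    exact app_mem_degenerate_one φ hk
  · rw [cl_eq_zero K Y (mem_degenerate_of_edge _ ⟨k - i, by omega⟩ _), TensorProduct.tmul_zero]
    rw [edge_act_backHom, ← app_edge]
    have : (⟨i + (k - i), by omega⟩ : Fin n) = k := Fin.ext (by simp; omega)
    rw [this]
    exact app_mem_degenerate_one ψ hk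

/-- The Alexander–Whitney map in degree `n`. -/
def awLin (n : ℕ) : (normChains K Z).X n →ₗ[K]
    (normChains K X ⊗ normChains K Y : ChainComplex (ModuleCat.{u} K) ℕ).X n :=
  normDesc (awSimplex K φ ψ)

theorem awLin_cl {n : ℕ} (z : Z _⦋n⦌) : awLin K φ ψ n (cl K Z z) = awSimplex K φ ψ z :=
  normDesc_cl _ (fun _ hz => awSimplex_eq_zero K φ ψ hz) z

theorem comp_awLin_cl {i j n : ℕ} (h : i + j = n) (z : Z _⦋n⦌) :
    comp (normChains K X) (normChains K Y) i j n (awLin K φ ψ n (cl K Z z)) =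
      cl K X (act (frontHom (by omega)) (φ.app _ z)) ⊗ₜ cl K Y (act (backHom h) (ψ.app _ z)) := by
  rw [awLin_cl, comp_awSimplex K φ ψ h]

/-- In bidegree `(i, j)` the last face of the front `(i + 1)`-simplex and the zeroth face of the
back `(j + 1)`-simplex produce the same tensor and cancel; the rest are the splittings of the faces
of `z`. -/
theorem d_awLin_cl {n : ℕ} (z : Z _⦋n + 1⦌) :
    ((normChains K X ⊗ normChains K Y : ChainComplex (ModuleCat.{u} K) ℕ).d (n + 1) n).hom
      (awLin K φ ψ (n + 1) (cl K Z z)) =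
      awLin K φ ψ n (((normChains K Z).d (n + 1) n).hom (cl K Z z)) := by
  refine tensor_ext_comp fun i j h => ?_
  rw [comp_d _ _ h, comp_awLin_cl K φ ψ (show i + 1 + j = n + 1 by omega),
    comp_awLin_cl K φ ψ (show i + (j + 1) = n + 1 by omega), LinearMap.rTensor_tmul,
    LinearMap.lTensor_tmul, d_cl, d_cl, d_cl, map_sum, map_sum]
  simp only [map_smul, comp_awLin_cl K φ ψ h]
  rw [TensorProduct.sum_tmul, TensorProduct.tmul_sum]
  simp only [← TensorProduct.smul_tmul', TensorProduct.tmul_smul]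
  refine alternating_sum_split (K := K)
    (M := (normChains K X).X i ⊗[K] (normChains K Y).X j) h _ _ _ (fun k => ?_) (fun l => ?_) ?_
  all_goals simp only [δ_eq_act, act_act, app_act]
  · refine congrArg₂ (fun a b => cl K X a ⊗ₜ[K] cl K Y b) (act_congr (fun m => Fin.ext ?_) _)
      (act_congr (fun m => Fin.ext ?_) _)
    · change (dHom k.castSucc m : ℕ) = dHom _ (frontHom _ m)
      rw [dHom_val, dHom_val, frontHom_val]; simp
    · change i + 1 + m = (dHom _ (backHom _ m) : ℕ)
      rw [dHom_val, backHom_val]; simp; split_ifs <;> omega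
  · refine congrArg₂ (fun a b => cl K X a ⊗ₜ[K] cl K Y b) (act_congr (fun m => Fin.ext ?_) _)
      (act_congr (fun m => Fin.ext ?_) _)
    · change (m : ℕ) = dHom _ (frontHom _ m)
      rw [dHom_val, frontHom_val]; simp; omega
    · change i + (dHom l.succ m : ℕ) = dHom _ (backHom _ m)
      rw [dHom_val, dHom_val, backHom_val]; simp; split_ifs <;> omega
  · refine congrArg₂ (fun a b => cl K X a ⊗ₜ[K] cl K Y b) (act_congr (fun m => Fin.ext ?_) _)
      (act_congr (fun m => Fin.ext ?_) _)
    · change (dHom (Fin.last (i + 1)) m : ℕ) = m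
      rw [dHom_val]; simp; omega
    · change i + 1 + m = i + (dHom 0 m : ℕ)
      rw [dHom_val]; simp; omega

/-- The Alexander–Whitney map. -/
def awMap : normChains K Z ⟶ normChains K X ⊗ normChains K Y where
  f n := ModuleCat.ofHom (awLin K φ ψ n)
  comm' i j hij := by
    obtain rfl : j + 1 = i := hij
    exact ModuleCat.hom_ext (normChains_ext fun z _ => d_awLin_cl K φ ψ z)

end AlexanderWhitney

/-! ### Submodules of tensor products -/

section Tens

variable {K : Type u} [CommRing K] {M M' Z : Type u} [AddCommGroup M] [Module K M]
  [AddCommGroup M'] [Module K M'] [AddCommGroup Z] [Module K Z]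

/-- The image of `U ⊗ U'` in `M ⊗ M'`. -/
def tens (U : Submodule K M) (U' : Submodule K M') : Submodule K (M ⊗[K] M') :=
  LinearMap.range (TensorProduct.map U.subtype U'.subtype)

theorem tmul_mem_tens {U : Submodule K M} {U' : Submodule K M'} {x : M} {y : M'} (hx : x ∈ U)
    (hy : y ∈ U') : x ⊗ₜ y ∈ tens U U' := ⟨(⟨x, hx⟩ : U) ⊗ₜ (⟨y, hy⟩ : U'), rfl⟩

theorem rTensor_eq_zero_of_mem_tens {U : Submodule K M} {U' : Submodule K M'} (φ : M →ₗ[K] Z)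
    (hφ : ∀ x ∈ U, φ x = 0) {t : M ⊗[K] M'} (ht : t ∈ tens U U') : φ.rTensor M' t = 0 := by
  obtain ⟨s, rfl⟩ := ht
  induction s using TensorProduct.induction_on with
  | zero => rw [map_zero, map_zero]
  | add a b ha hb => rw [map_add, map_add, ha, hb, add_zero]
  | tmul x y =>
    rw [TensorProduct.map_tmul, LinearMap.rTensor_tmul, Submodule.subtype_apply, hφ _ x.2,
      TensorProduct.zero_tmul]

theorem lTensor_eq_zero_of_mem_tens {U : Submodule K M} {U' : Submodule K M'} (φ : M' →ₗ[K] Z)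
    (hφ : ∀ x ∈ U', φ x = 0) {t : M ⊗[K] M'} (ht : t ∈ tens U U') : φ.lTensor M t = 0 := by
  obtain ⟨s, rfl⟩ := ht
  induction s using TensorProduct.induction_on with
  | zero => rw [map_zero, map_zero]
  | add a b ha hb => rw [map_add, map_add, ha, hb, add_zero]
  | tmul x y =>
    rw [TensorProduct.map_tmul, LinearMap.lTensor_tmul, Submodule.subtype_apply,
      Submodule.subtype_apply, hφ _ y.2, TensorProduct.tmul_zero]

/-- Flatness of `Z` makes `Z ⊗ U' → Z ⊗ M'` injective, so the vanishing can be checked before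
enlarging `U'`. Flatness of `U'` then identifies the kernel of `φ ⊗ 1` on `U ⊗ U'` with the kernel
on `U` tensored with `U'`. -/
theorem mem_tens_inf_ker_left {U : Submodule K M} {U' : Submodule K M'} [Module.Flat K U']
    [Module.Flat K Z] (φ : M →ₗ[K] Z) {t : M ⊗[K] M'} (ht : t ∈ tens U U')
    (h : φ.rTensor M' t = 0) : t ∈ tens (U ⊓ LinearMap.ker φ) U' := by
  obtain ⟨s, rfl⟩ := ht
  have h1 : (φ ∘ₗ U.subtype).rTensor U' s = 0 := by
    apply Module.Flat.lTensor_preserves_injective_linearMap (M := Z) U'.subtype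
      (Submodule.injective_subtype U')
    rw [map_zero, ← h]
    induction s using TensorProduct.induction_on with
    | zero => simp only [map_zero]
    | add a b ha hb =>
      clear h
      have key : U'.subtype.lTensor Z ∘ₗ (φ ∘ₗ U.subtype).rTensor U' =
        φ.rTensor M' ∘ₗ TensorProduct.map U.subtype U'.subtype :=
          TensorProduct.ext' fun x y => rfl
      exact LinearMap.congr_fun key (a + b)
    | tmul x y => rfl
  have hex := Module.Flat.rTensor_exact U' (f := (LinearMap.ker (φ ∘ₗ U.subtype)).subtype)
    (g := φ ∘ₗ U.subtype) (LinearMap.exact_subtype_ker_map _)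
  obtain ⟨r, rfl⟩ := (hex s).1 h1
  let θ : LinearMap.ker (φ ∘ₗ U.subtype) →ₗ[K] (U ⊓ LinearMap.ker φ : Submodule K M) :=
    LinearMap.codRestrict _ (U.subtype ∘ₗ (LinearMap.ker (φ ∘ₗ U.subtype)).subtype)
      fun x => ⟨x.1.2, x.2⟩
  have key : TensorProduct.map (U ⊓ LinearMap.ker φ).subtype U'.subtype ∘ₗ θ.rTensor U' =
      TensorProduct.map U.subtype U'.subtype ∘ₗ
        (LinearMap.ker (φ ∘ₗ U.subtype)).subtype.rTensor U' :=
    TensorProduct.ext' fun x y => rfl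
  exact ⟨θ.rTensor U' r, LinearMap.congr_fun key r⟩

theorem mem_tens_inf_ker_right {U : Submodule K M} {U' : Submodule K M'} [Module.Flat K U]
    [Module.Flat K Z] (φ : M' →ₗ[K] Z) {t : M ⊗[K] M'} (ht : t ∈ tens U U')
    (h : φ.lTensor M t = 0) : t ∈ tens U (U' ⊓ LinearMap.ker φ) := by
  obtain ⟨s, rfl⟩ := ht
  have h1 : (φ ∘ₗ U'.subtype).lTensor U s = 0 := by
    apply Module.Flat.rTensor_preserves_injective_linearMap (M := Z) U.subtype
      (Submodule.injective_subtype U)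
    have key : U.subtype.rTensor Z ∘ₗ (φ ∘ₗ U'.subtype).lTensor U =
      φ.lTensor M ∘ₗ TensorProduct.map U.subtype U'.subtype :=
        TensorProduct.ext' fun x y => rfl
    rw [map_zero, ← h]
    exact LinearMap.congr_fun key s
  have hex := Module.Flat.lTensor_exact U (f := (LinearMap.ker (φ ∘ₗ U'.subtype)).subtype)
    (g := φ ∘ₗ U'.subtype) (LinearMap.exact_subtype_ker_map _)
  obtain ⟨r, rfl⟩ := (hex s).1 h1
  let θ : LinearMap.ker (φ ∘ₗ U'.subtype) →ₗ[K] (U' ⊓ LinearMap.ker φ : Submodule K M') :=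
    LinearMap.codRestrict _ (U'.subtype ∘ₗ (LinearMap.ker (φ ∘ₗ U'.subtype)).subtype)
      fun x => ⟨x.1.2, x.2⟩
  have key : TensorProduct.map U.subtype (U' ⊓ LinearMap.ker φ).subtype ∘ₗ θ.lTensor U =
      TensorProduct.map U.subtype U'.subtype ∘ₗ
        (LinearMap.ker (φ ∘ₗ U'.subtype)).subtype.lTensor U :=
    TensorProduct.ext' fun x y => rfl
  exact ⟨θ.lTensor U r, LinearMap.congr_fun key r⟩

theorem map_subtype_injective (U : Submodule K M) (U' : Submodule K M') [Module.Flat K U]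
    [Module.Flat K M'] :
    Function.Injective (TensorProduct.map U.subtype U'.subtype) := by
  have h : TensorProduct.map U.subtype U'.subtype = U.subtype.rTensor M' ∘ₗ U'.subtype.lTensor U :=
    TensorProduct.ext' fun x y => rfl
  rw [h]
  exact (Module.Flat.rTensor_preserves_injective_linearMap _ U.injective_subtype).comp
    (Module.Flat.lTensor_preserves_injective_linearMap _ U'.injective_subtype)

end Tens

/-! ### The tensor product of two complexes `Ω` -/

section OmegaTensor

variable {K : Type u} [CommRing K]

/-- The inclusion of `ω(C, D)` in `C`. -/
def omegaι (C : ChainComplex (ModuleCat.{u} K) ℕ) (D : ∀ n, Submodule K (C.X n)) :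
    omegaComplex C D ⟶ C where
  f n := ModuleCat.ofHom (omegaSubmodule C D n).subtype

theorem comp_tensorHom {A A' B B' : ChainComplex (ModuleCat.{u} K) ℕ} (f : A ⟶ A') (g : B ⟶ B')
    {i j n : ℕ} (h : i + j = n) (u : (A ⊗ B : ChainComplex (ModuleCat.{u} K) ℕ).X n) :
    comp A' B' i j n
      (((f ⊗ₘ g : (A ⊗ B : ChainComplex (ModuleCat.{u} K) ℕ) ⟶ A' ⊗ B').f n).hom u) =
      TensorProduct.map (f.f i).hom (g.f j).hom (comp A B i j n u) := by
  rw [← sum_sumPairs_tz_comp A B n u, map_sum, map_sum, map_sum, map_sum]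
  refine Finset.sum_congr rfl fun p _ => ?_
  rw [tensorHom_tz]
  by_cases hp : p.1.1 = i ∧ p.1.2 = j
  · obtain ⟨⟨i', j'⟩, h'⟩ := p
    obtain ⟨rfl, rfl⟩ := hp
    rw [comp_tz_self A' B' h, comp_tz_self A B h]
  · rw [comp_tz_of_ne A' B' hp, comp_tz_of_ne A B hp, map_zero]

variable (S : PathPair.{u})

/-- Of the conditions on all `m` only the one with `m + 1 = n` has content, and for `n = 0` none
has, as `d 0 0` is zero. -/
theorem omegaSubmodule_eq_inf_ker (n : ℕ) :
    omegaSubmodule (normChains K S.X) (S.chainSubmodule K) n =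
      S.chainSubmodule K n ⊓
        LinearMap.ker (S.proj K (n - 1) ∘ₗ ((normChains K S.X).d n (n - 1)).hom) := by
  ext x
  rw [mem_omegaSubmodule, Submodule.mem_inf, LinearMap.mem_ker, LinearMap.comp_apply,
    S.proj_eq_zero_iff]
  refine and_congr_right fun _ => ⟨fun h => h (n - 1), fun h m => ?_⟩
  by_cases hm : m + 1 = n
  · subst hm; exact h
  · rw [HomologicalComplex.shape _ n m hm]
    exact zero_mem _

variable (K) in
/-- The inclusion of `Ω(S)` in the normalized chains. -/
def PathPair.ι : S.Omega K ⟶ normChains K S.X :=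
  omegaι (normChains K S.X) (S.chainSubmodule K)

variable (S' : PathPair.{u})

variable (K) in
/-- The map of `Ω(S) ⊗ Ω(S')` to the tensor product of the normalized chains. -/
def tensorι : S.Omega K ⊗ S'.Omega K ⟶ normChains K S.X ⊗ normChains K S'.X :=
  S.ι K ⊗ₘ S'.ι K

theorem mem_range_tensorι {n : ℕ}
    {t : (normChains K S.X ⊗ normChains K S'.X : ChainComplex (ModuleCat.{u} K) ℕ).X n}
    (ht : ∀ i j, i + j = n → comp _ _ i j n t ∈
      tens (omegaSubmodule (normChains K S.X) (S.chainSubmodule K) i)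
        (omegaSubmodule (normChains K S'.X) (S'.chainSubmodule K) j)) :
    t ∈ LinearMap.range ((tensorι K S S').f n).hom := by
  rw [← sum_sumPairs_tz_comp _ _ n t]
  refine Submodule.sum_mem _ fun p _ => ?_
  obtain ⟨s, hs⟩ := ht p.1.1 p.1.2 p.2
  refine ⟨tz (S.Omega K) (S'.Omega K) p.1.1 p.1.2 n s, ?_⟩
  refine (tensorHom_tz (S.ι K) (S'.ι K) p.1.1 p.1.2 n s).trans ?_
  exact congrArg _ hs

variable [IsDomain K] [IsPrincipalIdealRing K]

instance (n : ℕ) : Module.Free K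
    (omegaSubmodule (normChains K S.X) (S.chainSubmodule K) n) :=
  free_submodule_of_free (omegaSubmodule (normChains K S.X) (S.chainSubmodule K) n)

instance (n : ℕ) : Module.Free K ((S.Omega K).X n) :=
  inferInstanceAs (Module.Free K (omegaSubmodule (normChains K S.X) (S.chainSubmodule K) n))

theorem tensorι_injective (n : ℕ) : Function.Injective ((tensorι K S S').f n).hom := by
  intro u w h
  refine tensor_ext_comp fun i j hij => ?_
  apply map_subtype_injective (omegaSubmodule (normChains K S.X) (S.chainSubmodule K) i)
    (omegaSubmodule (normChains K S'.X) (S'.chainSubmodule K) j)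
  have h1 := congrArg (comp _ _ i j n) h
  have h2 := fun u => comp_tensorHom (S.ι K) (S'.ι K) hij u
  exact (h2 u).symm.trans (h1.trans (h2 w))

/-- A chain `t` such that `t` and its boundary lie in `D ⊗ D'` comes from `Ω ⊗ Ω'`. -/
theorem mem_range_tensorι_of_d {n : ℕ}
    {t : (normChains K S.X ⊗ normChains K S'.X : ChainComplex (ModuleCat.{u} K) ℕ).X n}
    (ht : ∀ i j, i + j = n → comp _ _ i j n t ∈
      tens (S.chainSubmodule K i) (S'.chainSubmodule K j))
    (hd : ∀ m i j, i + j = m → m + 1 = n → comp _ _ i j m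
      (((normChains K S.X ⊗ normChains K S'.X : ChainComplex (ModuleCat.{u} K) ℕ).d n m).hom t) ∈
        tens (S.chainSubmodule K i) (S'.chainSubmodule K j)) :
    t ∈ LinearMap.range ((tensorι K S S').f n).hom := by
  have hP : ∀ {i}, ∀ x ∈ S.chainSubmodule K i, S.proj K i x = 0 :=
    fun x hx => (S.proj_eq_zero_iff x).2 hx
  have hP' : ∀ {i}, ∀ x ∈ S'.chainSubmodule K i, S'.proj K i x = 0 :=
    fun x hx => (S'.proj_eq_zero_iff x).2 hx
  refine mem_range_tensorι S S' fun i j hij => ?_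
  rw [omegaSubmodule_eq_inf_ker S']
  refine mem_tens_inf_ker_right _ ?_ ?_
  · rw [omegaSubmodule_eq_inf_ker S]
    refine mem_tens_inf_ker_left _ (ht i j hij) ?_
    rcases i with _ | i
    · rw [HomologicalComplex.shape _ 0 (0 - 1) (by simp)]
      change (S.proj K 0 ∘ₗ 0).rTensor _ _ = 0
      rw [LinearMap.comp_zero, LinearMap.rTensor_zero]; rfl
    · obtain rfl : i + j + 1 = n := by omega
      -- Apply the projection off `D` to the left factor of the boundary in bidegree `(i, j)`. It
      -- kills the boundary by `hd`; it also kills the summand `1 ⊗ d`, because the component of `t`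
      -- in bidegree `(i, j + 1)` has its left factor in `D`. So the summand `d ⊗ 1` is killed by
      -- itself.
      have h1 := rTensor_eq_zero_of_mem_tens (S.proj K i) hP (hd (i + j) i j rfl rfl)
      rw [comp_d _ _ rfl, map_add, map_smul] at h1
      have h2 : (S.proj K i).rTensor _ (((normChains K S'.X).d (j + 1) j).hom.lTensor _
          (comp _ _ i (j + 1) (i + j + 1) t)) = 0 := by
        rw [← LinearMap.comp_apply, LinearMap.rTensor_comp_lTensor,
          ← LinearMap.lTensor_comp_rTensor, LinearMap.comp_apply,
          rTensor_eq_zero_of_mem_tens (S.proj K i) hP (ht i (j + 1) rfl), map_zero]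
      rw [h2, smul_zero, add_zero, ← LinearMap.comp_apply, ← LinearMap.rTensor_comp] at h1
      exact h1
  · rcases j with _ | j
    · rw [HomologicalComplex.shape _ 0 (0 - 1) (by simp)]
      change (S'.proj K 0 ∘ₗ 0).lTensor _ _ = 0
      rw [LinearMap.comp_zero, LinearMap.lTensor_zero]; rfl
    · obtain rfl : i + j + 1 = n := by omega
      have h1 := lTensor_eq_zero_of_mem_tens (S'.proj K j) hP' (hd (i + j) i j rfl rfl)
      rw [comp_d _ _ rfl, map_add, map_smul] at h1
      have h2 : (S'.proj K j).lTensor _ (((normChains K S.X).d (i + 1) i).hom.rTensor _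
          (comp _ _ (i + 1) j (i + j + 1) t)) = 0 := by
        rw [← LinearMap.comp_apply, LinearMap.lTensor_comp_rTensor,
          ← LinearMap.rTensor_comp_lTensor, LinearMap.comp_apply,
          lTensor_eq_zero_of_mem_tens (S'.proj K j) hP' (ht (i + 1) j (by omega)), map_zero]
      rw [h2, zero_add] at h1
      have h3 := ((isUnit_one.neg.pow i).smul_eq_zero).1 h1
      rw [← LinearMap.comp_apply, ← LinearMap.lTensor_comp] at h3
      exact h3

end OmegaTensor

/-! ### Box products of path pairs -/

/-- `T` is a box product of `S` and `S'`: its simplices are the pairs of simplices of `S` and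
`S'`, its vertices are the pairs of vertices, and its arrows are the pairs of an arrow and a
degenerate arrow. -/
structure IsBox (S S' T : PathPair.{u}) where
  fst : T.X ⟶ S.X
  snd : T.X ⟶ S'.X
  bijective : ∀ n, Function.Bijective
    fun z : T.X _⦋n⦌ => ((fst.app _ z, snd.app _ z) : S.X _⦋n⦌ × S'.X _⦋n⦌)
  mem_zero : ∀ z : T.X _⦋0⦌, z ∈ T.Y 0 ↔ fst.app _ z ∈ S.Y 0 ∧ snd.app _ z ∈ S'.Y 0
  mem_one : ∀ z : T.X _⦋1⦌, z ∈ T.Y 1 ↔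
    (fst.app _ z ∈ S.Y 1 ∧ ∃ v ∈ S'.Y 0, snd.app _ z = degEdge v) ∨
      ((∃ v ∈ S.Y 0, fst.app _ z = degEdge v) ∧ snd.app _ z ∈ S'.Y 1)

namespace IsBox

variable {S S' T : PathPair.{u}} (B : IsBox S S' T)

/-- The first component of a simplex. -/
def p {n : ℕ} (z : T.X _⦋n⦌) : S.X _⦋n⦌ := B.fst.app _ z

/-- The second component of a simplex. -/
def q {n : ℕ} (z : T.X _⦋n⦌) : S'.X _⦋n⦌ := B.snd.app _ z

/-- The simplex with two given components. -/
def pair {n : ℕ} (x : S.X _⦋n⦌) (y : S'.X _⦋n⦌) : T.X _⦋n⦌ := ((B.bijective n).2 (x, y)).choose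

theorem p_pair {n : ℕ} (x : S.X _⦋n⦌) (y : S'.X _⦋n⦌) : B.p (B.pair x y) = x :=
  congrArg Prod.fst ((B.bijective n).2 (x, y)).choose_spec

theorem q_pair {n : ℕ} (x : S.X _⦋n⦌) (y : S'.X _⦋n⦌) : B.q (B.pair x y) = y :=
  congrArg Prod.snd ((B.bijective n).2 (x, y)).choose_spec

theorem ext {n : ℕ} {z w : T.X _⦋n⦌} (hp : B.p z = B.p w) (hq : B.q z = B.q w) : z = w :=
  (B.bijective n).1 (Prod.ext hp hq)

section

variable {m n : ℕ} (f : Fin (m + 1) →o Fin (n + 1)) (z : T.X _⦋n⦌)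

theorem p_act : B.p (act f z) = act f (B.p z) := app_act _ f z

theorem q_act : B.q (act f z) = act f (B.q z) := app_act _ f z

theorem p_edge (i : Fin n) : B.p (edge z i) = edge (B.p z) i := B.p_act _ z

theorem q_edge (i : Fin n) : B.q (edge z i) = edge (B.q z) i := B.q_act _ z

theorem p_vtx (a : Fin (n + 1)) : B.p (vtx z a) = vtx (B.p z) a := B.p_act _ z

theorem q_vtx (a : Fin (n + 1)) : B.q (vtx z a) = vtx (B.q z) a := B.q_act _ z

theorem act_pair (x : S.X _⦋n⦌) (y : S'.X _⦋n⦌) :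
    act f (B.pair x y) = B.pair (act f x) (act f y) :=
  B.ext (by rw [p_act, p_pair, p_pair]) (by rw [q_act, q_pair, q_pair])

end

theorem mem_degenerate_one (e : T.X _⦋1⦌) : e ∈ T.X.degenerate 1 ↔
    B.p e ∈ S.X.degenerate 1 ∧ B.q e ∈ S'.X.degenerate 1 := by
  constructor
  · exact fun h => ⟨app_mem_degenerate_one _ h, app_mem_degenerate_one _ h⟩
  · rintro ⟨h1, h2⟩
    obtain ⟨v, hv⟩ := (mem_degenerate_one_iff _).1 h1
    obtain ⟨w, hw⟩ := (mem_degenerate_one_iff _).1 h2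
    refine (mem_degenerate_one_iff _).2 ⟨B.pair v w, B.ext ?_ ?_⟩
    · rw [hv, degEdge, degEdge, p_act, p_pair]
    · rw [hw, degEdge, degEdge, q_act, q_pair]

theorem mem_one' (z : T.X _⦋1⦌) : z ∈ T.Y 1 ↔
    (B.p z ∈ S.Y 1 ∧ ∃ v ∈ S'.Y 0, B.q z = degEdge v) ∨
      ((∃ v ∈ S.Y 0, B.p z = degEdge v) ∧ B.q z ∈ S'.Y 1) := B.mem_one z

variable [QuiverLike T]

theorem nonDegenerate_iff {n : ℕ} {z : T.X _⦋n⦌} : z ∈ T.X.nonDegenerate n ↔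
    ∀ i, ¬ (edge (B.p z) i ∈ S.X.degenerate 1 ∧ edge (B.q z) i ∈ S'.X.degenerate 1) := by
  rw [mem_nonDegenerate_iff_edges]
  refine forall_congr' fun i => ?_
  rw [B.mem_degenerate_one, p_edge, q_edge]

theorem p_mem [QuiverLike S] {n : ℕ} {z : T.X _⦋n⦌} (hz : z ∈ T.Y n) : B.p z ∈ S.Y n := by
  rw [QuiverLike.mem_iff]
  refine ⟨fun a => ?_, fun i => ?_⟩
  · rw [← p_vtx]; exact ((B.mem_zero _).1 (PathPair.vtx_mem hz a)).1
  · rw [← p_edge]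
    rcases (B.mem_one' _).1 (PathPair.edge_mem hz i) with ⟨h, _⟩ | ⟨⟨v, hv, h⟩, _⟩
    · exact h
    · rw [h]; exact S.degEdge_mem_Y hv

theorem q_mem [QuiverLike S'] {n : ℕ} {z : T.X _⦋n⦌} (hz : z ∈ T.Y n) : B.q z ∈ S'.Y n := by
  rw [QuiverLike.mem_iff]
  refine ⟨fun a => ?_, fun i => ?_⟩
  · rw [← q_vtx]; exact ((B.mem_zero _).1 (PathPair.vtx_mem hz a)).2
  · rw [← q_edge]
    rcases (B.mem_one' _).1 (PathPair.edge_mem hz i) with ⟨_, ⟨v, hv, h⟩⟩ | ⟨_, h⟩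
    · rw [h]; exact S'.degEdge_mem_Y hv
    · exact h

/-- Each edge of a path is horizontal or vertical. -/
theorem edge_cases {n : ℕ} {z : T.X _⦋n⦌} (hz : z ∈ T.Y n) (i : Fin n) :
    edge (B.q z) i ∈ S'.X.degenerate 1 ∨ edge (B.p z) i ∈ S.X.degenerate 1 := by
  rcases (B.mem_one' _).1 (PathPair.edge_mem hz i) with ⟨_, v, _, h⟩ | ⟨⟨v, _, h⟩, _⟩
  · left; rw [← q_edge, h]; exact degEdge_mem v
  · right; rw [← p_edge, h]; exact degEdge_mem v

theorem mem_of_edges {n : ℕ} {z : T.X _⦋n⦌} (hp : ∀ a, vtx (B.p z) a ∈ S.Y 0)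
    (hq : ∀ a, vtx (B.q z) a ∈ S'.Y 0)
    (h : ∀ i, (edge (B.p z) i ∈ S.Y 1 ∧ edge (B.q z) i ∈ S'.X.degenerate 1) ∨
      (edge (B.p z) i ∈ S.X.degenerate 1 ∧ edge (B.q z) i ∈ S'.Y 1)) : z ∈ T.Y n := by
  rw [QuiverLike.mem_iff]
  refine ⟨fun a => ?_, fun i => ?_⟩
  · exact (B.mem_zero _).2 ⟨by have := hp a; rwa [← p_vtx] at this,
      by have := hq a; rwa [← q_vtx] at this⟩
  · rw [B.mem_one', p_edge, q_edge]
    rcases h i with ⟨h1, h2⟩ | ⟨h1, h2⟩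
    · exact Or.inl ⟨h1, _, hq _, (seg_eq_of_mem_degenerate _ h2).1⟩
    · exact Or.inr ⟨⟨_, hp _, (seg_eq_of_mem_degenerate _ h1).1⟩, h2⟩

end IsBox

/-! ### Interchanging two steps of a path -/

section EdgesOfFaces

variable {n : ℕ}

/-- The index `i` is independent of the simplicial set, so the same one works for both components of
a simplex in a box product. -/
theorem exists_edge_act_dHom (j : Fin (n + 2)) (k : Fin n) (hjk : (j : ℕ) ≠ k + 1) :
    ∃ i : Fin (n + 1), ∀ {X : SSet.{u}} (x : X _⦋n + 1⦌), edge (act (dHom j) x) k = edge x i := by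
  rcases Nat.lt_or_ge k j with h | h
  · refine ⟨k.castSucc, fun x => ?_⟩
    rw [edge_act]
    exact seg_eq_edge x _ k.castSucc (by rw [dHom_val]; simp [h]) (by rw [dHom_val]; simp; omega)
  · refine ⟨k.succ, fun x => ?_⟩
    rw [edge_act]
    exact seg_eq_edge x _ k.succ (by rw [dHom_val]; simp; omega) (by rw [dHom_val]; simp; omega)

theorem castSucc_castSucc_le_succ_succ (k : Fin n) : k.castSucc.castSucc ≤ k.succ.succ := by
  rw [Fin.le_def]; simp; omega

theorem edge_act_dHom_self {X : SSet.{u}} (x : X _⦋n + 1⦌) (k : Fin n) :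
    edge (act (dHom k.succ.castSucc) x) k =
      seg x k.castSucc.castSucc k.succ.succ (castSucc_castSucc_le_succ_succ k) := by
  rw [edge_act]
  exact seg_congr x (Fin.ext (by rw [dHom_val]; simp)) (Fin.ext (by rw [dHom_val]; simp)) _

theorem sHom_succ_dHom (k : Fin n) (a : Fin (n + 2)) :
    (dHom k.succ.castSucc (sHom k.succ a) : ℕ) =
      if (a : ℕ) = (k : ℕ) + 1 then (k : ℕ) + 2 else (a : ℕ) := by
  rw [dHom_val, sHom_val]; simp; split_ifs <;> omega

theorem sHom_castSucc_dHom (k : Fin n) (a : Fin (n + 2)) :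
    (dHom k.succ.castSucc (sHom k.castSucc a) : ℕ) =
      if (a : ℕ) = (k : ℕ) + 1 then (k : ℕ) else (a : ℕ) := by
  rw [dHom_val, sHom_val]; simp; split_ifs <;> omega

/-- Move the vertex `k + 1` to the vertex `k + 2`. -/
def upHom (k : Fin n) : Fin (n + 2) →o Fin (n + 2) := (dHom k.succ.castSucc).comp (sHom k.succ)

/-- Move the vertex `k + 1` to the vertex `k`. -/
def downHom (k : Fin n) : Fin (n + 2) →o Fin (n + 2) :=
  (dHom k.succ.castSucc).comp (sHom k.castSucc)

theorem upHom_val (k : Fin n) (a : Fin (n + 2)) :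
    (upHom k a : ℕ) = if (a : ℕ) = (k : ℕ) + 1 then (k : ℕ) + 2 else (a : ℕ) := sHom_succ_dHom k a

theorem downHom_val (k : Fin n) (a : Fin (n + 2)) :
    (downHom k a : ℕ) = if (a : ℕ) = (k : ℕ) + 1 then (k : ℕ) else (a : ℕ) :=
  sHom_castSucc_dHom k a

variable {X : SSet.{u}} (x : X _⦋n + 1⦌) (k : Fin n)

theorem act_upHom : act (upHom k) x = act (sHom k.succ) (act (dHom k.succ.castSucc) x) :=
  (act_act _ _ _).symm

theorem act_downHom : act (downHom k) x = act (sHom k.castSucc) (act (dHom k.succ.castSucc) x) :=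
  (act_act _ _ _).symm

theorem act_dHom_upHom : act (dHom k.succ.castSucc) (act (upHom k) x) =
    act (dHom k.succ.castSucc) x := by
  rw [act_act]
  refine act_congr (fun a => Fin.ext ?_) x
  change (upHom k (dHom _ a) : ℕ) = _
  rw [upHom_val, dHom_val]; simp; split_ifs <;> omega

theorem act_dHom_downHom : act (dHom k.succ.castSucc) (act (downHom k) x) =
    act (dHom k.succ.castSucc) x := by
  rw [act_act]
  refine act_congr (fun a => Fin.ext ?_) x
  change (downHom k (dHom _ a) : ℕ) = _
  rw [downHom_val, dHom_val]; simp; split_ifs <;> omega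

theorem edge_act_upHom_of_ne (i : Fin (n + 1)) (h : i ≠ k.castSucc) (h' : i ≠ k.succ) :
    edge (act (upHom k) x) i = edge x i := by
  rw [Ne, Fin.ext_iff] at h h'
  simp only [Fin.val_castSucc, Fin.val_succ] at h h'
  rw [edge_act]
  refine seg_eq_edge x _ i ?_ ?_
  · rw [upHom_val, Fin.val_castSucc, if_neg h']
  · rw [upHom_val, Fin.val_succ, if_neg (by omega)]

theorem edge_act_downHom_of_ne (i : Fin (n + 1)) (h : i ≠ k.castSucc) (h' : i ≠ k.succ) :
    edge (act (downHom k) x) i = edge x i := by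
  rw [Ne, Fin.ext_iff] at h h'
  simp only [Fin.val_castSucc, Fin.val_succ] at h h'
  rw [edge_act]
  refine seg_eq_edge x _ i ?_ ?_
  · rw [downHom_val, Fin.val_castSucc, if_neg h']
  · rw [downHom_val, Fin.val_succ, if_neg (by omega)]

theorem edge_act_upHom_succ : edge (act (upHom k) x) k.succ ∈ X.degenerate 1 := by
  rw [edge_act]
  exact seg_mem_of_eq x _ (Fin.ext (by rw [upHom_val, upHom_val]; simp))

theorem edge_act_downHom_castSucc : edge (act (downHom k) x) k.castSucc ∈ X.degenerate 1 := by
  rw [edge_act]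
  exact seg_mem_of_eq x _ (Fin.ext (by rw [downHom_val, downHom_val]; simp))

variable [SpineDetermined X]

theorem seg_of_left_edge (h : edge x k.castSucc ∈ X.degenerate 1) :
    seg x k.castSucc.castSucc k.succ.succ (castSucc_castSucc_le_succ_succ k) = edge x k.succ :=
  seg_eq_of_left x (b := k.succ.castSucc) (by rw [Fin.le_def]; simp) (by rw [Fin.le_def]; simp) h

theorem seg_of_right_edge (h : edge x k.succ ∈ X.degenerate 1) :
    seg x k.castSucc.castSucc k.succ.succ (castSucc_castSucc_le_succ_succ k) = edge x k.castSucc :=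
  seg_eq_of_right x (b := k.succ.castSucc) (by rw [Fin.le_def]; simp) (by rw [Fin.le_def]; simp) h

theorem edge_act_upHom_castSucc (h : edge x k.castSucc ∈ X.degenerate 1) :
    edge (act (upHom k) x) k.castSucc = edge x k.succ := by
  rw [edge_act, ← seg_of_left_edge x k h]
  exact seg_congr x (Fin.ext (by rw [upHom_val]; simp)) (Fin.ext (by rw [upHom_val]; simp)) _

theorem edge_act_downHom_succ (h : edge x k.succ ∈ X.degenerate 1) :
    edge (act (downHom k) x) k.succ = edge x k.castSucc := by
  rw [edge_act, ← seg_of_right_edge x k h]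
  exact seg_congr x (Fin.ext (by rw [downHom_val]; simp)) (Fin.ext (by rw [downHom_val]; simp)) _

theorem act_upHom_eq_self (h : edge x k.succ ∈ X.degenerate 1) : act (upHom k) x = x := by
  rw [act_upHom]; exact (eq_sHom_dHom_castSucc x k.succ h).symm

theorem act_downHom_eq_self (h : edge x k.castSucc ∈ X.degenerate 1) : act (downHom k) x = x := by
  rw [act_downHom]; exact (eq_sHom_dHom_succ x k.castSucc h).symm

end EdgesOfFaces

namespace IsBox

variable {S S' T : PathPair.{u}} (B : IsBox S S' T)
variable {n : ℕ} (k : Fin n) (z : T.X _⦋n + 1⦌)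

/-- The path obtained from `z` by interchanging a vertical step `k` and a horizontal
step `k + 1`. -/
def swap : T.X _⦋n + 1⦌ := B.pair (act (upHom k) (B.p z)) (act (downHom k) (B.q z))

theorem p_swap : B.p (B.swap k z) = act (upHom k) (B.p z) := B.p_pair _ _

theorem q_swap : B.q (B.swap k z) = act (downHom k) (B.q z) := B.q_pair _ _

theorem act_dHom_swap :
    act (dHom k.succ.castSucc) (B.swap k z) = act (dHom k.succ.castSucc) z := by
  apply B.ext
  · rw [p_act, p_act, p_swap, act_dHom_upHom]
  · rw [q_act, q_act, q_swap, act_dHom_downHom]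

theorem edge_swap_of_ne (i : Fin (n + 1)) (h : i ≠ k.castSucc) (h' : i ≠ k.succ) :
    edge (B.p (B.swap k z)) i = edge (B.p z) i ∧ edge (B.q (B.swap k z)) i = edge (B.q z) i := by
  rw [p_swap, q_swap, edge_act_upHom_of_ne _ k i h h', edge_act_downHom_of_ne _ k i h h']
  exact ⟨rfl, rfl⟩

theorem edge_swap_castSucc [QuiverLike S] (hp : edge (B.p z) k.castSucc ∈ S.X.degenerate 1) :
    edge (B.p (B.swap k z)) k.castSucc = edge (B.p z) k.succ ∧
      edge (B.q (B.swap k z)) k.castSucc ∈ S'.X.degenerate 1 := by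
  rw [p_swap, q_swap]
  exact ⟨edge_act_upHom_castSucc _ k hp, edge_act_downHom_castSucc _ k⟩

theorem edge_swap_succ [QuiverLike S'] (hq : edge (B.q z) k.succ ∈ S'.X.degenerate 1) :
    edge (B.p (B.swap k z)) k.succ ∈ S.X.degenerate 1 ∧
      edge (B.q (B.swap k z)) k.succ = edge (B.q z) k.castSucc := by
  rw [p_swap, q_swap]
  exact ⟨edge_act_upHom_succ _ k, edge_act_downHom_succ _ k hq⟩

variable {k z}

theorem edge_act_dHom [QuiverLike S] [QuiverLike S'] (hp : edge (B.p z) k.castSucc ∈ S.X.degenerate 1)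
    (hq : edge (B.q z) k.succ ∈ S'.X.degenerate 1) :
    edge (act (dHom k.succ.castSucc) (B.p z)) k = edge (B.p z) k.succ ∧
      edge (act (dHom k.succ.castSucc) (B.q z)) k = edge (B.q z) k.castSucc := by
  rw [edge_act_dHom_self, edge_act_dHom_self, seg_of_left_edge _ k hp, seg_of_right_edge _ k hq]
  exact ⟨rfl, rfl⟩

variable [QuiverLike S] [QuiverLike S'] [QuiverLike T]

theorem swap_mem (hz : z ∈ T.Y (n + 1)) (hp : edge (B.p z) k.castSucc ∈ S.X.degenerate 1)
    (hq : edge (B.q z) k.succ ∈ S'.X.degenerate 1) : B.swap k z ∈ T.Y (n + 1) := by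
  have h1 := B.p_mem hz
  have h2 := B.q_mem hz
  refine B.mem_of_edges (fun a => ?_) (fun a => ?_) (fun i => ?_)
  · rw [p_swap, vtx_act]; exact PathPair.vtx_mem h1 _
  · rw [q_swap, vtx_act]; exact PathPair.vtx_mem h2 _
  · by_cases hi : i = k.castSucc
    · subst hi
      obtain ⟨e1, e2⟩ := B.edge_swap_castSucc k z hp
      rw [e1]
      exact Or.inl ⟨PathPair.edge_mem h1 _, e2⟩
    · by_cases hi' : i = k.succ
      · subst hi'
        obtain ⟨e1, e2⟩ := B.edge_swap_succ k z hq
        rw [e2]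
        exact Or.inr ⟨e1, PathPair.edge_mem h2 _⟩
      · obtain ⟨e1, e2⟩ := B.edge_swap_of_ne k z i hi hi'
        rw [e1, e2]
        rcases B.edge_cases hz i with h | h
        · exact Or.inl ⟨PathPair.edge_mem h1 _, h⟩
        · exact Or.inr ⟨h, PathPair.edge_mem h2 _⟩

theorem swap_nonDegenerate (hd : z ∈ T.X.nonDegenerate (n + 1))
    (hp : edge (B.p z) k.castSucc ∈ S.X.degenerate 1)
    (hq : edge (B.q z) k.succ ∈ S'.X.degenerate 1) :
    B.swap k z ∈ T.X.nonDegenerate (n + 1) := by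
  rw [B.nonDegenerate_iff] at hd ⊢
  intro i
  by_cases hi : i = k.castSucc
  · subst hi
    rw [(B.edge_swap_castSucc k z hp).1]
    exact fun h => hd _ ⟨h.1, hq⟩
  · by_cases hi' : i = k.succ
    · subst hi'
      rw [(B.edge_swap_succ k z hq).2]
      exact fun h => hd _ ⟨hp, h.2⟩
    · obtain ⟨e1, e2⟩ := B.edge_swap_of_ne k z i hi hi'
      rw [e1, e2]
      exact hd i

/-- Two horizontal or two vertical steps at `k`, `k + 1` would make one component of the merged edge
degenerate, while for `z` both are nondegenerate. For each of the two mixed orders, the face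
determines both components of `w`, since the inner vertex of each component is repeated at a
prescribed end. -/
theorem eq_or_eq_swap (hd : z ∈ T.X.nonDegenerate (n + 1))
    (hp : edge (B.p z) k.castSucc ∈ S.X.degenerate 1)
    (hq : edge (B.q z) k.succ ∈ S'.X.degenerate 1) {w : T.X _⦋n + 1⦌} (hw : w ∈ T.Y (n + 1))
    (h : act (dHom k.succ.castSucc) w = act (dHom k.succ.castSucc) z) :
    w = z ∨ w = B.swap k z := by
  have hpw : act (dHom k.succ.castSucc) (B.p w) = act (dHom k.succ.castSucc) (B.p z) := by
    rw [← p_act, ← p_act, h]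
  have hqw : act (dHom k.succ.castSucc) (B.q w) = act (dHom k.succ.castSucc) (B.q z) := by
    rw [← q_act, ← q_act, h]
  obtain ⟨e1, e2⟩ := B.edge_act_dHom hp hq
  rw [B.nonDegenerate_iff] at hd
  rcases B.edge_cases hw k.castSucc with h1 | h1 <;> rcases B.edge_cases hw k.succ with h2 | h2
  · refine absurd ⟨hp, ?_⟩ (hd k.castSucc)
    rw [← e2, ← hqw, edge_act_dHom_self, seg_of_left_edge _ k h1]
    exact h2
  · right
    apply B.ext
    · rw [p_swap, ← act_upHom_eq_self _ k h2, act_upHom, act_upHom, hpw]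
    · rw [q_swap, ← act_downHom_eq_self _ k h1, act_downHom, act_downHom, hqw]
  · left
    apply B.ext
    · rw [← act_downHom_eq_self _ k h1, ← act_downHom_eq_self (B.p z) k hp, act_downHom,
        act_downHom, hpw]
    · rw [← act_upHom_eq_self _ k h2, ← act_upHom_eq_self (B.q z) k hq, act_upHom, act_upHom, hqw]
  · refine absurd ⟨?_, hq⟩ (hd k.succ)
    rw [← e1, ← hpw, edge_act_dHom_self, seg_of_left_edge _ k h1]
    exact h2

theorem act_dHom_nonDegenerate (hd : z ∈ T.X.nonDegenerate (n + 1))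
    (hp : edge (B.p z) k.castSucc ∈ S.X.degenerate 1)
    (hq : edge (B.q z) k.succ ∈ S'.X.degenerate 1) :
    act (dHom k.succ.castSucc) z ∈ T.X.nonDegenerate n := by
  rw [B.nonDegenerate_iff] at hd ⊢
  intro i
  rw [p_act, q_act]
  by_cases hi : i = k
  · subst hi
    rw [(B.edge_act_dHom hp hq).1]
    exact fun h => hd _ ⟨h.1, hq⟩
  · obtain ⟨j, hj⟩ := exists_edge_act_dHom k.succ.castSucc i fun h => hi (Fin.ext (by simp at h; omega))
    rw [hj, hj]
    exact hd j

/-- The merged edge is diagonal: both of its components are nondegenerate, so it is not an arrow of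
the box product. -/
theorem act_dHom_notMem (hd : z ∈ T.X.nonDegenerate (n + 1))
    (hp : edge (B.p z) k.castSucc ∈ S.X.degenerate 1)
    (hq : edge (B.q z) k.succ ∈ S'.X.degenerate 1) : act (dHom k.succ.castSucc) z ∉ T.Y n := by
  intro h
  rw [B.nonDegenerate_iff] at hd
  obtain ⟨e1, e2⟩ := B.edge_act_dHom hp hq
  rcases B.edge_cases h k with h1 | h1
  · rw [q_act, e2] at h1; exact hd _ ⟨hp, h1⟩
  · rw [p_act, e1] at h1; exact hd _ ⟨h1, hq⟩

theorem swap_ne (hd : z ∈ T.X.nonDegenerate (n + 1))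
    (hp : edge (B.p z) k.castSucc ∈ S.X.degenerate 1)
    (hq : edge (B.q z) k.succ ∈ S'.X.degenerate 1) : B.swap k z ≠ z := by
  intro h
  have h1 := (B.edge_swap_castSucc k z hp).1
  rw [h] at h1
  rw [B.nonDegenerate_iff] at hd
  exact hd k.succ ⟨h1 ▸ hp, hq⟩

variable {K : Type u} [CommRing K]

/-- The coefficients of a chain in `Ω` at two paths which differ by an interchange of two steps
are opposite. -/
theorem coeff_add_coeff_swap (hd : z ∈ T.X.nonDegenerate (n + 1))
    (hp : edge (B.p z) k.castSucc ∈ S.X.degenerate 1)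
    (hq : edge (B.q z) k.succ ∈ S'.X.degenerate 1) {u : (normChains K T.X).X (n + 1)}
    (hu : u ∈ omegaSubmodule (normChains K T.X) (T.chainSubmodule K) (n + 1)) :
    coeff K z u + coeff K (B.swap k z) u = 0 := by
  classical
  have hw := B.act_dHom_nonDegenerate hd hp hq
  -- Zero is rewritten as the coefficient of the inner face of `z` in the corresponding face of `u`.
  -- Among nondegenerate paths only `z` and its interchange have that face, each with coefficient
  -- one.
  rw [← T.coeff_eq_zero (T.face_mem hu k.succ.castSucc) hw (B.act_dHom_notMem hd hp hq)]
  refine T.eqOn_chainSubmodule (f := coeff K z + coeff K (B.swap k z))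
    (g := coeff K (act (dHom k.succ.castSucc) z) ∘ₗ face K T.X k.succ.castSucc)
    (fun y hy hyd => ?_) (mem_omegaSubmodule.1 hu).1
  rw [LinearMap.add_apply, LinearMap.comp_apply, face_cl _ hyd, coeff_cl hd, coeff_cl hw,
    coeff_cl (B.swap_nonDegenerate hd hp hq), δ_eq_act]
  by_cases h : act (dHom k.succ.castSucc) y = act (dHom k.succ.castSucc) z
  · rw [if_pos h]
    rcases B.eq_or_eq_swap hd hp hq hy h with rfl | rfl
    · rw [if_pos rfl, if_neg (B.swap_ne hd hp hq).symm, add_zero]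
    · rw [if_neg (B.swap_ne hd hp hq), if_pos rfl, zero_add]
  · rw [if_neg h, if_neg (by rintro rfl; exact h rfl), if_neg, add_zero]
    rintro rfl
    exact h (B.act_dHom_swap k z)

end IsBox

/-! ### Injectivity of the Alexander–Whitney map on `Ω` -/

/-- The retraction of `frontHom`. -/
def minHom (p n : ℕ) : Fin (n + 1) →o Fin (p + 1) where
  toFun k := ⟨min k p, by omega⟩
  monotone' _ _ h := min_le_min_right p h

/-- The retraction of `backHom`. -/
def subHom {p q n : ℕ} (h : p + q = n) : Fin (n + 1) →o Fin (q + 1) where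
  toFun k := ⟨k - p, by omega⟩
  monotone' _ _ h := Nat.sub_le_sub_right h p

theorem minHom_val (p n : ℕ) (k : Fin (n + 1)) : (minHom p n k : ℕ) = min (k : ℕ) p := rfl

theorem subHom_val {p q n : ℕ} (h : p + q = n) (k : Fin (n + 1)) : (subHom h k : ℕ) = k - p := rfl

section

variable {X : SSet.{u}} [SpineDetermined X]

theorem act_minHom_frontHom {p n : ℕ} (h : p ≤ n) (x : X _⦋n⦌)
    (hx : ∀ i : Fin n, p ≤ i → edge x i ∈ X.degenerate 1) :
    act (minHom p n) (act (frontHom h) x) = x := by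
  rw [act_act]
  refine (act_eq_of_seg_degenerate x _ OrderHom.id fun k => ⟨?_, ?_⟩).trans (act_id x)
  · change min (k : ℕ) p ≤ k
    exact min_le_left _ _
  · refine seg_mem_degenerate_of_edges x _ fun i h1 h2 => hx i ?_
    change min (k : ℕ) p ≤ i at h1
    change (i : ℕ) < k at h2
    omega

theorem act_subHom_backHom {p q n : ℕ} (h : p + q = n) (x : X _⦋n⦌)
    (hx : ∀ i : Fin n, (i : ℕ) < p → edge x i ∈ X.degenerate 1) :
    act (subHom h) (act (backHom h) x) = x := by
  rw [act_act]
  refine Eq.trans (act_eq_of_seg_degenerate x OrderHom.id _ fun k => ⟨?_, ?_⟩).symm (act_id x)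
  · change (k : ℕ) ≤ p + (k - p)
    omega
  · refine seg_mem_degenerate_of_edges x _ fun i h1 h2 => hx i ?_
    change (k : ℕ) ≤ i at h1
    change (i : ℕ) < p + (k - p) at h2
    omega

end

namespace IsBox

variable {S S' T : PathPair.{u}} (B : IsBox S S' T) [QuiverLike T]
variable {K : Type u} [CommRing K] {n : ℕ}

theorem exists_sorted {z : T.X _⦋n⦌} (hz : z ∈ T.Y n)
    (h : ∀ i j : Fin n, (j : ℕ) = i + 1 → edge (B.p z) i ∈ S.X.degenerate 1 →
      edge (B.q z) j ∉ S'.X.degenerate 1) :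
    ∃ p q, p + q = n ∧ (∀ i : Fin n, (i : ℕ) < p → edge (B.q z) i ∈ S'.X.degenerate 1) ∧
      ∀ i : Fin n, p ≤ i → edge (B.p z) i ∈ S.X.degenerate 1 := by
  classical
  by_cases h0 : ∃ p : ℕ, ∃ hp : p < n, edge (B.p z) ⟨p, hp⟩ ∈ S.X.degenerate 1
  · let p := Nat.find h0
    obtain ⟨hp, hp'⟩ := Nat.find_spec h0
    refine ⟨p, n - p, by omega, fun i hi => ?_, ?_⟩
    · refine (B.edge_cases hz i).resolve_right fun h1 => Nat.find_min h0 hi ⟨i.2, h1⟩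
    · suffices H : ∀ i, p ≤ i → ∀ hi : i < n, edge (B.p z) ⟨i, hi⟩ ∈ S.X.degenerate 1 from
        fun i hpi => H i hpi i.2
      intro i hpi
      induction i, hpi using Nat.le_induction with
      | base => exact fun _ => hp'
      | succ i hpi ih =>
        exact fun hi => (B.edge_cases hz _).resolve_left
          (h ⟨i, by omega⟩ ⟨i + 1, hi⟩ rfl (ih (by omega)))
  · push Not at h0
    refine ⟨n, 0, rfl, fun i _ => ?_, fun i hi => absurd i.2 (by omega)⟩
    exact (B.edge_cases hz i).resolve_right (h0 i i.2)

variable [QuiverLike S] [QuiverLike S']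

/-- A path `w` whose front part and back part in bidegree `(p, q)` equal the nondegenerate ones of
`z` must itself be sorted at `p`, and a sorted path is recovered from these two parts. So the
coefficient at `z` is a coefficient of the Alexander–Whitney image. -/
theorem coeff_eq_zero_of_sorted {z : T.X _⦋n⦌} (hd : z ∈ T.X.nonDegenerate n)
    {p q : ℕ} (h : p + q = n)
    (h1 : ∀ i : Fin n, (i : ℕ) < p → edge (B.q z) i ∈ S'.X.degenerate 1)
    (h2 : ∀ i : Fin n, p ≤ i → edge (B.p z) i ∈ S.X.degenerate 1)
    {u : (normChains K T.X).X n} (hu : u ∈ T.chainSubmodule K n)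
    (haw : awLin K B.fst B.snd n u = 0) : coeff K z u = 0 := by
  classical
  have hpn : p ≤ n := by omega
  have hd' := hd
  rw [B.nonDegenerate_iff] at hd'
  have hx : act (frontHom hpn) (B.p z) ∈ S.X.nonDegenerate p := by
    rw [mem_nonDegenerate_iff_edges]
    intro i
    rw [edge_act_frontHom]
    exact fun h3 => hd' _ ⟨h3, h1 _ i.2⟩
  have hy : act (backHom h) (B.q z) ∈ S'.X.nonDegenerate q := by
    rw [mem_nonDegenerate_iff_edges]
    intro i
    rw [edge_act_backHom]
    exact fun h3 => hd' _ ⟨h2 _ (Nat.le_add_right _ _), h3⟩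
  let F : (normChains K T.X).X n →ₗ[K] K :=
    (TensorProduct.lid K K).toLinearMap ∘ₗ
      TensorProduct.map (coeff K (act (frontHom hpn) (B.p z)))
        (coeff K (act (backHom h) (B.q z))) ∘ₗ
      comp (normChains K S.X) (normChains K S'.X) p q n ∘ₗ awLin K B.fst B.snd n
  have hF : F u = 0 := by
    change (TensorProduct.lid K K) (TensorProduct.map _ _ (comp _ _ p q n
      (awLin K B.fst B.snd n u))) = 0
    rw [haw, map_zero, map_zero, map_zero]
  rw [← hF]
  refine T.eqOn_chainSubmodule (fun w hw hwd => ?_) hu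
  change _ = (TensorProduct.lid K K) (TensorProduct.map _ _ (comp _ _ p q n
    (awLin K B.fst B.snd n (cl K T.X w))))
  rw [comp_awLin_cl K B.fst B.snd h, TensorProduct.map_tmul, TensorProduct.lid_tmul, smul_eq_mul,
    coeff_cl hd, coeff_cl hx, coeff_cl hy]
  change _ = (if act (frontHom hpn) (B.p w) = _ then (1 : K) else 0) *
    (if act (backHom h) (B.q w) = _ then (1 : K) else 0)
  by_cases h3 : act (frontHom hpn) (B.p w) = act (frontHom hpn) (B.p z) ∧
      act (backHom h) (B.q w) = act (backHom h) (B.q z)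
  · rw [if_pos h3.1, if_pos h3.2, mul_one, if_pos]
    -- A vertical step of `w` before `p` would be a degenerate edge in its front part, which is
    -- nondegenerate.
    have h4 : ∀ i : Fin n, (i : ℕ) < p → edge (B.q w) i ∈ S'.X.degenerate 1 := by
      intro i hi
      refine (B.edge_cases hw i).resolve_right fun h5 => ?_
      rw [mem_nonDegenerate_iff_edges, ← h3.1] at hx
      refine hx ⟨i, hi⟩ ?_
      rw [edge_act_frontHom]; exact h5
    have h5 : ∀ i : Fin n, p ≤ i → edge (B.p w) i ∈ S.X.degenerate 1 := by
      intro i hi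
      refine (B.edge_cases hw i).resolve_left fun h6 => ?_
      rw [mem_nonDegenerate_iff_edges, ← h3.2] at hy
      refine hy ⟨i - p, by omega⟩ ?_
      rw [edge_act_backHom]
      have : (⟨p + (i - p), by omega⟩ : Fin n) = i := Fin.ext (by simp; omega)
      rw [this]; exact h6
    apply B.ext
    · rw [← act_minHom_frontHom hpn _ h5, ← act_minHom_frontHom hpn _ h2, h3.1]
    · rw [← act_subHom_backHom h _ h4, ← act_subHom_backHom h _ h1, h3.2]
  · rw [if_neg (by rintro rfl; exact h3 ⟨rfl, rfl⟩)]
    rw [not_and_or] at h3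
    rcases h3 with h3 | h3
    · rw [if_neg h3, zero_mul]
    · rw [if_neg h3, mul_zero]

open Classical in
/-- The sequence of the types of the steps of a path, `true` for vertical steps. -/
def word (z : T.X _⦋n⦌) : Lex (Fin n → Bool) :=
  toLex fun i => decide (edge (B.p z) i ∈ S.X.degenerate 1)

/-- The first letter changed by the interchange is at `k`, where `true` (vertical) becomes `false`
(horizontal). -/
theorem word_swap_lt {k : Fin n} {z : T.X _⦋n + 1⦌} (hd : z ∈ T.X.nonDegenerate (n + 1))
    (hp : edge (B.p z) k.castSucc ∈ S.X.degenerate 1)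
    (hq : edge (B.q z) k.succ ∈ S'.X.degenerate 1) : B.word (B.swap k z) < B.word z := by
  classical
  refine ⟨k.castSucc, fun j hj => ?_, ?_⟩
  · change decide _ = decide _
    rw [(B.edge_swap_of_ne k z j hj.ne (hj.trans k.castSucc_lt_succ).ne).1]
  · change decide _ < decide _
    rw [(B.edge_swap_castSucc k z hp).1, decide_eq_true hp, decide_eq_false]
    · decide
    · rw [B.nonDegenerate_iff] at hd
      exact fun h => hd _ ⟨h, hq⟩

/-- Induction on the word of the path in lexicographic order: an unsorted path has a vertical step
directly before a horizontal one, and interchanging them changes the coefficient only by a sign and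
makes the word smaller. -/
theorem coeff_eq_zero_of_awLin {u : (normChains K T.X).X n}
    (hu : u ∈ omegaSubmodule (normChains K T.X) (T.chainSubmodule K) n)
    (haw : awLin K B.fst B.snd n u = 0) {z : T.X _⦋n⦌} (hz : z ∈ T.Y n)
    (hd : z ∈ T.X.nonDegenerate n) : coeff K z u = 0 := by
  induction hw : B.word z using WellFoundedLT.induction generalizing z with
  | ind w ih =>
    by_cases h : ∀ i j : Fin n, (j : ℕ) = i + 1 → edge (B.p z) i ∈ S.X.degenerate 1 →
      edge (B.q z) j ∉ S'.X.degenerate 1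
    · obtain ⟨p, q, hpq, h1, h2⟩ := B.exists_sorted hz h
      exact B.coeff_eq_zero_of_sorted hd hpq h1 h2 (mem_omegaSubmodule.1 hu).1 haw
    · push Not at h
      obtain ⟨i, j, hij, hp, hq⟩ := h
      rcases n with _ | n
      · exact i.elim0
      · obtain ⟨k, rfl⟩ : ∃ k : Fin n, i = k.castSucc := ⟨⟨i, by omega⟩, rfl⟩
        obtain rfl : j = k.succ := Fin.ext (by simpa using hij)
        have h1 := ih _ (hw ▸ B.word_swap_lt hd hp hq) (B.swap_mem hz hp hq)
          (B.swap_nonDegenerate hd hp hq) rfl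
        have h2 := B.coeff_add_coeff_swap hd hp hq hu
        rwa [h1, add_zero] at h2

/-- The Alexander–Whitney map is injective on `Ω`. -/
theorem eq_zero_of_awLin {u : (normChains K T.X).X n}
    (hu : u ∈ omegaSubmodule (normChains K T.X) (T.chainSubmodule K) n)
    (haw : awLin K B.fst B.snd n u = 0) : u = 0 := by
  refine eq_zero_of_coeff fun z hd => ?_
  by_cases hz : z ∈ T.Y n
  · exact B.coeff_eq_zero_of_awLin hu haw hz hd
  · exact T.coeff_eq_zero (mem_omegaSubmodule.1 hu).1 hd hz

/-! ### The Alexander–Whitney map on `Ω` -/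

theorem comp_awLin_mem_tens {i j : ℕ} (h : i + j = n) {u : (normChains K T.X).X n}
    (hu : u ∈ T.chainSubmodule K n) :
    comp (normChains K S.X) (normChains K S'.X) i j n (awLin K B.fst B.snd n u) ∈
      tens (S.chainSubmodule K i) (S'.chainSubmodule K j) := by
  refine T.chainSubmodule_le (N := (tens (S.chainSubmodule K i) (S'.chainSubmodule K j)).comap
    (comp (normChains K S.X) (normChains K S'.X) i j n ∘ₗ awLin K B.fst B.snd n))
    (fun z hz _ => ?_) hu
  change comp (normChains K S.X) (normChains K S'.X) i j n
    (awLin K B.fst B.snd n (cl K T.X z)) ∈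
    tens (S.chainSubmodule K i) (S'.chainSubmodule K j)
  rw [comp_awLin_cl K B.fst B.snd h]
  refine tmul_mem_tens (S.cl_mem ?_) (S'.cl_mem ?_)
  · have hp := B.p_mem hz
    exact (QuiverLike.mem_iff _).2 ⟨fun a => by rw [vtx_act]; exact PathPair.vtx_mem hp _,
      fun a => by rw [edge_act_frontHom]; exact PathPair.edge_mem hp _⟩
  · have hq := B.q_mem hz
    exact (QuiverLike.mem_iff _).2 ⟨fun a => by rw [vtx_act]; exact PathPair.vtx_mem hq _,
      fun a => by rw [edge_act_backHom]; exact PathPair.edge_mem hq _⟩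

variable [IsDomain K] [IsPrincipalIdealRing K]

theorem awLin_mem_range {u : (normChains K T.X).X n}
    (hu : u ∈ omegaSubmodule (normChains K T.X) (T.chainSubmodule K) n) :
    awLin K B.fst B.snd n u ∈ LinearMap.range ((tensorι K S S').f n).hom := by
  rw [mem_omegaSubmodule] at hu
  refine mem_range_tensorι_of_d S S' (fun i j h => B.comp_awLin_mem_tens h hu.1) ?_
  intro m i j h hm
  have h1 : ((normChains K S.X ⊗ normChains K S'.X : ChainComplex (ModuleCat.{u} K) ℕ).d n m).hom
      (awLin K B.fst B.snd n u) = awLin K B.fst B.snd m (((normChains K T.X).d n m).hom u) :=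
    hom_comm_apply (awMap K B.fst B.snd) n m u
  rw [h1]
  exact B.comp_awLin_mem_tens h (hu.2 m)

variable (K) in
/-- The Alexander–Whitney map on `Ω` in degree `n`. -/
def awOmegaLin (n : ℕ) : (T.Omega K).X n →ₗ[K]
    (S.Omega K ⊗ S'.Omega K : ChainComplex (ModuleCat.{u} K) ℕ).X n :=
  (LinearEquiv.ofInjective ((tensorι K S S').f n).hom
    (tensorι_injective S S' n)).symm.toLinearMap ∘ₗ
    LinearMap.codRestrict _ (awLin K B.fst B.snd n ∘ₗ ((T.ι K).f n).hom)
      (fun u => B.awLin_mem_range u.2)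

theorem tensorι_awOmegaLin (u : (T.Omega K).X n) :
    ((tensorι K S S').f n).hom (B.awOmegaLin K n u) =
      awLin K B.fst B.snd n (((T.ι K).f n).hom u) :=
  congrArg Subtype.val ((LinearEquiv.ofInjective ((tensorι K S S').f n).hom
    (tensorι_injective S S' n)).apply_symm_apply ⟨_, B.awLin_mem_range u.2⟩)

variable (K) in
/-- The Alexander–Whitney map on `Ω`. -/
def awOmega : T.Omega K ⟶ S.Omega K ⊗ S'.Omega K where
  f n := ModuleCat.ofHom (B.awOmegaLin K n)
  comm' i j _ := by
    refine ModuleCat.hom_ext (LinearMap.ext fun u => tensorι_injective S S' j ?_)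
    refine (hom_comm_apply (tensorι K S S') i j (B.awOmegaLin K i u)).symm.trans ?_
    rw [B.tensorι_awOmegaLin]
    refine (hom_comm_apply (awMap K B.fst B.snd) i j (((T.ι K).f i).hom u)).trans ?_
    refine Eq.trans ?_ (B.tensorι_awOmegaLin (((T.Omega K).d i j).hom u)).symm
    exact congrArg (awLin K B.fst B.snd j) (hom_comm_apply (T.ι K) i j u)

theorem awOmegaLin_injective : Function.Injective (B.awOmegaLin K n) := by
  refine (injective_iff_map_eq_zero _).2 fun u hu => Subtype.ext ?_
  refine B.eq_zero_of_awLin u.2 ?_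
  refine (B.tensorι_awOmegaLin u).symm.trans ?_
  rw [hu, map_zero]

end IsBox

/-! ### Shuffles -/

instance (m n : ℕ) : Fintype (Fin m →o Fin n) :=
  Fintype.ofInjective (fun f => (f : Fin m → Fin n)) DFunLike.coe_injective

/-- The maps `f`, `g` are the components of a maximal chain in `{0, …, p} × {0, …, q}`. -/
def IsShuffle {p q n : ℕ} (f : Fin (n + 1) →o Fin (p + 1)) (g : Fin (n + 1) →o Fin (q + 1)) :
    Prop :=
  p + q = n ∧ ∀ k, (f k : ℕ) + g k = k

namespace IsShuffle

variable {p q n : ℕ} {f : Fin (n + 1) →o Fin (p + 1)} {g : Fin (n + 1) →o Fin (q + 1)}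

theorem symm (h : IsShuffle f g) : IsShuffle g f :=
  ⟨(add_comm _ _).trans h.1, fun k => (add_comm _ _).trans (h.2 k)⟩

theorem step (h : IsShuffle f g) (k : Fin n) :
    ((f k.succ : ℕ) = f k.castSucc + 1 ∧ (g k.succ : ℕ) = g k.castSucc) ∨
      ((f k.succ : ℕ) = f k.castSucc ∧ (g k.succ : ℕ) = g k.castSucc + 1) := by
  have h1 := h.2 k.succ
  have h2 := h.2 k.castSucc
  have h3 : (f k.castSucc : ℕ) ≤ f k.succ := f.monotone k.castSucc_le_succ
  have h4 : (g k.castSucc : ℕ) ≤ g k.succ := g.monotone k.castSucc_le_succ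
  simp only [Fin.val_succ, Fin.val_castSucc] at h1 h2
  omega

/-- Discrete intermediate values: `f` runs from `0` to `p` in steps of at most one, so it passes
from `i` to `i + 1` somewhere, and `g` stands still at that step. -/
theorem exists_step (h : IsShuffle f g) (i : Fin p) :
    ∃ k : Fin n, (f k.castSucc : ℕ) = i ∧ (f k.succ : ℕ) = i + 1 ∧ g k.castSucc = g k.succ := by
  have hl : (f (Fin.last n) : ℕ) = p := by
    have h1 := h.2 (Fin.last n)
    have h2 := h.1
    rw [Fin.val_last] at h1
    omega
  have h0 : (f 0 : ℕ) = 0 := by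
    have h1 := h.2 0
    rw [Fin.val_zero] at h1
    omega
  by_contra! hc
  have key : ∀ k : ℕ, ∀ hk : k < n + 1, (f ⟨k, hk⟩ : ℕ) ≤ i := by
    intro k
    induction k with
    | zero => intro hk; change (f 0 : ℕ) ≤ i; omega
    | succ k ih =>
      intro hk
      have h1 := ih (by omega)
      have h2 := h.step ⟨k, by omega⟩
      have h3 := hc ⟨k, by omega⟩
      change (f ⟨k, _⟩ : ℕ) = i → (f ⟨k + 1, _⟩ : ℕ) = i + 1 → g ⟨k, _⟩ ≠ g ⟨k + 1, _⟩ at h3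
      change ((f ⟨k + 1, _⟩ : ℕ) = f ⟨k, _⟩ + 1 ∧ (g ⟨k + 1, _⟩ : ℕ) = g ⟨k, _⟩) ∨
        ((f ⟨k + 1, _⟩ : ℕ) = f ⟨k, _⟩ ∧ (g ⟨k + 1, _⟩ : ℕ) = g ⟨k, _⟩ + 1) at h2
      rcases h2 with ⟨h2, h4⟩ | ⟨h2, h4⟩
      · by_contra hlt
        exact h3 (by omega) (by omega) (Fin.ext h4.symm)
      · omega
  have := key n (by omega)
  change (f (Fin.last n) : ℕ) ≤ i at this
  omega

theorem minHom_subHom (h : p + q = n) : IsShuffle (minHom p n) (subHom h) :=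
  ⟨h, fun k => by rw [minHom_val, subHom_val]; omega⟩

theorem eq_of_front (h : IsShuffle f g) (hf : ∀ k : Fin n, (k : ℕ) < p → f k.castSucc ≠ f k.succ) :
    f = minHom p n ∧ g = subHom h.1 := by
  have key : ∀ k : ℕ, ∀ hk : k < n + 1, k ≤ p → (f ⟨k, hk⟩ : ℕ) = k := by
    intro k
    induction k with
    | zero =>
      intro hk _
      have h1 := h.2 0
      rw [Fin.val_zero] at h1
      change (f 0 : ℕ) = 0
      omega
    | succ k ih =>
      intro hk hkp
      have h1 := ih (by omega) (by omega)
      rcases h.step ⟨k, by omega⟩ with ⟨h2, _⟩ | ⟨h2, _⟩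
      · change (f ⟨k + 1, _⟩ : ℕ) = f ⟨k, _⟩ + 1 at h2
        omega
      · exact absurd (Fin.ext h2.symm) (hf ⟨k, by omega⟩ (by simpa using hkp))
  have hval : ∀ k, (f k : ℕ) = min (k : ℕ) p := by
    intro k
    rcases le_total (k : ℕ) p with hk | hk
    · rw [key k k.2 hk, min_eq_left hk]
    · have h1 := key p (by have := h.1; omega) le_rfl
      have h2 : (f ⟨p, by have := h.1; omega⟩ : ℕ) ≤ f k :=
        f.monotone (show (⟨p, _⟩ : Fin (n + 1)) ≤ k from hk)
      rw [min_eq_right hk]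
      omega
  constructor
  · exact OrderHom.ext _ _ (funext fun k => Fin.ext (by rw [hval, minHom_val]))
  · refine OrderHom.ext _ _ (funext fun k => Fin.ext ?_)
    have h1 := h.2 k
    rw [hval] at h1
    rw [subHom_val]
    omega

/-- A face of a shuffle between two steps of the same type is a face of one of the factors. -/
theorem exists_face {p q m : ℕ} {f : Fin (m + 2) →o Fin (p + 2)} {g : Fin (m + 2) →o Fin (q + 1)}
    (h : IsShuffle f g) (k : Fin m)
    (h1 : (f k.succ.castSucc : ℕ) = f k.castSucc.castSucc + 1)
    (h2 : (f k.succ.succ : ℕ) = f k.succ.castSucc + 1) :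
    ∃ f' : Fin (m + 1) →o Fin (p + 1), IsShuffle f' (g.comp (dHom k.succ.castSucc)) ∧
      f.comp (dHom k.succ.castSucc) = (dHom (f k.succ.castSucc)).comp f' := by
  have hlo : ∀ l : Fin (m + 1), (l : ℕ) ≤ k → (dHom k.succ.castSucc l : ℕ) = l ∧
      (f (dHom k.succ.castSucc l) : ℕ) < f k.succ.castSucc := by
    intro l hl
    have h3 : (dHom k.succ.castSucc l : ℕ) = l := by rw [dHom_val]; simp; omega
    have h4 : (f (dHom k.succ.castSucc l) : ℕ) ≤ f k.castSucc.castSucc := by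
      refine f.monotone (show ((dHom k.succ.castSucc l : Fin (m + 2)) : ℕ) ≤ _ from ?_)
      rw [h3]; exact hl
    exact ⟨h3, by omega⟩
  have hhi : ∀ l : Fin (m + 1), ¬ (l : ℕ) ≤ k → (dHom k.succ.castSucc l : ℕ) = l + 1 ∧
      (f k.succ.castSucc : ℕ) < f (dHom k.succ.castSucc l) := by
    intro l hl
    have h3 : (dHom k.succ.castSucc l : ℕ) = l + 1 := by rw [dHom_val]; simp; omega
    have h4 : (f k.succ.succ : ℕ) ≤ f (dHom k.succ.castSucc l) := by
      refine f.monotone (show _ ≤ ((dHom k.succ.castSucc l : Fin (m + 2)) : ℕ) from ?_)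
      rw [h3]; simp; omega
    exact ⟨h3, by omega⟩
  -- `f` skips its value at `k + 1` once that vertex is omitted, so the larger values are lowered by
  -- one.
  refine ⟨⟨fun l => ⟨if (l : ℕ) ≤ k then f (dHom k.succ.castSucc l)
    else f (dHom k.succ.castSucc l) - 1, ?_⟩, ?_⟩, ⟨?_, fun l => ?_⟩, ?_⟩
  · have h3 := (f (dHom k.succ.castSucc l)).2
    have h4 := (f k.succ.succ).2
    split_ifs with hl
    · have := (hlo l hl).2; omega
    · omega
  · intro l l' hll
    have h3 : (f (dHom k.succ.castSucc l) : ℕ) ≤ f (dHom k.succ.castSucc l') :=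
      f.monotone ((dHom k.succ.castSucc).monotone hll)
    have h4 : (l : ℕ) ≤ l' := hll
    change (if (l : ℕ) ≤ k then (f (dHom k.succ.castSucc l) : ℕ)
      else f (dHom k.succ.castSucc l) - 1) ≤ (if (l' : ℕ) ≤ k then
        (f (dHom k.succ.castSucc l') : ℕ) else f (dHom k.succ.castSucc l') - 1)
    split_ifs with hl hl'
    · exact h3
    · have := (hlo l hl).2
      have := (hhi l' hl').2
      omega
    · omega
    · omega
  · have := h.1; omega
  · change (if (l : ℕ) ≤ k then (f (dHom k.succ.castSucc l) : ℕ)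
      else f (dHom k.succ.castSucc l) - 1) + (g (dHom k.succ.castSucc l) : ℕ) = l
    have h3 := h.2 (dHom k.succ.castSucc l)
    split_ifs with hl
    · have := (hlo l hl).1; omega
    · have := hhi l hl; omega
  · refine OrderHom.ext _ _ (funext fun l => Fin.ext ?_)
    change (f (dHom k.succ.castSucc l) : ℕ) = (dHom (f k.succ.castSucc) ⟨if (l : ℕ) ≤ k then
      (f (dHom k.succ.castSucc l) : ℕ) else f (dHom k.succ.castSucc l) - 1, _⟩ : ℕ)
    rw [dHom_val]
    by_cases hl : (l : ℕ) ≤ k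
    · simp only [if_pos hl, if_pos (hlo l hl).2]
    · have := (hhi l hl).2
      simp only [if_neg hl]
      rw [if_neg (by omega)]
      omega

end IsShuffle

/-- The monotone map obtained from `f` by reflecting the value at an inner point between the
neighbouring values. -/
def flipHom {m p : ℕ} (k : Fin m) (f : Fin (m + 2) →o Fin (p + 1)) : Fin (m + 2) →o Fin (p + 1) where
  toFun l := if l = k.succ.castSucc then
    ⟨f k.castSucc.castSucc + f k.succ.succ - f k.succ.castSucc, by
      have h1 : (f k.castSucc.castSucc : ℕ) ≤ f k.succ.castSucc :=
        f.monotone (show (k : ℕ) ≤ k + 1 from Nat.le_succ _)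
      omega⟩ else f l
  monotone' := by
    have h1 : (f k.castSucc.castSucc : ℕ) ≤ f k.succ.castSucc :=
      f.monotone (show (k : ℕ) ≤ k + 1 from Nat.le_succ _)
    have h2 : (f k.succ.castSucc : ℕ) ≤ f k.succ.succ :=
      f.monotone (show (k : ℕ) + 1 ≤ k + 1 + 1 from Nat.le_succ _)
    intro l l' hll
    have hll' : (l : ℕ) ≤ l' := hll
    dsimp only
    split_ifs with h3 h4 h4
    · exact le_rfl
    · have h5 : (l : ℕ) = k + 1 := by rw [h3]; simp
      have h6 : (l' : ℕ) ≠ k + 1 := fun h => h4 (Fin.ext (by simpa using h))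
      have h7 : (f k.succ.succ : ℕ) ≤ f l' :=
        f.monotone (show (k : ℕ) + 1 + 1 ≤ l' by omega)
      change (f k.castSucc.castSucc + f k.succ.succ - f k.succ.castSucc : ℕ) ≤ f l'
      omega
    · have h5 : (l' : ℕ) = k + 1 := by rw [h4]; simp
      have h6 : (l : ℕ) ≠ k + 1 := fun h => h3 (Fin.ext (by simpa using h))
      have h7 : (f l : ℕ) ≤ f k.castSucc.castSucc :=
        f.monotone (show (l : ℕ) ≤ k by omega)
      change (f l : ℕ) ≤ (f k.castSucc.castSucc + f k.succ.succ - f k.succ.castSucc : ℕ)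
      omega
    · exact f.monotone hll

section flipHom

variable {m p : ℕ} (k : Fin m) (f : Fin (m + 2) →o Fin (p + 1))

theorem flipHom_self : (flipHom k f k.succ.castSucc : ℕ) =
    f k.castSucc.castSucc + f k.succ.succ - f k.succ.castSucc :=
  congrArg Fin.val (if_pos rfl)

theorem flipHom_of_ne {l : Fin (m + 2)} (hl : l ≠ k.succ.castSucc) : flipHom k f l = f l :=
  if_neg hl

theorem flipHom_comp_dHom :
    (flipHom k f).comp (dHom k.succ.castSucc) = f.comp (dHom k.succ.castSucc) :=
  OrderHom.ext _ _ (funext fun _ => flipHom_of_ne k f (Fin.succAbove_ne _ _))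

theorem flipHom_flipHom : flipHom k (flipHom k f) = f := by
  refine OrderHom.ext _ _ (funext fun l => ?_)
  by_cases hl : l = k.succ.castSucc
  · have h1 : (f k.castSucc.castSucc : ℕ) ≤ f k.succ.castSucc :=
      f.monotone (show (k : ℕ) ≤ k + 1 from Nat.le_succ _)
    have h2 : (f k.succ.castSucc : ℕ) ≤ f k.succ.succ :=
      f.monotone (show (k : ℕ) + 1 ≤ k + 1 + 1 from Nat.le_succ _)
    subst hl
    apply Fin.ext
    rw [flipHom_self, flipHom_self, flipHom_of_ne k f (Fin.ne_of_val_ne (by simp)),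
      flipHom_of_ne k f (Fin.ne_of_val_ne (by simp))]
    omega
  · rw [flipHom_of_ne _ _ hl, flipHom_of_ne _ _ hl]

theorem IsShuffle.flip {q : ℕ} {f : Fin (m + 2) →o Fin (p + 1)} {g : Fin (m + 2) →o Fin (q + 1)}
    (h : IsShuffle f g) : IsShuffle (flipHom k f) (flipHom k g) := by
  refine ⟨h.1, fun l => ?_⟩
  by_cases hl : l = k.succ.castSucc
  · subst hl
    have h1 := h.2 k.castSucc.castSucc
    have h2 := h.2 k.succ.castSucc
    have h3 := h.2 k.succ.succ
    have h4 := h.step k.castSucc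
    have h5 := h.step k.succ
    rw [Fin.succ_castSucc] at h4
    rw [flipHom_self, flipHom_self]
    simp only [Fin.val_castSucc, Fin.val_succ] at *
    omega
  · rw [flipHom_of_ne _ _ hl, flipHom_of_ne _ _ hl, h.2]

/-- The sign of a shuffle. -/
def shuffleSign (K : Type*) [CommRing K] {p n : ℕ} (f : Fin (n + 1) →o Fin (p + 1)) : K :=
  (-1) ^ ∑ l, (f l : ℕ)

theorem shuffleSign_mul_self (K : Type*) [CommRing K] {p n : ℕ} (f : Fin (n + 1) →o Fin (p + 1)) :
    shuffleSign K f * shuffleSign K f = 1 := by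
  rw [shuffleSign, ← mul_pow, neg_mul_neg, one_mul, one_pow]

/-- When the two steps differ in type, the flip changes exactly one value of `f`, and by one, so the
parity of the exponent changes. -/
theorem shuffleSign_flipHom (K : Type*) [CommRing K]
    (h : ((f k.succ.castSucc : ℕ) = f k.castSucc.castSucc ∧
        (f k.succ.succ : ℕ) = f k.succ.castSucc + 1) ∨
      ((f k.succ.castSucc : ℕ) = f k.castSucc.castSucc + 1 ∧
        (f k.succ.succ : ℕ) = f k.succ.castSucc)) :
    shuffleSign K (flipHom k f) = - shuffleSign K f := by
  rw [shuffleSign, shuffleSign, ← Finset.add_sum_erase _ _ (Finset.mem_univ k.succ.castSucc),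
    ← Finset.add_sum_erase _ (fun l => (f l : ℕ)) (Finset.mem_univ k.succ.castSucc),
    Finset.sum_congr rfl fun l hl => by rw [flipHom_of_ne k f (Finset.ne_of_mem_erase hl)],
    pow_add, pow_add, flipHom_self, ← neg_mul]
  congr 1
  rcases h with ⟨h1, h2⟩ | ⟨h1, h2⟩
  · rw [show (f k.castSucc.castSucc : ℕ) + f k.succ.succ - f k.succ.castSucc =
      f k.succ.castSucc + 1 by omega, pow_succ, mul_neg_one]
  · rw [show (f k.castSucc.castSucc : ℕ) + f k.succ.succ - f k.succ.castSucc =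
      f k.castSucc.castSucc by omega, h1, pow_succ, mul_neg_one, neg_neg]

end flipHom

/-! ### The shuffle product -/

namespace PathPair

variable {K : Type u} [CommRing K] (S : PathPair.{u}) {n : ℕ}
  {u : (normChains K S.X).X (n + 1)}

theorem face_zero_mem (hu : u ∈ S.chainSubmodule K (n + 1)) :
    face K S.X 0 u ∈ S.chainSubmodule K n := by
  refine S.chainSubmodule_le (N := (S.chainSubmodule K n).comap (face K S.X 0))
    (fun x hx hd => ?_) hu
  change face K S.X 0 (cl K S.X x) ∈ S.chainSubmodule K n
  rw [face_cl 0 hd]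
  exact S.cl_mem (S.δ_zero_mem n x hx)

theorem face_last_mem (hu : u ∈ S.chainSubmodule K (n + 1)) :
    face K S.X (Fin.last (n + 1)) u ∈ S.chainSubmodule K n := by
  refine S.chainSubmodule_le (N := (S.chainSubmodule K n).comap (face K S.X (Fin.last (n + 1))))
    (fun x hx hd => ?_) hu
  change face K S.X (Fin.last (n + 1)) (cl K S.X x) ∈ S.chainSubmodule K n
  rw [face_cl _ hd]
  exact S.cl_mem (S.δ_last_mem n x hx)

end PathPair

section

variable {X : SSet.{u}} {p q n : ℕ} {f : Fin (n + 1) →o Fin (p + 1)}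
  {g : Fin (n + 1) →o Fin (q + 1)}

theorem edge_act_of_eq (x : X _⦋p⦌) {k : Fin n} (h : (f k.succ : ℕ) = f k.castSucc) :
    edge (act f x) k ∈ X.degenerate 1 := by
  rw [edge_act]
  exact seg_mem_of_eq _ _ (Fin.ext h.symm)

theorem edge_act_of_succ (x : X _⦋p⦌) {k : Fin n} (h : (f k.succ : ℕ) = f k.castSucc + 1) :
    edge (act f x) k = edge x ⟨f k.castSucc, by omega⟩ := by
  rw [edge_act]
  exact seg_eq_edge x _ _ rfl h

end

namespace IsBox

variable {K : Type u} [CommRing K] {S S' T : PathPair.{u}} (B : IsBox S S' T)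

variable (K) in
/-- The summand of the shuffle product which belongs to one shuffle. -/
def ez {p q n : ℕ} (f : Fin (n + 1) →o Fin (p + 1)) (g : Fin (n + 1) →o Fin (q + 1)) :
    (normChains K S.X).X p →ₗ[K] (normChains K S'.X).X q →ₗ[K] (normChains K T.X).X n :=
  normDesc fun x => normDesc fun y => cl K T.X (B.pair (act f x) (act g y))

variable (K) in
/-- The shuffle product. -/
def shuffleProd (p q n : ℕ) :
    (normChains K S.X).X p →ₗ[K] (normChains K S'.X).X q →ₗ[K] (normChains K T.X).X n :=
  open Classical in
  ∑ t : (Fin (n + 1) →o Fin (p + 1)) × (Fin (n + 1) →o Fin (q + 1)) with IsShuffle t.1 t.2,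
    shuffleSign K t.1 • B.ez K t.1 t.2

open Classical in
theorem shuffleProd_apply (p q n : ℕ) (a : (normChains K S.X).X p) (b : (normChains K S'.X).X q) :
    B.shuffleProd K p q n a b =
      ∑ t : (Fin (n + 1) →o Fin (p + 1)) × (Fin (n + 1) →o Fin (q + 1)) with IsShuffle t.1 t.2,
        shuffleSign K t.1 • B.ez K t.1 t.2 a b := by
  rw [shuffleProd, LinearMap.sum_apply, LinearMap.sum_apply]
  rfl

variable {p q n : ℕ}

theorem bilin_ext {M : Type*} [AddCommGroup M] [Module K M]
    {F G : (normChains K S.X).X p →ₗ[K] (normChains K S'.X).X q →ₗ[K] M}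
    (h : ∀ x ∈ S.X.nonDegenerate p, ∀ y ∈ S'.X.nonDegenerate q,
      F (cl K S.X x) (cl K S'.X y) = G (cl K S.X x) (cl K S'.X y)) : F = G :=
  normChains_ext fun x hx => normChains_ext fun y hy => h x hx y hy

variable [QuiverLike T]

theorem pair_mem_degenerate_left {f : Fin (n + 1) →o Fin (p + 1)} {g : Fin (n + 1) →o Fin (q + 1)}
    (h : IsShuffle f g) {x : S.X _⦋p⦌} (hx : x ∈ S.X.degenerate p) (y : S'.X _⦋q⦌) :
    B.pair (act f x) (act g y) ∈ T.X.degenerate n := by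
  obtain ⟨i, hi⟩ := exists_edge_of_mem_degenerate hx
  obtain ⟨k, h1, h2, h3⟩ := h.exists_step i
  refine mem_degenerate_of_edge _ k ((B.mem_degenerate_one _).2 ⟨?_, ?_⟩)
  · rw [p_edge, p_pair, edge_act_of_succ x (by omega)]
    have : (⟨f k.castSucc, by omega⟩ : Fin p) = i := Fin.ext h1
    rw [this]; exact hi
  · rw [q_edge, q_pair]
    exact edge_act_of_eq y (congrArg Fin.val h3.symm)

theorem pair_mem_degenerate_right {f : Fin (n + 1) →o Fin (p + 1)} {g : Fin (n + 1) →o Fin (q + 1)}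
    (h : IsShuffle f g) (x : S.X _⦋p⦌) {y : S'.X _⦋q⦌} (hy : y ∈ S'.X.degenerate q) :
    B.pair (act f x) (act g y) ∈ T.X.degenerate n := by
  obtain ⟨i, hi⟩ := exists_edge_of_mem_degenerate hy
  obtain ⟨k, h1, h2, h3⟩ := h.symm.exists_step i
  refine mem_degenerate_of_edge _ k ((B.mem_degenerate_one _).2 ⟨?_, ?_⟩)
  · rw [p_edge, p_pair]
    exact edge_act_of_eq x (congrArg Fin.val h3.symm)
  · rw [q_edge, q_pair, edge_act_of_succ y (by omega)]
    have : (⟨g k.castSucc, by omega⟩ : Fin q) = i := Fin.ext h1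
    rw [this]; exact hi

/-- By construction the formula holds on nondegenerate simplices. For a shuffle it extends to all:
every edge of `x` and of `y` is traversed at some step where the other component rests, so a
degenerate argument yields a degenerate simplex. -/
theorem ez_cl {f : Fin (n + 1) →o Fin (p + 1)} {g : Fin (n + 1) →o Fin (q + 1)}
    (h : IsShuffle f g) (x : S.X _⦋p⦌) (y : S'.X _⦋q⦌) :
    B.ez K f g (cl K S.X x) (cl K S'.X y) = cl K T.X (B.pair (act f x) (act g y)) := by
  rw [ez, normDesc_cl]
  · exact normDesc_cl _ (fun y hy => cl_eq_zero K T.X (B.pair_mem_degenerate_right h x hy)) y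
  · intro x hx
    refine normChains_ext fun y _ => ?_
    rw [normDesc_cl _ fun y hy => cl_eq_zero K T.X (B.pair_mem_degenerate_right h x hy),
      cl_eq_zero K T.X (B.pair_mem_degenerate_left h hx y)]
    rfl

variable [QuiverLike S] [QuiverLike S']

theorem pair_nonDegenerate {f : Fin (n + 1) →o Fin (p + 1)} {g : Fin (n + 1) →o Fin (q + 1)}
    (h : IsShuffle f g) {x : S.X _⦋p⦌} (hx : x ∈ S.X.nonDegenerate p) {y : S'.X _⦋q⦌}
    (hy : y ∈ S'.X.nonDegenerate q) : B.pair (act f x) (act g y) ∈ T.X.nonDegenerate n := by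
  rw [mem_nonDegenerate_iff_edges] at hx hy
  rw [B.nonDegenerate_iff]
  rintro k ⟨h1, h2⟩
  rw [p_pair] at h1
  rw [q_pair] at h2
  rcases h.step k with ⟨h3, _⟩ | ⟨_, h3⟩
  · rw [edge_act_of_succ x h3] at h1; exact hx _ h1
  · rw [edge_act_of_succ y h3] at h2; exact hy _ h2

theorem pair_mem {f : Fin (n + 1) →o Fin (p + 1)} {g : Fin (n + 1) →o Fin (q + 1)}
    (h : IsShuffle f g) {x : S.X _⦋p⦌} (hx : x ∈ S.Y p) {y : S'.X _⦋q⦌} (hy : y ∈ S'.Y q) :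
    B.pair (act f x) (act g y) ∈ T.Y n := by
  refine B.mem_of_edges (fun a => ?_) (fun a => ?_) fun k => ?_
  · rw [p_pair, vtx_act]; exact PathPair.vtx_mem hx _
  · rw [q_pair, vtx_act]; exact PathPair.vtx_mem hy _
  · rw [p_pair, q_pair]
    rcases h.step k with ⟨h1, h2⟩ | ⟨h1, h2⟩
    · rw [edge_act_of_succ x h1]
      exact Or.inl ⟨PathPair.edge_mem hx _, edge_act_of_eq y h2⟩
    · rw [edge_act_of_succ y h2]
      exact Or.inr ⟨edge_act_of_eq x h1, PathPair.edge_mem hy _⟩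

theorem ez_mem {f : Fin (n + 1) →o Fin (p + 1)} {g : Fin (n + 1) →o Fin (q + 1)}
    (h : IsShuffle f g) {a : (normChains K S.X).X p} (ha : a ∈ S.chainSubmodule K p)
    {b : (normChains K S'.X).X q} (hb : b ∈ S'.chainSubmodule K q) :
    B.ez K f g a b ∈ T.chainSubmodule K n := by
  refine S.chainSubmodule_le (N := (T.chainSubmodule K n).comap ((B.ez K f g).flip b))
    (fun x hx _ => ?_) ha
  refine S'.chainSubmodule_le (N := (T.chainSubmodule K n).comap (B.ez K f g (cl K S.X x)))
    (fun y hy _ => ?_) hb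
  change B.ez K f g (cl K S.X x) (cl K S'.X y) ∈ T.chainSubmodule K n
  rw [B.ez_cl h]
  exact T.cl_mem (B.pair_mem h hx hy)

theorem face_ez_cl {f : Fin (n + 2) →o Fin (p + 1)} {g : Fin (n + 2) →o Fin (q + 1)}
    (h : IsShuffle f g) (i : Fin (n + 2)) {x : S.X _⦋p⦌} (hx : x ∈ S.X.nonDegenerate p)
    {y : S'.X _⦋q⦌} (hy : y ∈ S'.X.nonDegenerate q) :
    face K T.X i (B.ez K f g (cl K S.X x) (cl K S'.X y)) =
      cl K T.X (B.pair (act (f.comp (dHom i)) x) (act (g.comp (dHom i)) y)) := by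
  rw [B.ez_cl h, face_cl i (B.pair_nonDegenerate h hx hy), δ_eq_act, B.act_pair, act_act, act_act]

theorem face_ez_congr {f f' : Fin (n + 2) →o Fin (p + 1)} {g g' : Fin (n + 2) →o Fin (q + 1)}
    (h : IsShuffle f g) (h' : IsShuffle f' g') (i : Fin (n + 2))
    (hf : f.comp (dHom i) = f'.comp (dHom i)) (hg : g.comp (dHom i) = g'.comp (dHom i))
    (a : (normChains K S.X).X p) (b : (normChains K S'.X).X q) :
    face K T.X i (B.ez K f g a b) = face K T.X i (B.ez K f' g' a b) := by
  have key : (B.ez K f g).compr₂ (face K T.X i) = (B.ez K f' g').compr₂ (face K T.X i) :=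
    bilin_ext fun x hx y hy => by
      rw [LinearMap.compr₂_apply, LinearMap.compr₂_apply, B.face_ez_cl h i hx hy,
        B.face_ez_cl h' i hx hy, hf, hg]
  exact LinearMap.congr_fun (LinearMap.congr_fun key a) b

theorem face_ez_left {f : Fin (n + 2) →o Fin (p + 2)} {g : Fin (n + 2) →o Fin (q + 1)}
    (h : IsShuffle f g) (i : Fin (n + 2)) (j : Fin (p + 2)) {f' : Fin (n + 1) →o Fin (p + 1)}
    (h' : IsShuffle f' (g.comp (dHom i))) (hf : f.comp (dHom i) = (dHom j).comp f')
    (a : (normChains K S.X).X (p + 1)) (b : (normChains K S'.X).X q) :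
    face K T.X i (B.ez K f g a b) = B.ez K f' (g.comp (dHom i)) (face K S.X j a) b := by
  have key : (B.ez K f g).compr₂ (face K T.X i) =
      (B.ez K f' (g.comp (dHom i))).comp (face K S.X j) :=
    bilin_ext fun x hx y hy => by
      rw [LinearMap.compr₂_apply, B.face_ez_cl h i hx hy, LinearMap.comp_apply, face_cl j hx,
        B.ez_cl h', δ_eq_act, act_act, hf]
  exact LinearMap.congr_fun (LinearMap.congr_fun key a) b

theorem face_ez_right {f : Fin (n + 2) →o Fin (p + 1)} {g : Fin (n + 2) →o Fin (q + 2)}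
    (h : IsShuffle f g) (i : Fin (n + 2)) (j : Fin (q + 2)) {g' : Fin (n + 1) →o Fin (q + 1)}
    (h' : IsShuffle (f.comp (dHom i)) g') (hg : g.comp (dHom i) = (dHom j).comp g')
    (a : (normChains K S.X).X p) (b : (normChains K S'.X).X (q + 1)) :
    face K T.X i (B.ez K f g a b) = B.ez K (f.comp (dHom i)) g' a (face K S'.X j b) := by
  have key : (B.ez K f g).compr₂ (face K T.X i) =
      (B.ez K (f.comp (dHom i)) g').compl₂ (face K S'.X j) :=
    bilin_ext fun x hx y hy => by
      rw [LinearMap.compr₂_apply, B.face_ez_cl h i hx hy, LinearMap.compl₂_apply, face_cl j hy,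
        B.ez_cl h', δ_eq_act, act_act, hg]
  exact LinearMap.congr_fun (LinearMap.congr_fun key a) b

theorem face_ez_mem {f : Fin (n + 2) →o Fin (p + 1)} {g : Fin (n + 2) →o Fin (q + 1)}
    (h : IsShuffle f g) (k : Fin n) (hk : flipHom k f = f)
    {a : (normChains K S.X).X p} {b : (normChains K S'.X).X q}
    (ha : a ∈ omegaSubmodule (normChains K S.X) (S.chainSubmodule K) p)
    (hb : b ∈ omegaSubmodule (normChains K S'.X) (S'.chainSubmodule K) q) :
    face K T.X k.succ.castSucc (B.ez K f g a b) ∈ T.chainSubmodule K n := by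
  have h1 := h.step k.castSucc
  have h2 := h.step k.succ
  rw [Fin.succ_castSucc] at h1
  have h3 := flipHom_self k f
  rw [hk] at h3
  -- Invariance under the flip says that the value at `k + 1` is the midpoint of its neighbours, so
  -- the two steps have the same type.
  have h4 : ((f k.succ.castSucc : ℕ) = f k.castSucc.castSucc + 1 ∧
      (f k.succ.succ : ℕ) = f k.succ.castSucc + 1) ∨
      ((g k.succ.castSucc : ℕ) = g k.castSucc.castSucc + 1 ∧
        (g k.succ.succ : ℕ) = g k.succ.castSucc + 1) := by omega
  rcases h4 with h4 | h4
  · rcases p with _ | p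
    · have := (f k.succ.succ).2; omega
    · obtain ⟨f', h5, h6⟩ := h.exists_face k h4.1 h4.2
      rw [B.face_ez_left h _ _ h5 h6]
      exact B.ez_mem h5 (S.face_mem ha _) (mem_omegaSubmodule.1 hb).1
  · rcases q with _ | q
    · have := (g k.succ.succ).2; omega
    · obtain ⟨g', h5, h6⟩ := h.symm.exists_face k h4.1 h4.2
      rw [B.face_ez_right h _ _ h5.symm h6]
      exact B.ez_mem h5.symm (mem_omegaSubmodule.1 ha).1 (S'.face_mem hb _)

theorem shuffleProd_mem {a : (normChains K S.X).X p} {b : (normChains K S'.X).X q}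
    (ha : a ∈ S.chainSubmodule K p) (hb : b ∈ S'.chainSubmodule K q) :
    B.shuffleProd K p q n a b ∈ T.chainSubmodule K n := by
  classical
  rw [shuffleProd_apply]
  exact Submodule.sum_mem _ fun t ht =>
    Submodule.smul_mem _ _ (B.ez_mem (Finset.mem_filter.1 ht).2 ha hb)

/-- Shuffles fixed by the flip at `k` give a face of `a` or of `b`, which is a chain of paths
because `a` and `b` lie in `Ω`. The other shuffles come in pairs with equal inner face and opposite
sign. -/
theorem face_shuffleProd_mem (k : Fin n)
    {a : (normChains K S.X).X p} {b : (normChains K S'.X).X q}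
    (ha : a ∈ omegaSubmodule (normChains K S.X) (S.chainSubmodule K) p)
    (hb : b ∈ omegaSubmodule (normChains K S'.X) (S'.chainSubmodule K) q) :
    face K T.X k.succ.castSucc (B.shuffleProd K p q (n + 1) a b) ∈ T.chainSubmodule K n := by
  classical
  rw [shuffleProd_apply, map_sum,
    ← Finset.sum_filter_add_sum_filter_not _ (fun t => flipHom k t.1 = t.1)]
  refine add_mem (Submodule.sum_mem _ fun t ht => ?_) ?_
  · rw [Finset.mem_filter, Finset.mem_filter] at ht
    rw [map_smul]
    exact Submodule.smul_mem _ _ (B.face_ez_mem ht.1.2 k ht.2 ha hb)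
  · convert zero_mem (T.chainSubmodule K n)
    refine Finset.sum_involution (fun t _ => (flipHom k t.1, flipHom k t.2)) (fun t ht => ?_)
      (fun t ht _ h => ?_) (fun t ht => ?_) (fun t ht => ?_)
    · rw [Finset.mem_filter, Finset.mem_filter] at ht
      have h1 := ht.1.2.step k.castSucc
      have h2 := ht.1.2.step k.succ
      rw [Fin.succ_castSucc] at h1
      have h3 : ¬ (t.1 k.succ.castSucc : ℕ) =
          t.1 k.castSucc.castSucc + t.1 k.succ.succ - t.1 k.succ.castSucc := by
        intro h
        refine ht.2 (OrderHom.ext _ _ (funext fun l => ?_))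
        by_cases hl : l = k.succ.castSucc
        · subst hl
          exact Fin.ext ((flipHom_self k t.1).trans h.symm)
        · exact flipHom_of_ne k t.1 hl
      rw [map_smul, map_smul, shuffleSign_flipHom k t.1 K (by omega),
        B.face_ez_congr (ht.1.2.flip k) ht.1.2 _ (flipHom_comp_dHom k t.1)
          (flipHom_comp_dHom k t.2), neg_smul, add_neg_cancel]
    · rw [Finset.mem_filter] at ht
      exact ht.2 (congrArg Prod.fst h)
    · rw [Finset.mem_filter, Finset.mem_filter] at ht ⊢
      refine ⟨⟨Finset.mem_univ _, ht.1.2.flip k⟩, fun h => ht.2 ?_⟩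
      rw [flipHom_flipHom] at h
      exact h.symm
    · rw [flipHom_flipHom, flipHom_flipHom]

/-- The shuffle product of chains in `Ω` is a chain in `Ω`. -/
theorem shuffleProd_mem_omega {a : (normChains K S.X).X p} {b : (normChains K S'.X).X q}
    (ha : a ∈ omegaSubmodule (normChains K S.X) (S.chainSubmodule K) p)
    (hb : b ∈ omegaSubmodule (normChains K S'.X) (S'.chainSubmodule K) q) :
    B.shuffleProd K p q n a b ∈ omegaSubmodule (normChains K T.X) (T.chainSubmodule K) n := by
  have h0 := B.shuffleProd_mem (n := n) (mem_omegaSubmodule.1 ha).1 (mem_omegaSubmodule.1 hb).1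
  refine mem_omegaSubmodule.2 ⟨h0, fun m => ?_⟩
  by_cases hm : m + 1 = n
  · subst hm
    change ((normChains K T.X).d (m + 1) m).hom _ ∈ _
    rw [d_eq_sum_face]
    refine Submodule.sum_mem _ fun i _ => Submodule.smul_mem _ _ ?_
    -- The two outer faces only need that paths are closed under `d₀` and `dₙ`; inner faces use that
    -- `a` and `b` lie in `Ω`.
    induction i using Fin.lastCases with
    | last => exact T.face_last_mem h0
    | cast i =>
      induction i using Fin.cases with
      | zero => exact T.face_zero_mem h0
      | succ k => exact B.face_shuffleProd_mem k ha hb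
  · rw [HomologicalComplex.shape _ n m hm]
    exact zero_mem _

/-- A shuffle other than the one that completes the first factor before the second rests in the
first factor somewhere among its first `p` steps, which produces a degenerate edge. -/
theorem act_comp_frontHom_mem_degenerate {f : Fin (n + 1) →o Fin (p + 1)}
    {g : Fin (n + 1) →o Fin (q + 1)} (h : IsShuffle f g)
    (hne : (f, g) ≠ (minHom p n, subHom h.1)) (x : S.X _⦋p⦌) (hp : p ≤ n) :
    act (f.comp (frontHom hp)) x ∈ S.X.degenerate p := by
  have h1 : ∃ k : Fin n, (k : ℕ) < p ∧ f k.castSucc = f k.succ := by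
    by_contra! hc
    obtain ⟨h1, h2⟩ := h.eq_of_front hc
    exact hne (Prod.ext h1 h2)
  obtain ⟨k, hk, h1⟩ := h1
  exact mem_degenerate_of_edge _ ⟨k, hk⟩ (edge_act_of_eq x (congrArg Fin.val h1.symm))

theorem comp_awLin_ez {f : Fin (n + 1) →o Fin (p + 1)} {g : Fin (n + 1) →o Fin (q + 1)}
    (h : IsShuffle f g) {i j : ℕ} (hij : i + j = n) (x : S.X _⦋p⦌) (y : S'.X _⦋q⦌) :
    comp (normChains K S.X) (normChains K S'.X) i j n
      (awLin K B.fst B.snd n (B.ez K f g (cl K S.X x) (cl K S'.X y))) =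
      cl K S.X (act (f.comp (frontHom (by omega))) x) ⊗ₜ
        cl K S'.X (act (g.comp (backHom hij)) y) := by
  rw [B.ez_cl h, comp_awLin_cl K B.fst B.snd hij, ← act_act, ← act_act]
  exact congrArg₂ (fun a b => cl K S.X (act _ a) ⊗ₜ cl K S'.X (act _ b)) (B.p_pair _ _)
    (B.q_pair _ _)

theorem awLin_shuffleProd_cl (h : p + q = n) (x : S.X _⦋p⦌) (y : S'.X _⦋q⦌) :
    awLin K B.fst B.snd n (B.shuffleProd K p q n (cl K S.X x) (cl K S'.X y)) =
      shuffleSign K (minHom p n) •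
        tz (normChains K S.X) (normChains K S'.X) p q n (cl K S.X x ⊗ₜ cl K S'.X y) := by
  classical
  refine tensor_ext_comp fun i j hij => ?_
  rw [shuffleProd_apply, map_sum, map_sum, map_smul]
  by_cases hi : i = p ∧ j = q
  · obtain ⟨rfl, rfl⟩ := hi
    rw [Finset.sum_eq_single (minHom i n, subHom h), map_smul, map_smul,
      B.comp_awLin_ez (IsShuffle.minHom_subHom h) hij,
      comp_tz_self (normChains K S.X) (normChains K S'.X) h]
    · refine congrArg _ (congrArg₂ (fun a b => cl K S.X a ⊗ₜ cl K S'.X b)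
        ((act_congr (fun k => Fin.ext ?_) x).trans (act_id x))
        ((act_congr (fun k => Fin.ext ?_) y).trans (act_id y)))
      · change min (k : ℕ) i = k
        omega
      · change i + (k : ℕ) - i = k
        omega
    · intro t ht hne
      have ht' := (Finset.mem_filter.1 ht).2
      rw [map_smul, map_smul, B.comp_awLin_ez ht' hij,
        cl_eq_zero K S.X (act_comp_frontHom_mem_degenerate ht' hne x _), TensorProduct.zero_tmul,
        smul_zero]
    · intro hn
      refine absurd ?_ hn
      rw [Finset.mem_filter]
      exact ⟨Finset.mem_univ _, IsShuffle.minHom_subHom h⟩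
  · rw [comp_tz_of_ne (normChains K S.X) (normChains K S'.X) (fun h' => hi ⟨h'.1.symm, h'.2.symm⟩),
      smul_zero]
    refine Finset.sum_eq_zero fun t ht => ?_
    rw [map_smul, map_smul, B.comp_awLin_ez (Finset.mem_filter.1 ht).2 hij]
    -- In a different bidegree either `i > p` or `j > q`, and a simplex pulled back to a dimension
    -- larger than its own is degenerate.
    rcases Nat.lt_or_ge p i with hpi | hpi
    · rw [cl_eq_zero K S.X (act_mem_degenerate hpi _ x), TensorProduct.zero_tmul, smul_zero]
    · rw [cl_eq_zero K S'.X (act_mem_degenerate (by omega) _ y), TensorProduct.tmul_zero,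
        smul_zero]

theorem awLin_shuffleProd (h : p + q = n) (a : (normChains K S.X).X p)
    (b : (normChains K S'.X).X q) :
    awLin K B.fst B.snd n (B.shuffleProd K p q n a b) =
      shuffleSign K (minHom p n) •
        tz (normChains K S.X) (normChains K S'.X) p q n (a ⊗ₜ b) := by
  have key : (B.shuffleProd K p q n).compr₂ (awLin K B.fst B.snd n) =
      shuffleSign K (minHom p n) • (TensorProduct.mk K _ _).compr₂
        (tz (normChains K S.X) (normChains K S'.X) p q n) :=
    bilin_ext fun x _ y _ => B.awLin_shuffleProd_cl h x y
  exact LinearMap.congr_fun (LinearMap.congr_fun key a) b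

variable [IsDomain K] [IsPrincipalIdealRing K]

/-- The preimage of `a ⊗ b` is the shuffle product times the sign of the sorted shuffle, which
occurs twice and so disappears. -/
theorem awOmegaLin_surjective : Function.Surjective (B.awOmegaLin K n) := by
  rw [← LinearMap.range_eq_top, eq_top_iff]
  intro t _
  rw [← sum_sumPairs_tz_comp (S.Omega K) (S'.Omega K) n t]
  refine Submodule.sum_mem _ fun r _ => ?_
  generalize comp (S.Omega K) (S'.Omega K) r.1.1 r.1.2 n t = s
  induction s using TensorProduct.induction_on with
  | zero => rw [map_zero]; exact zero_mem _
  | add s s' hs hs' => rw [map_add]; exact add_mem hs hs'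
  | tmul a b =>
    refine ⟨shuffleSign K (minHom r.1.1 n) •
      (⟨_, B.shuffleProd_mem_omega (n := n) a.2 b.2⟩ : omegaSubmodule _ _ n), ?_⟩
    apply tensorι_injective S S' n
    refine (B.tensorι_awOmegaLin _).trans ?_
    refine Eq.trans ?_ (tensorHom_tz (S.ι K) (S'.ι K) r.1.1 r.1.2 n (a ⊗ₜ b)).symm
    refine ((awLin K B.fst B.snd n).map_smul _ _).trans ?_
    refine (congrArg _ (B.awLin_shuffleProd r.2 a.1 b.1)).trans ?_
    rw [smul_smul, shuffleSign_mul_self, one_smul]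
    rfl

end IsBox

/-! ### The isomorphism and the Künneth sequence of a box product, with naturality -/

namespace IsBox

theorem awLin_naturality {K : Type u} [CommRing K] {S S' T L L' M : PathPair.{u}}
    [QuiverLike S] [QuiverLike S'] [QuiverLike L] [QuiverLike L'] (B : IsBox S S' T)
    (D : IsBox L L' M) (f : S.Hom L) (f' : S'.Hom L') (g : T.Hom M)
    (hfst : B.fst ≫ f.map = g.map ≫ D.fst)
    (hsnd : B.snd ≫ f'.map = g.map ≫ D.snd) {n : ℕ} (u : (normChains K T.X).X n) :
    (((SSet.normalizedChainComplexMap f.map (ModuleCat.of K K) ⊗ₘ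
      SSet.normalizedChainComplexMap f'.map (ModuleCat.of K K) :
        normChains K S.X ⊗ normChains K S'.X ⟶ normChains K L.X ⊗ normChains K L'.X).f n).hom
      (awLin K B.fst B.snd n u)) = awLin K D.fst D.snd n
        (((SSet.normalizedChainComplexMap g.map (ModuleCat.of K K)).f n).hom u) := by
  have key : ((SSet.normalizedChainComplexMap f.map (ModuleCat.of K K) ⊗ₘ
      SSet.normalizedChainComplexMap f'.map (ModuleCat.of K K) :
        normChains K S.X ⊗ normChains K S'.X ⟶ normChains K L.X ⊗ normChains K L'.X).f n).hom ∘ₗ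
      awLin K B.fst B.snd n = awLin K D.fst D.snd n ∘ₗ
        ((SSet.normalizedChainComplexMap g.map (ModuleCat.of K K)).f n).hom := by
    refine normChains_ext fun z _ => tensor_ext_comp fun i j h => ?_
    refine (comp_tensorHom _ _ h _).trans ?_
    refine (congrArg _ (comp_awLin_cl K B.fst B.snd h z)).trans ?_
    refine Eq.trans ?_ (congrArg (fun w => comp _ _ i j n (awLin K D.fst D.snd n w))
      (normMap_cl K g.map z)).symm
    refine Eq.trans ?_ (comp_awLin_cl K D.fst D.snd h _).symm
    refine (congrArg₂ (fun a b => a ⊗ₜ b) (normMap_cl K f.map _) (normMap_cl K f'.map _)).trans ?_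
    rw [app_act, app_act]
    have h1 : f.map.app _ (B.fst.app _ z) = D.fst.app _ (g.map.app _ z) :=
      ConcreteCategory.congr_hom (congrArg (fun φ : T.X ⟶ L.X => φ.app (.op ⦋n⦌)) hfst) z
    have h2 : f'.map.app _ (B.snd.app _ z) = D.snd.app _ (g.map.app _ z) :=
      ConcreteCategory.congr_hom (congrArg (fun φ : T.X ⟶ L'.X => φ.app (.op ⦋n⦌)) hsnd) z
    rw [h1, h2]
  exact LinearMap.congr_fun key u

variable (K : Type u) [CommRing K] [IsDomain K] [IsPrincipalIdealRing K]

section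

variable {S S' T : PathPair.{u}} (B : IsBox S S' T) [QuiverLike S] [QuiverLike S'] [QuiverLike T]

instance isIso_awOmega : IsIso (B.awOmega K) :=
  have (n : ℕ) : IsIso ((B.awOmega K).f n) :=
    (ConcreteCategory.isIso_iff_bijective _).2 ⟨B.awOmegaLin_injective, B.awOmegaLin_surjective⟩
  HomologicalComplex.Hom.isIso_of_components _

/-- The Eilenberg–Zilber isomorphism. -/
def omegaIso : T.Omega K ≅ S.Omega K ⊗ S'.Omega K := asIso (B.awOmega K)

/-- The cross product in the Künneth sequence of a box product. -/
def cross (n : ℕ) : kunnethTensor (S.Omega K) (S'.Omega K) n ⟶ (T.Omega K).homology n :=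
  kunnethCross (S.Omega K) (S'.Omega K) n ≫ HomologicalComplex.homologyMap (B.omegaIso K).inv n

/-- The map to the torsion term in the Künneth sequence of a box product. -/
def torMap (n : ℕ) : (T.Omega K).homology n ⟶ kunnethTor (S.Omega K) (S'.Omega K) n :=
  HomologicalComplex.homologyMap (B.omegaIso K).hom n ≫
    kunnethTorMapOut (S.Omega K) (S'.Omega K) n

theorem isShortExact (n : ℕ) : IsShortExact (B.cross K n) (B.torMap K n) := by
  obtain ⟨w, h⟩ := kunneth_isShortExact (S.Omega K) (S'.Omega K) n
  have h1 : HomologicalComplex.homologyMap (B.omegaIso K).inv n ≫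
      HomologicalComplex.homologyMap (B.omegaIso K).hom n = 𝟙 _ := by
    rw [← HomologicalComplex.homologyMap_comp, Iso.inv_hom_id,
      HomologicalComplex.homologyMap_id]
  have w' : B.cross K n ≫ B.torMap K n = 0 := by
    rw [cross, torMap, Category.assoc, reassoc_of% h1, w]
  refine ⟨w', ShortComplex.shortExact_of_iso (ShortComplex.isoMk (S₁ := ShortComplex.mk _ _ w)
    (S₂ := ShortComplex.mk _ _ w') (Iso.refl _)
    (HomologicalComplex.homologyMapIso (B.omegaIso K) n).symm (Iso.refl _) ?_ ?_) h⟩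
  · exact Category.id_comp _
  · change HomologicalComplex.homologyMap (B.omegaIso K).inv n ≫ B.torMap K n =
      kunnethTorMapOut (S.Omega K) (S'.Omega K) n ≫ 𝟙 _
    rw [torMap, reassoc_of% h1, Category.comp_id]

end

section Naturality

variable {S S' T L L' M : PathPair.{u}} (B : IsBox S S' T) (D : IsBox L L' M) [QuiverLike S]
  [QuiverLike S'] [QuiverLike T] [QuiverLike L] [QuiverLike L'] [QuiverLike M]
  (f : S.Hom L) (f' : S'.Hom L') (g : T.Hom M)

/-- Checked after the injective map `tensorι`, where it becomes naturality of the Alexander–Whitney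
map on all normalized chains. -/
theorem awOmega_naturality (hfst : B.fst ≫ f.map = g.map ≫ D.fst)
    (hsnd : B.snd ≫ f'.map = g.map ≫ D.snd) :
    B.awOmega K ≫ (f.omegaMap K ⊗ₘ f'.omegaMap K) = g.omegaMap K ≫ D.awOmega K := by
  refine HomologicalComplex.hom_ext _ _ fun n => ModuleCat.hom_ext (LinearMap.ext fun u => ?_)
  apply tensorι_injective L L' n
  have h1 : (f.omegaMap K ⊗ₘ f'.omegaMap K) ≫ tensorι K L L' =
      tensorι K S S' ≫ (SSet.normalizedChainComplexMap f.map (ModuleCat.of K K) ⊗ₘ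
      SSet.normalizedChainComplexMap f'.map (ModuleCat.of K K)) := by
    rw [tensorι, tensorι, tensorHom_comp_tensorHom, tensorHom_comp_tensorHom]
    rfl
  have h2 := LinearMap.congr_fun (congrArg ModuleCat.Hom.hom
    (congrArg (fun φ => HomologicalComplex.Hom.f φ n) h1)) (B.awOmegaLin K n u)
  refine h2.trans ?_
  refine (congrArg _ (B.tensorι_awOmegaLin u)).trans ?_
  refine (awLin_naturality B D f f' g hfst hsnd _).trans ?_
  exact (D.tensorι_awOmegaLin (((g.omegaMap K).f n).hom u)).symm

theorem omegaIso_inv_naturality (hfst : B.fst ≫ f.map = g.map ≫ D.fst)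
    (hsnd : B.snd ≫ f'.map = g.map ≫ D.snd) :
    (f.omegaMap K ⊗ₘ f'.omegaMap K) ≫ (D.omegaIso K).inv =
      (B.omegaIso K).inv ≫ g.omegaMap K := by
  rw [Iso.eq_inv_comp, ← Category.assoc, Iso.comp_inv_eq]
  exact awOmega_naturality K B D f f' g hfst hsnd

theorem cross_naturality (hfst : B.fst ≫ f.map = g.map ≫ D.fst)
    (hsnd : B.snd ≫ f'.map = g.map ≫ D.snd) (n : ℕ) :
    kunnethTensorMap (f.omegaMap K) (f'.omegaMap K) n ≫ D.cross K n =
      B.cross K n ≫ HomologicalComplex.homologyMap (g.omegaMap K) n := by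
  rw [cross, cross, ← Category.assoc, kunnethCross_naturality, Category.assoc, Category.assoc,
    ← HomologicalComplex.homologyMap_comp, ← HomologicalComplex.homologyMap_comp,
    omegaIso_inv_naturality K B D f f' g hfst hsnd]

theorem torMap_naturality (hfst : B.fst ≫ f.map = g.map ≫ D.fst)
    (hsnd : B.snd ≫ f'.map = g.map ≫ D.snd) (n : ℕ) :
    HomologicalComplex.homologyMap (g.omegaMap K) n ≫ D.torMap K n =
      B.torMap K n ≫ kunnethTorMap (f.omegaMap K) (f'.omegaMap K) n := by
  have h : g.omegaMap K ≫ (D.omegaIso K).hom =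
      (B.omegaIso K).hom ≫ (f.omegaMap K ⊗ₘ f'.omegaMap K) :=
    (awOmega_naturality K B D f f' g hfst hsnd).symm
  rw [torMap, torMap, ← Category.assoc, ← HomologicalComplex.homologyMap_comp, h,
    HomologicalComplex.homologyMap_comp, Category.assoc, kunnethTorMapOut_naturality,
    Category.assoc]

end Naturality

end IsBox

/-! ### Embedded quivers -/

section Nerve

variable {C : Type u} [Category.{v} C]

/-- The arrow which corresponds to an edge of the nerve. -/
def nerveArrow (e : (nerve C) _⦋1⦌) : Arrow C :=
  ComposableArrows.arrowEquiv (show ComposableArrows C 1 from e)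

theorem nerveArrow_injective : Function.Injective (nerveArrow (C := C)) :=
  ComposableArrows.arrowEquiv.injective

/-- The object which corresponds to a vertex of the nerve. -/
def nerveObj (v : (nerve C) _⦋0⦌) : C := (show ComposableArrows C 0 from v).obj 0

theorem nerveArrow_degEdge (v : (nerve C) _⦋0⦌) :
    nerveArrow (degEdge v) = Arrow.mk (𝟙 (nerveObj v)) :=
  congrArg Arrow.mk ((show ComposableArrows C 0 from v).map_id 0)

/-- A functor on a finite ordinal is determined by its objects and its consecutive morphisms. -/
instance : SpineDetermined (nerve C) where
  ext' n x y h h' := by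
    refine ComposableArrows.ext (F := show ComposableArrows C n from x)
      (G := show ComposableArrows C n from y) (fun a => congrArg nerveObj (h a)) fun i hi => ?_
    exact Functor.congr_hom (F := (show ComposableArrows C 1 from edge x ⟨i, hi⟩))
      (G := (show ComposableArrows C 1 from edge y ⟨i, hi⟩)) (h' ⟨i, hi⟩)
      (homOfLE (Fin.zero_le 1) : (0 : Fin 2) ⟶ 1)

variable (Q : SubquiverOf C)

theorem mem_paths_zero (v : (nerve C) _⦋0⦌) : v ∈ Q.paths 0 ↔ nerveObj v ∈ Q.vert :=
  ⟨fun h => h.1 0, fun h => ⟨fun i => by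
    obtain rfl : i = 0 := Subsingleton.elim (α := Fin 1) _ _
    exact h, fun i => i.elim0⟩⟩

theorem mem_paths_one (e : (nerve C) _⦋1⦌) : e ∈ Q.paths 1 ↔ nerveArrow e ∈ Q.arr := by
  refine ⟨fun h => h.2 0, fun h => ⟨fun i => ?_, fun i => ?_⟩⟩
  · fin_cases i
    · exact Q.left_mem _ h
    · exact Q.right_mem _ h
  · obtain rfl : i = 0 := Subsingleton.elim (α := Fin 1) _ _
    exact h

theorem exists_eq_degEdge_iff (e : (nerve C) _⦋1⦌) :
    (∃ v ∈ Q.paths 0, e = degEdge v) ↔ nerveArrow e ∈ Q.degArr := by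
  constructor
  · rintro ⟨v, hv, rfl⟩
    exact ⟨nerveObj v, (mem_paths_zero Q v).1 hv, nerveArrow_degEdge v⟩
  · rintro ⟨c, hc, h⟩
    refine ⟨ComposableArrows.mk₀ c, (mem_paths_zero Q _).2 hc, nerveArrow_injective ?_⟩
    exact h.trans (nerveArrow_degEdge (show (nerve C) _⦋0⦌ from ComposableArrows.mk₀ c)).symm

end Nerve

namespace EmbeddedQuiver

instance (E : EmbeddedQuiver.{v, u}) : QuiverLike E.pathPair where
  spineDetermined := inferInstanceAs (SpineDetermined (nerve E.C))
  mem_iff x := and_congr (forall_congr' fun a => (mem_paths_zero E.Q (vtx x a)).symm)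
    (forall_congr' fun i => (mem_paths_one E.Q (edge x i)).symm)

variable {E E' F : EmbeddedQuiver.{v, u}}

/-- An embedded quiver whose category is the product of two categories and whose vertices and
arrows are those of the box product is a box product. -/
def isBox (P : F.C ⥤ E.C) (P' : F.C ⥤ E'.C)
    (hP : ∀ n, Function.Bijective fun G : ComposableArrows F.C n => (G ⋙ P, G ⋙ P'))
    (hvert : ∀ c, c ∈ F.Q.vert ↔ P.obj c ∈ E.Q.vert ∧ P'.obj c ∈ E'.Q.vert)
    (harr : ∀ a, a ∈ F.Q.arr ↔
      (P.mapArrow.obj a ∈ E.Q.arr ∧ P'.mapArrow.obj a ∈ E'.Q.degArr) ∨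
        (P.mapArrow.obj a ∈ E.Q.degArr ∧ P'.mapArrow.obj a ∈ E'.Q.arr)) :
    IsBox E.pathPair E'.pathPair F.pathPair where
  fst := nerveMap P
  snd := nerveMap P'
  bijective := hP
  mem_zero z := by
    refine (mem_paths_zero F.Q z).trans ((hvert _).trans (and_congr ?_ ?_))
    · exact (mem_paths_zero E.Q ((nerveMap P).app _ z)).symm
    · exact (mem_paths_zero E'.Q ((nerveMap P').app _ z)).symm
  mem_one z := by
    refine (mem_paths_one F.Q z).trans ((harr _).trans
      (or_congr (and_congr ?_ ?_) (and_congr ?_ ?_)))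
    · exact (mem_paths_one E.Q ((nerveMap P).app _ z)).symm
    · exact (exists_eq_degEdge_iff E'.Q ((nerveMap P').app _ z)).symm
    · exact (exists_eq_degEdge_iff E.Q ((nerveMap P).app _ z)).symm
    · exact (mem_paths_one E'.Q ((nerveMap P').app _ z)).symm

/-- The box product of embedded quivers. -/
def boxIsBox (E E' : EmbeddedQuiver.{v, u}) :
    IsBox E.pathPair E'.pathPair (E.box E').pathPair :=
  isBox (F := E.box E') (CategoryTheory.Prod.fst E.C E'.C) (CategoryTheory.Prod.snd E.C E'.C)
    (fun n => ⟨fun G H h => by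
      have h1 : G = (G ⋙ CategoryTheory.Prod.fst E.C E'.C).prod'
        (G ⋙ CategoryTheory.Prod.snd E.C E'.C) := rfl
      have h2 : H = (H ⋙ CategoryTheory.Prod.fst E.C E'.C).prod'
        (H ⋙ CategoryTheory.Prod.snd E.C E'.C) := rfl
      rw [h1, h2]
      exact congrArg₂ Functor.prod' (congrArg Prod.fst h) (congrArg Prod.snd h),
      fun G => ⟨G.1.prod' G.2, rfl⟩⟩)
    (fun _ => Iff.rfl) (fun _ => Iff.rfl)

end EmbeddedQuiver

/-! ### Digraphs and pointed subsets of groups -/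

namespace DiagDigraph

theorem mem_degArr_iff (G : DiagDigraph.{u}) (a : Arrow (Codiscrete G.V)) :
    a ∈ G.embeddedQuiver.Q.degArr ↔ a.left.as = a.right.as := by
  constructor
  · rintro ⟨c, _, rfl⟩
    rfl
  · obtain ⟨⟨x⟩, ⟨y⟩, f⟩ := a
    intro h
    obtain rfl : x = y := h
    exact ⟨_, Set.mem_univ _, rfl⟩

theorem codiscrete_functor_ext {C : Type*} [Category C] {V : Type*} {F G : C ⥤ Codiscrete V}
    (h : ∀ c, (F.obj c).as = (G.obj c).as) : F = G :=
  CategoryTheory.Functor.ext fun c => Codiscrete.ext (h c)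

/-- The box product of digraphs. -/
def boxIsBox (G G' : DiagDigraph.{u}) :
    IsBox G.embeddedQuiver.pathPair G'.embeddedQuiver.pathPair (G.box G').embeddedQuiver.pathPair :=
  EmbeddedQuiver.isBox (F := (G.box G').embeddedQuiver) (E := G.embeddedQuiver)
    (E' := G'.embeddedQuiver) (Codiscrete.functorOfFun Prod.fst) (Codiscrete.functorOfFun Prod.snd)
    -- A functor to a codiscrete category is a function on objects, so functors to the codiscrete
    -- category on pairs are pairs of functors; no product category enters.
    (fun n => ⟨fun _ _ h => codiscrete_functor_ext fun c => Prod.ext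
        (congrArg (fun F : ComposableArrows (Codiscrete G.V) n => (F.obj c).as)
          (congrArg Prod.fst h))
        (congrArg (fun F : ComposableArrows (Codiscrete G'.V) n => (F.obj c).as)
          (congrArg Prod.snd h)),
      fun H => ⟨Codiscrete.functor fun c =>
        (((show ComposableArrows (Codiscrete G.V) n from H.1).obj c).as,
          ((show ComposableArrows (Codiscrete G'.V) n from H.2).obj c).as), rfl⟩⟩)
    (fun _ => ⟨fun _ => ⟨Set.mem_univ _, Set.mem_univ _⟩, fun _ => Set.mem_univ _⟩)
    (fun a => or_congr
      (and_congr Iff.rfl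
        (mem_degArr_iff G' ((Codiscrete.functorOfFun Prod.snd).mapArrow.obj a)).symm)
      (and_congr (mem_degArr_iff G ((Codiscrete.functorOfFun Prod.fst).mapArrow.obj a)).symm
        Iff.rfl))

end DiagDigraph

namespace PointedSubset

theorem mem_degArr_iff (P : PointedSubset.{u}) (a : Arrow (SingleObj P.G)) :
    a ∈ P.embeddedQuiver.Q.degArr ↔ (show P.G from a.hom) = 1 := by
  constructor
  · rintro ⟨c, _, rfl⟩
    rfl
  · obtain ⟨x, y, f⟩ := a
    rintro h
    refine ⟨x, Set.mem_univ _, ?_⟩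
    obtain rfl : y = x := Subsingleton.elim (α := Unit) _ _
    exact congrArg Arrow.mk h

theorem singleObj_functor_ext {C : Type*} [Category C] {G : Type*} [Monoid G]
    {F H : C ⥤ SingleObj G}
    (h : ∀ {c d : C} (f : c ⟶ d), (show G from F.map f) = (show G from H.map f)) : F = H := by
  refine Functor.hext (fun c => Subsingleton.elim (α := Unit) _ _) fun c d f => ?_
  exact heq_of_eq (h f)

/-- The wedge of pointed subsets of groups. -/
def wedgeIsBox (P P' : PointedSubset.{u}) :
    IsBox P.embeddedQuiver.pathPair P'.embeddedQuiver.pathPair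
      (P.wedge P').embeddedQuiver.pathPair :=
  EmbeddedQuiver.isBox (F := (P.wedge P').embeddedQuiver) (E := P.embeddedQuiver)
    (E' := P'.embeddedQuiver) (MonoidHom.fst P.G P'.G).toFunctor (MonoidHom.snd P.G P'.G).toFunctor
    -- A functor to a one-object category is determined by its values on morphisms, and a pair of
    -- such functors is assembled componentwise in the product group.
    (fun n => ⟨fun _ _ h => singleObj_functor_ext fun f => Prod.ext
        (congrArg (fun F : ComposableArrows (SingleObj P.G) n => (show P.G from F.map f))
          (congrArg Prod.fst h))
        (congrArg (fun F : ComposableArrows (SingleObj P'.G) n => (show P'.G from F.map f))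
          (congrArg Prod.snd h)),
      fun H => ⟨
        { obj := fun _ => SingleObj.star (P.G × P'.G)
          map := fun f =>
            (((show ComposableArrows (SingleObj P.G) n from H.1).map f : P.G),
              ((show ComposableArrows (SingleObj P'.G) n from H.2).map f : P'.G))
          map_id := fun c => Prod.ext
            ((show ComposableArrows (SingleObj P.G) n from H.1).map_id c)
            ((show ComposableArrows (SingleObj P'.G) n from H.2).map_id c)
          map_comp := fun f g => Prod.ext
            ((show ComposableArrows (SingleObj P.G) n from H.1).map_comp f g)
            ((show ComposableArrows (SingleObj P'.G) n from H.2).map_comp f g) }, rfl⟩⟩)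
    (fun _ => ⟨fun _ => ⟨Set.mem_univ _, Set.mem_univ _⟩, fun _ => Set.mem_univ _⟩)
    (fun a => or_congr
      (and_congr Iff.rfl
        (mem_degArr_iff P' ((MonoidHom.snd P.G P'.G).toFunctor.mapArrow.obj a)).symm)
      (and_congr (mem_degArr_iff P ((MonoidHom.fst P.G P'.G).toFunctor.mapArrow.obj a)).symm
        Iff.rfl))

variable {P P' L L' : PointedSubset.{u}} (f : P.Hom L) (f' : P'.Hom L')

theorem wedgeIsBox_fst_naturality :
    (P.wedgeIsBox P').fst ≫ f.embeddedQuiverHom.pathPairHom.map =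
      (f.wedge f').embeddedQuiverHom.pathPairHom.map ≫ (L.wedgeIsBox L').fst := rfl

theorem wedgeIsBox_snd_naturality :
    (P.wedgeIsBox P').snd ≫ f'.embeddedQuiverHom.pathPairHom.map =
      (f.wedge f').embeddedQuiverHom.pathPairHom.map ≫ (L.wedgeIsBox L').snd := rfl

end PointedSubset

end

end GLMY

/-! ### The theorem for embedded quivers, digraphs and pointed subsets of groups -/

theorem mainTheorem8 (K : Type u) [CommRing K] [IsDomain K] [IsPrincipalIdealRing K] :
    -- embedded quivers
    (∀ E E' : GLMY.EmbeddedQuiver.{u, u},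
      Nonempty ((E.box E').Omega K ≅ E.Omega K ⊗ E'.Omega K) ∧
      ∀ n : ℕ, ∃ (a : GLMY.kunnethTensor (E.Omega K) (E'.Omega K) n ⟶
            ((E.box E').Omega K).homology n)
          (b : ((E.box E').Omega K).homology n ⟶
            GLMY.kunnethTor (E.Omega K) (E'.Omega K) n),
        GLMY.IsShortExact a b) ∧
    -- digraphs
    (∀ G G' : GLMY.DiagDigraph.{u},
      Nonempty ((G.box G').Omega K ≅ G.Omega K ⊗ G'.Omega K) ∧
      ∀ n : ℕ, ∃ (a : GLMY.kunnethTensor (G.Omega K) (G'.Omega K) n ⟶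
            ((G.box G').Omega K).homology n)
          (b : ((G.box G').Omega K).homology n ⟶
            GLMY.kunnethTor (G.Omega K) (G'.Omega K) n),
        GLMY.IsShortExact a b) ∧
    -- pointed subsets of groups
    (∀ P P' : GLMY.PointedSubset.{u},
      Nonempty ((P.wedge P').Omega K ≅ P.Omega K ⊗ P'.Omega K)) ∧
    ∃ (a : ∀ (P P' : GLMY.PointedSubset.{u}) (n : ℕ),
          GLMY.kunnethTensor (P.Omega K) (P'.Omega K) n ⟶ ((P.wedge P').Omega K).homology n)
        (b : ∀ (P P' : GLMY.PointedSubset.{u}) (n : ℕ),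
          ((P.wedge P').Omega K).homology n ⟶ GLMY.kunnethTor (P.Omega K) (P'.Omega K) n),
      (∀ (P P' : GLMY.PointedSubset.{u}) (n : ℕ), GLMY.IsShortExact (a P P' n) (b P P' n)) ∧
      ∀ (P P' L L' : GLMY.PointedSubset.{u}) (f : P.Hom L) (f' : P'.Hom L') (n : ℕ),
        GLMY.kunnethTensorMap (f.omegaMap K) (f'.omegaMap K) n ≫ a L L' n =
            a P P' n ≫ HomologicalComplex.homologyMap ((f.wedge f').omegaMap K) n ∧
          HomologicalComplex.homologyMap ((f.wedge f').omegaMap K) n ≫ b L L' n =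
            b P P' n ≫ GLMY.kunnethTorMap (f.omegaMap K) (f'.omegaMap K) n := by
  refine ⟨fun E E' => ⟨⟨(E.boxIsBox E').omegaIso K⟩, fun n => ⟨_, _,
      (E.boxIsBox E').isShortExact K n⟩⟩,
    fun G G' => ⟨⟨(G.boxIsBox G').omegaIso K⟩, fun n => ⟨_, _,
      (G.boxIsBox G').isShortExact K n⟩⟩,
    fun P P' => ⟨(P.wedgeIsBox P').omegaIso K⟩,
    fun P P' n => (P.wedgeIsBox P').cross K n, fun P P' n => (P.wedgeIsBox P').torMap K n,
    fun P P' n => (P.wedgeIsBox P').isShortExact K n, fun P P' L L' f f' n => ⟨?_, ?_⟩⟩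
  · exact GLMY.IsBox.cross_naturality K (P.wedgeIsBox P') (L.wedgeIsBox L')
      f.embeddedQuiverHom.pathPairHom f'.embeddedQuiverHom.pathPairHom
      (f.wedge f').embeddedQuiverHom.pathPairHom
      (GLMY.PointedSubset.wedgeIsBox_fst_naturality f f') (GLMY.PointedSubset.wedgeIsBox_snd_naturality f f') n
  · exact GLMY.IsBox.torMap_naturality K (P.wedgeIsBox P') (L.wedgeIsBox L')
      f.embeddedQuiverHom.pathPairHom f'.embeddedQuiverHom.pathPairHom
      (f.wedge f').embeddedQuiverHom.pathPairHom
      (GLMY.PointedSubset.wedgeIsBox_fst_naturality f f') (GLMY.PointedSubset.wedgeIsBox_snd_naturality f f') n
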